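/- Let a convex body in $\mathbb{R}^2$ be a compact convex set with nonempty interior. For convex bodies $K,T\subset\mathbb{R}^2$ let $C=K\times T\subset\mathbb{R}^2\times\mathbb{R}^2=\mathbb{R}^4$ be their Lagrangian product. If the origin is an interior point of $C$, let $\mu_C$ be the Minkowski functional of $C$ and $\partial\mu_C$ its subdifferential, and let $J=\begin{pmatrix}0&\mathbb{1}\\-\mathbb{1}&0\end{pmatrix}$. A closed characteristic on $\partial C$ is an absolutely continuous loop $x:\mathbb{R}/\mathbb{Z}\to\mathbb{R}^4$ with $\mu_C(x(t))=1$ for all $t$ and $\dot x(t)\in\mathbb{R}_{>0}\,J\,\partial\mu_C(x(t))$ for almost every $t$; its action is $\mathbb{A}(x)=-\frac12\int_0^1\langle J\dot x(t),x(t)\rangle\,dt$. The EHZ-capacity $c_{EHZ}(C)$ is the minimum of $\mathbb{A}(x)$ over all closed characteristics $x$ on $\partial C$. For general $K$ and $T$ it is defined by translating $C$ so that the origin becomes an interior point (the value does not depend on the translation). We call $K\times T$ an equality case (of Viterbo's conjecture) if $$\mathrm{vol}(K\times T)=\frac{c_{EHZ}(K\times T)^2}{2}.$$ We say that $T$ is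 a scaled translate of $S$ if $T=rS+s$ for some $r>0$ and $s\in\mathbb{R}^2$. In $\mathbb{R}^2$ write $J(a,b)=(b,-a)$. All triangles, quadrilaterals and parallelograms are nondegenerate and filled. A trapezoid is a triangle or a quadrilateral with at least one pair of parallel sides. (i) Let $\Delta\subset\mathbb{R}^2$ be any triangle, and let $\mathcal{T}_\Delta$ be the set of all $\mathrm{conv}\{J\Delta,-J\Delta+t\}$ for which $t\in\mathbb{R}^2$ minimizes $\mathrm{vol}(\mathrm{conv}\{J\Delta,-J\Delta+\tilde t\})$ over all $\tilde t\in\mathbb{R}^2$. Then, for $T\subset\mathbb{R}^2$, $\Delta\times T$ is an equality case if and only if $T$ is a scaled translate of a member of $\mathcal{T}_\Delta$. (ii) For $a_1,a_2\in[0,1]$ let $\diamondsuit(a_1,a_2)=\mathrm{conv}\big((\{a_1\}\times[0,1])\cup([0,1]\times\{a_2\})\big)$. Let $\square\subset\mathbb{R}^2$ be any square with sides parallel to the coordinate axes. Then, for $T\subset\mathbb{R}^2$, $\square\times T$ is an equality case if and only if $T$ is a scaled translate of $\diamondsuit(a_1,a_2)$ for some $a_1,a_2\in[0,1]$. (iii)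 Let $Q\subset\mathbb{R}^2$ be any trapezoid which is neither a triangle nor a parallelogram. Then there is a parallelogram $P\subset\mathbb{R}^2$ such that, for $T\subset\mathbb{R}^2$, $Q\times T$ is an equality case if and only if $T$ is a scaled translate of $P$. Moreover, $P$ can be chosen as $P=(\phi^{T})^{-1}([0,1]^2)$, where $\phi$ is a linear automorphism of $\mathbb{R}^2$ with $Q=\phi(\diamondsuit(a_1,a_2))+c$ for some $a_1,a_2\in[0,1]$ and $c\in\mathbb{R}^2$. -/

import Mathlib

open MeasureTheory Set
open scoped Pointwise

noncomputable section

namespace Viterbo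

/-- The Euclidean plane. -/
abbrev Plane : Type := EuclideanSpace ℝ (Fin 2)

/-- The phase space `ℝ⁴ = ℝ²(x) × ℝ²(y)`. Only its linear and topological structure, its product
Lebesgue measure and the Euclidean inner product `dot` below are used. -/
abbrev Phase : Type := Plane × Plane

/-- The Euclidean inner product of `ℝ⁴`. -/
def dot (z w : Phase) : ℝ := inner ℝ z.1 w.1 + inner ℝ z.2 w.2

/-- The symplectic matrix of `ℝ⁴`: `J (x, y) = (y, -x)`. -/
def J4 (z : Phase) : Phase := (z.2, -z.1)

/-- The symplectic matrix of `ℝ²`: `J (a, b) = (b, -a)`. -/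
def J2 (v : Plane) : Plane := !₂[v 1, -v 0]

/-- Compact convex subsets of the plane with nonempty interior. -/
def IsConvexBody (K : Set Plane) : Prop :=
  IsCompact K ∧ Convex ℝ K ∧ (interior K).Nonempty

/-- The subdifferential of `f : ℝ⁴ → ℝ` at `z`. -/
def subdifferential (f : Phase → ℝ) (z : Phase) : Set Phase :=
  {n | ∀ w, f z + dot n (w - z) ≤ f w}

/-- `x`, restricted to `[0, 1]`, is a (generalized) closed characteristic on the boundary of `C`,
where the origin is an interior point of the compact convex set `C`. -/
structure IsClosedCharacteristic (C : Set Phase) (x : ℝ → Phase) : Prop where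
  absCont : AbsolutelyContinuousOnInterval x 0 1
  closed : x 0 = x 1
  velocity : ∀ᵐ t : ℝ, t ∈ Ioo (0 : ℝ) 1 →
    ∃ r : ℝ, 0 < r ∧ ∃ n ∈ subdifferential (gauge C) (x t), HasDerivAt x (r • J4 n) t
  boundary : ∀ t ∈ Icc (0 : ℝ) 1, gauge C (x t) = 1

/-- The action of a loop. -/
def action (x : ℝ → Phase) : ℝ :=
  -(1 / 2) * ∫ t in (0 : ℝ)..1, dot (J4 (deriv x t)) (x t)

/-- `c` is the EHZ-capacity of the compact convex set `C`: the minimal action of the closed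
characteristics on its boundary. Since the gauge function refers to an origin inside `C`, an
interior point `z` of `C` is translated to the origin; neither the characteristics, seen as loops
on the boundary of `C`, nor their actions depend on the choice of `z`. -/
def IsEHZCapacity (C : Set Phase) (c : ℝ) : Prop :=
  IsLeast {A : ℝ | ∃ z ∈ interior C, ∃ x : ℝ → Phase,
    IsClosedCharacteristic (-z +ᵥ C) x ∧ action x = A} c

/-- The Lagrangian product `K × T` of two convex bodies is an equality case of Viterbo's
conjecture: `vol (K × T) = c_EHZ (K × T) ^ 2 / 2`. -/
def IsEqualityCase (K T : Set Plane) : Prop :=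
  IsConvexBody K ∧ IsConvexBody T ∧
    ∃ c : ℝ, IsEHZCapacity (K ×ˢ T) c ∧ volume.real (K ×ˢ T) = c ^ 2 / 2

/-- `T` arises from `S` by scaling and translation. -/
def IsScaledTranslate (S T : Set Plane) : Prop :=
  ∃ r : ℝ, 0 < r ∧ ∃ s : Plane, T = s +ᵥ r • S

/-- Nondegenerate triangles. -/
def IsTriangle (D : Set Plane) : Prop :=
  ∃ v : Fin 3 → Plane, AffineIndependent ℝ v ∧ D = convexHull ℝ (range v)

/-- Nondegenerate parallelograms. -/
def IsParallelogram (P : Set Plane) : Prop :=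
  ∃ a u v : Plane, LinearIndependent ℝ ![u, v] ∧
    P = convexHull ℝ {a, a + u, a + u + v, a + v}

/-- Trapezoids: triangles, and quadrilaterals with consecutive vertices `a, b, c, d` whose sides
`ab` and `dc` are parallel. -/
def IsTrapezoid (Q : Set Plane) : Prop :=
  IsTriangle Q ∨
    ∃ a b c d : Plane, AffineIndependent ℝ ![a, b, d] ∧
      (∃ l : ℝ, 0 < l ∧ c - d = l • (b - a)) ∧ Q = convexHull ℝ {a, b, c, d}

/-- Squares with sides parallel to the coordinate axes. -/
def IsAxisParallelSquare (S : Set Plane) : Prop :=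
  ∃ x y a : ℝ, 0 < a ∧ S = {p | p 0 ∈ Icc x (x + a) ∧ p 1 ∈ Icc y (y + a)}

/-- The unit square `[0, 1] × [0, 1]`. -/
def unitSquare : Set Plane := {p | p 0 ∈ Icc (0 : ℝ) 1 ∧ p 1 ∈ Icc (0 : ℝ) 1}

/-- The diamond in basic form: the convex hull of `{a₁} × [0, 1]` and `[0, 1] × {a₂}`. -/
def diamond (a₁ a₂ : ℝ) : Set Plane :=
  convexHull ℝ ({p | p 0 = a₁ ∧ p 1 ∈ Icc (0 : ℝ) 1} ∪ {p | p 0 ∈ Icc (0 : ℝ) 1 ∧ p 1 = a₂})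

/-- The convex hull of `J D` and `-J D + t`. -/
def doubleHull (D : Set Plane) (t : Plane) : Set Plane :=
  convexHull ℝ (J2 '' D ∪ (t +ᵥ -(J2 '' D)))

/-- The set of the volume-minimizing convex hulls of `J D` and `-J D + t`, `t ∈ ℝ²`. -/
def minimalHulls (D : Set Plane) : Set (Set Plane) :=
  {T | ∃ t : Plane, (∀ t' : Plane, volume (doubleHull D t) ≤ volume (doubleHull D t')) ∧
    T = doubleHull D t}

/-- `Q` is the image of a diamond in basic form under an affine map with linear part `φ`, and `P`
is the image of the unit square under the inverse transpose of `φ`. -/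
def IsDualParallelogram (Q P : Set Plane) : Prop :=
  ∃ (φ : Plane ≃ₗ[ℝ] Plane) (c : Plane) (a₁ a₂ : ℝ), a₁ ∈ Icc (0 : ℝ) 1 ∧ a₂ ∈ Icc (0 : ℝ) 1 ∧
    Q = c +ᵥ (φ '' diamond a₁ a₂) ∧
    P = LinearMap.adjoint (φ.symm : Plane →ₗ[ℝ] Plane) '' unitSquare

end Viterbo

end

noncomputable section

namespace Viterbo

/-! ### Areas in the plane -/

/-- The determinant of two vectors of the plane. -/
def cross (u v : Plane) : ℝ := u 0 * v 1 - u 1 * v 0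

lemma continuous_cross (u : Plane) : Continuous (cross u) := by
  unfold cross; fun_prop

/-- The linear map sending the standard basis to `u, v`. -/
def basisMap (u v : Plane) : Plane →ₗ[ℝ] Plane where
  toFun x := x 0 • u + x 1 • v
  map_add' x y := by simp only [PiLp.add_apply]; module
  map_smul' r x := by simp only [PiLp.smul_apply, smul_eq_mul, RingHom.id_apply]; module

lemma basisMap_apply (u v x : Plane) : basisMap u v x = x 0 • u + x 1 • v := rfl

lemma det_basisMap (u v : Plane) : LinearMap.det (basisMap u v) = cross u v := by
  rw [← LinearMap.det_toMatrix (EuclideanSpace.basisFun (Fin 2) ℝ).toBasis, Matrix.det_fin_two]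
  simp [LinearMap.toMatrix_apply, basisMap_apply, cross]
  ring

lemma volume_real_image (f : Plane →ₗ[ℝ] Plane) (S : Set Plane) :
    volume.real (f '' S) = |LinearMap.det f| * volume.real S := by
  simp [Measure.real, Measure.addHaar_image_linearMap]

lemma volume_real_vadd (s : Plane) (S : Set Plane) : volume.real (s +ᵥ S) = volume.real S := by
  simp [Measure.real, measure_vadd]

lemma volume_real_smul (r : ℝ) (S : Set Plane) :
    volume.real (r • S) = r ^ 2 * volume.real S := by
  simp [Measure.real, Measure.addHaar_smul, sq_nonneg]

lemma volume_unitSquare : volume unitSquare = 1 := by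
  have h := (EuclideanSpace.volume_preserving_symm_measurableEquiv_toLp (Fin 2)).symm
  have h2 : unitSquare = (MeasurableEquiv.toLp 2 (Fin 2 → ℝ)).symm ⁻¹' (Icc (0 : Fin 2 → ℝ) 1) := by
    ext x
    simp [unitSquare, Pi.le_def, Fin.forall_fin_two]
    tauto
  rw [h2, (EuclideanSpace.volume_preserving_symm_measurableEquiv_toLp
    (Fin 2)).measure_preimage_equiv, Real.volume_Icc_pi]
  simp

lemma volume_real_unitSquare : volume.real unitSquare = 1 := by
  simp [Measure.real, volume_unitSquare]

lemma volume_line {u : Plane} (hu : u ≠ 0) (r : ℝ) : volume {x : Plane | cross u x = r} = 0 := by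
  let f : Plane →ₗ[ℝ] ℝ :=
    { toFun := cross u
      map_add' := fun x y => by simp only [cross, PiLp.add_apply]; ring
      map_smul' := fun r x => by
        simp only [cross, PiLp.smul_apply, smul_eq_mul, RingHom.id_apply]; ring }
  have hf : f ≠ 0 := by
    intro h
    apply hu
    have h0 : cross u !₂[1, 0] = 0 := LinearMap.congr_fun h _
    have h1 : cross u !₂[0, 1] = 0 := LinearMap.congr_fun h _
    simp [cross] at h0 h1
    ext i; fin_cases i <;> simp [h0, h1]
  obtain ⟨x₀, hx₀⟩ : ∃ x₀, f x₀ = r := (LinearMap.surjective_iff_ne_zero.2 hf) r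
  have h1 : {x : Plane | cross u x = r} = x₀ +ᵥ (LinearMap.ker f : Set Plane) := by
    ext x
    rw [mem_vadd_set_iff_neg_vadd_mem]
    simp only [mem_ofPred_eq, vadd_eq_add, SetLike.mem_coe, LinearMap.mem_ker, map_add, map_neg, hx₀]
    change f x = r ↔ _
    constructor <;> intro h <;> linarith
  rw [h1, measure_vadd]
  exact Measure.addHaar_submodule _ _ (by rwa [Ne, LinearMap.ker_eq_top])

lemma volume_real_split {H : Set Plane} (hH : volume H ≠ ⊤) {u : Plane} (hu : u ≠ 0) (r : ℝ) :
    volume.real (H ∩ {x | cross u x ≤ r}) + volume.real (H ∩ {x | r ≤ cross u x}) =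
      volume.real H := by
  have hm : MeasurableSet {x : Plane | cross u x ≤ r} :=
    (isClosed_le (continuous_cross u) continuous_const).measurableSet
  rw [← measureReal_inter_add_sdiff₀ (s := H) hm.nullMeasurableSet hH]
  congr 1
  apply measureReal_congr
  have h0 : ∀ᵐ x : Plane, cross u x ≠ r := by
    rw [ae_iff]; simpa using volume_line hu r
  filter_upwards [h0] with x hx
  apply propext
  change (x ∈ H ∧ r ≤ cross u x) ↔ (x ∈ H ∧ ¬ (cross u x ≤ r))
  rw [not_le, le_iff_lt_or_eq]
  constructor
  · rintro ⟨h1, h2 | h2⟩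
    exacts [⟨h1, h2⟩, absurd h2.symm hx]
  · rintro ⟨h1, h2⟩
    exact ⟨h1, Or.inl h2⟩

/-- The standard triangle. -/
def stdTriangle : Set Plane := {x | 0 ≤ x 0 ∧ 0 ≤ x 1 ∧ x 0 + x 1 ≤ 1}

lemma unitSquare_volume_ne_top : volume unitSquare ≠ ⊤ := by simp [volume_unitSquare]

lemma volume_real_stdTriangle : volume.real stdTriangle = 1 / 2 := by
  have h := volume_real_split unitSquare_volume_ne_top (u := !₂[1, -1])
    (by intro h; simpa using congrArg (fun x : Plane => x 0) h) 1
  have e1 : unitSquare ∩ {x | cross !₂[1, -1] x ≤ 1} = stdTriangle := by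
    ext x
    simp only [unitSquare, stdTriangle, cross, mem_inter_iff, mem_ofPred_eq, mem_Icc]
    simp
    constructor
    · rintro ⟨⟨⟨h1, h2⟩, h3, h4⟩, h5⟩; exact ⟨h1, h3, by linarith⟩
    · rintro ⟨h1, h2, h3⟩; refine ⟨⟨⟨h1, by linarith⟩, h2, by linarith⟩, by linarith⟩
  have e2 : unitSquare ∩ {x | 1 ≤ cross !₂[1, -1] x} = !₂[(1 : ℝ), 1] +ᵥ (-1 : ℝ) • stdTriangle := by
    ext x
    rw [mem_vadd_set_iff_neg_vadd_mem, mem_smul_set_iff_inv_smul_mem₀ (by norm_num)]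
    simp only [unitSquare, stdTriangle, cross, mem_inter_iff, mem_ofPred_eq, mem_Icc]
    simp
    constructor
    · rintro ⟨⟨⟨h1, h2⟩, h3, h4⟩, h5⟩; exact ⟨h2, h4, by linarith⟩
    · rintro ⟨h1, h2, h3⟩; refine ⟨⟨⟨by linarith, by linarith⟩, by linarith, by linarith⟩, by linarith⟩
  rw [e1, e2, volume_real_vadd, volume_real_smul, volume_real_unitSquare] at h
  linarith

lemma mem_convexHull_triple {a b c x : Plane} :
    x ∈ convexHull ℝ {a, b, c} ↔
      ∃ s t : ℝ, 0 ≤ s ∧ 0 ≤ t ∧ s + t ≤ 1 ∧ x = a + (s • (b - a) + t • (c - a)) := by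
  rw [convexHull_insert (by simp), convexHull_pair]
  simp only [convexJoin_singleton_left, mem_iUnion, segment_eq_image', mem_image]
  constructor
  · rintro ⟨_, ⟨θ, hθ, rfl⟩, η, hη, rfl⟩
    refine ⟨η * (1 - θ), η * θ, mul_nonneg hη.1 (by linarith [hθ.2]), mul_nonneg hη.1 hθ.1,
      by nlinarith [hη.2], by module⟩
  · rintro ⟨s, t, hs, ht, hst, rfl⟩
    rcases eq_or_lt_of_le (add_nonneg hs ht) with h | h
    · have hs0 : s = 0 := by linarith
      have ht0 : t = 0 := by linarith
      subst hs0; subst ht0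
      exact ⟨b, ⟨0, by simp, by simp⟩, 0, by simp, by simp⟩
    · refine ⟨_, ⟨t / (s + t), ⟨by positivity, by rw [div_le_one h]; linarith⟩, rfl⟩,
        s + t, ⟨h.le, hst⟩, ?_⟩
      have : s + t ≠ 0 := h.ne'
      have e : (s + t) * (t / (s + t)) = t := by field_simp
      have e2 : a + (s + t) • (b + (t / (s + t)) • (c - b) - a) =
        a + ((s + t) • (b - a) + ((s + t) * (t / (s + t))) • (c - b)) := by module
      rw [e2, e]; module

lemma volume_real_triangle (a b c : Plane) :
    volume.real (convexHull ℝ {a, b, c}) = |cross (b - a) (c - a)| / 2 := by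
  have h : convexHull ℝ {a, b, c} = a +ᵥ (basisMap (b - a) (c - a) '' stdTriangle) := by
    ext x
    rw [mem_convexHull_triple, mem_vadd_set]
    constructor
    · rintro ⟨s, t, hs, ht, hst, rfl⟩
      refine ⟨_, ⟨!₂[s, t], ?_, rfl⟩, ?_⟩
      · simp [stdTriangle, hs, ht, hst]
      · simp [basisMap_apply]
    · rintro ⟨_, ⟨y, hy, rfl⟩, rfl⟩
      exact ⟨y 0, y 1, hy.1, hy.2.1, hy.2.2, rfl⟩
  rw [h, volume_real_vadd, volume_real_image, det_basisMap, volume_real_stdTriangle]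
  ring

lemma triangle_le {H : Set Plane} (hc : Convex ℝ H) (hH : volume H ≠ ⊤) {a b c : Plane}
    (ha : a ∈ H) (hb : b ∈ H) (hc' : c ∈ H) : |cross (b - a) (c - a)| / 2 ≤ volume.real H := by
  rw [← volume_real_triangle]
  refine measureReal_mono (convexHull_min ?_ hc) hH
  rintro x (rfl | rfl | rfl) <;> assumption

lemma cross_sub (u x y : Plane) : cross u (x - y) = cross u x - cross u y := by
  simp only [cross, PiLp.sub_apply]; ring

lemma cross_add (u x y : Plane) : cross u (x + y) = cross u x + cross u y := by
  simp only [cross, PiLp.add_apply]; ring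

lemma cross_smul (u : Plane) (r : ℝ) (x : Plane) : cross u (r • x) = r * cross u x := by
  simp only [cross, PiLp.smul_apply, smul_eq_mul]; ring

lemma isLinearMap_cross (u : Plane) : IsLinearMap ℝ (cross u) :=
  ⟨cross_add u, cross_smul u⟩

lemma volume_inter_ne_top {H : Set Plane} (hH : volume H ≠ ⊤) (S : Set Plane) :
    volume (H ∩ S) ≠ ⊤ := measure_ne_top_of_subset inter_subset_left hH

/-- Cutting a triangle off a convex set along a line through two of its points. -/
lemma cut_le {H : Set Plane} (hc : Convex ℝ H) (hH : volume H ≠ ⊤) {a b c : Plane}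
    (ha : a ∈ H) (hb : b ∈ H) (hc' : c ∈ H) :
    volume.real (H ∩ {x | 0 ≤ cross (b - a) (x - a)}) - cross (b - a) (c - a) / 2 ≤
      volume.real H := by
  rcases le_or_gt 0 (cross (b - a) (c - a)) with h | h
  · have := measureReal_mono (μ := volume)
      (inter_subset_left (s := H) (t := {x | 0 ≤ cross (b - a) (x - a)})) hH
    linarith
  · have hu : b - a ≠ 0 := by rintro h0; simp [h0, cross] at h
    rw [← volume_real_split hH hu (cross (b - a) a)]
    have e : {x | 0 ≤ cross (b - a) (x - a)} = {x | cross (b - a) a ≤ cross (b - a) x} := by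
      ext x; simp [cross_sub]
    rw [e]
    have h1 := triangle_le (H := H ∩ {x | cross (b - a) x ≤ cross (b - a) a})
      (hc.inter (convex_halfSpace_le (isLinearMap_cross _) _)) (volume_inter_ne_top hH _)
      (a := a) (b := b) (c := c) ⟨ha, by simp only [mem_ofPred_eq, le_refl]⟩
      ⟨hb, by simp only [mem_ofPred_eq]; simp only [cross, PiLp.sub_apply]; apply le_of_eq; ring⟩
      ⟨hc', by rw [cross_sub] at h; simp only [mem_ofPred_eq]; linarith⟩
    rw [abs_of_neg h] at h1
    linarith

/-- The area of a convex set is bounded below by the area spanned by two of its chords. -/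
lemma quad_le {H : Set Plane} (hc : Convex ℝ H) (hH : volume H ≠ ⊤) {a b c d : Plane}
    (ha : a ∈ H) (hb : b ∈ H) (hc' : c ∈ H) (hd : d ∈ H) :
    |cross (c - a) (d - b)| / 2 ≤ volume.real H := by
  have e : cross (c - a) (d - b) = cross (c - a) (d - a) - cross (c - a) (b - a) := by
    simp only [cross, PiLp.sub_apply]; ring
  have key : ∀ p q : Plane, p ∈ H → q ∈ H →
      (cross (c - a) (p - a) - cross (c - a) (q - a)) / 2 ≤ volume.real H := by
    intro p q hp hq
    have hp1 := triangle_le hc hH ha hc' hp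
    have hq1 := triangle_le hc hH ha hc' hq
    rcases le_or_gt (cross (c - a) (p - a)) 0 with h | h
    · have := neg_le_abs (cross (c - a) (q - a)); linarith
    · have h2 := cut_le hc hH ha hc' hq
      have h3 := triangle_le (H := H ∩ {x | 0 ≤ cross (c - a) (x - a)})
        (hc.inter (by
          have : {x | 0 ≤ cross (c - a) (x - a)} = {x | cross (c - a) a ≤ cross (c - a) x} := by
            ext x; simp [cross_sub]
          rw [this]; exact convex_halfSpace_ge (isLinearMap_cross _) _))
        (volume_inter_ne_top hH _) (a := a) (b := c) (c := p) ⟨ha, by simp [cross]⟩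
        ⟨hc', by simp only [mem_ofPred_eq, cross, PiLp.sub_apply]; apply le_of_eq; ring⟩ ⟨hp, h.le⟩
      rw [abs_of_pos h] at h3
      linarith
  rw [e]
  rcases abs_cases (cross (c - a) (d - a) - cross (c - a) (b - a)) with ⟨h, _⟩ | ⟨h, _⟩
  · rw [h]; exact key d b hd hb
  · rw [h]; have := key b d hb hd; linarith

lemma volume_ne_top_of_isCompact {S : Set Plane} (hS : IsCompact S) : volume S ≠ ⊤ :=
  hS.measure_lt_top.ne

/-- A closed subset of full area of a convex body is the whole convex body. -/
lemma eq_of_subset_of_volume_le {S T : Set Plane} (hT : IsConvexBody T) (hS : IsClosed S)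
    (hST : S ⊆ T) (hv : volume.real T ≤ volume.real S) : S = T := by
  refine hST.antisymm ?_
  have h1 : interior T ⊆ S := by
    intro x hx
    by_contra hxS
    have hU : IsOpen (interior T ∩ Sᶜ) := isOpen_interior.inter hS.isOpen_compl
    have hpos : 0 < volume (interior T ∩ Sᶜ) := hU.measure_pos _ ⟨x, hx, hxS⟩
    have hTf := volume_ne_top_of_isCompact hT.1
    have hsub : volume.real S + volume.real (interior T ∩ Sᶜ) ≤ volume.real T := by
      rw [← measureReal_union (disjoint_left.2 fun y hy hy' => hy'.2 hy) hU.measurableSet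
        (measure_ne_top_of_subset hST hTf)
        (measure_ne_top_of_subset (inter_subset_left.trans interior_subset) hTf)]
      exact measureReal_mono (union_subset hST (inter_subset_left.trans interior_subset)) hTf
    have : 0 < volume.real (interior T ∩ Sᶜ) :=
      ENNReal.toReal_pos hpos.ne'
        (measure_ne_top_of_subset (inter_subset_left.trans interior_subset) hTf)
    linarith
  calc T ⊆ closure T := subset_closure
    _ = closure (interior T) := (hT.2.1.closure_interior_eq_closure_of_nonempty_interior hT.2.2).symm
    _ ⊆ S := closure_minimal h1 hS

/-! ### Piecewise linear closed characteristics -/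

lemma dot_sub_right (n x y : Phase) : dot n (x - y) = dot n x - dot n y := by
  simp only [dot, Prod.fst_sub, Prod.snd_sub, inner_sub_right]; ring

lemma dot_add_right (n x y : Phase) : dot n (x + y) = dot n x + dot n y := by
  simp only [dot, Prod.fst_add, Prod.snd_add, inner_add_right]; ring

lemma dot_smul_right (n : Phase) (r : ℝ) (x : Phase) : dot n (r • x) = r * dot n x := by
  simp only [dot, Prod.smul_fst, Prod.smul_snd, inner_smul_right]; ring

lemma dot_zero_right (n : Phase) : dot n 0 = 0 := by simp [dot]

lemma dot_J4_self (n : Phase) : dot n (J4 n) = 0 := by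
  simp [dot, J4, real_inner_comm]

lemma dot_J4_smul_J4 (r : ℝ) (n x : Phase) : dot (J4 (r • J4 n)) x = -r * dot n x := by
  simp only [dot, J4, Prod.smul_fst, Prod.smul_snd, inner_neg_left, inner_smul_left, smul_neg,
    conj_trivial]
  ring

lemma dot_le_gauge {C : Set Phase} (hC : C ∈ nhds 0) {n : Phase} (hn : ∀ c ∈ C, dot n c ≤ 1)
    (w : Phase) : dot n w ≤ gauge C w := by
  refine le_of_forall_gt_imp_ge_of_dense fun s hs => ?_
  obtain ⟨b, hb, hbs, y, hy, rfl⟩ := exists_lt_of_gauge_lt (absorbent_nhds_zero hC) hs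
  change dot n (b • y) ≤ s
  rw [dot_smul_right]
  have := mul_le_mul_of_nonneg_left (hn y hy) hb.le
  linarith

lemma gauge_eq_one_of_normal {C : Set Phase} (hC : C ∈ nhds 0) {n x : Phase}
    (hn : ∀ c ∈ C, dot n c ≤ 1) (hx : x ∈ C) (hnx : dot n x = 1) : gauge C x = 1 :=
  le_antisymm (gauge_le_one_of_mem hx) (hnx ▸ dot_le_gauge hC hn x)

lemma mem_subdifferential_of_normal {C : Set Phase} (hC : C ∈ nhds 0) {n x : Phase}
    (hn : ∀ c ∈ C, dot n c ≤ 1) (hx : x ∈ C) (hnx : dot n x = 1) :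
    n ∈ subdifferential (gauge C) x := by
  intro w
  rw [gauge_eq_one_of_normal hC hn hx hnx, dot_sub_right, hnx]
  linarith [dot_le_gauge hC hn w]

lemma normal_of_mem_subdifferential {C : Set Phase} {n x : Phase} (hx : gauge C x = 1)
    (hn : n ∈ subdifferential (gauge C) x) : (∀ c ∈ C, dot n c ≤ 1) ∧ dot n x = 1 := by
  have h0 := hn 0
  have h2 := hn ((2 : ℝ) • x)
  rw [gauge_smul_of_nonneg (by norm_num), dot_sub_right, dot_smul_right, hx, smul_eq_mul] at h2
  rw [gauge_zero, dot_sub_right, dot_zero_right, hx] at h0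
  refine ⟨fun c hc => ?_, by linarith⟩
  have hc' := hn c
  rw [dot_sub_right, hx] at hc'
  have := gauge_le_one_of_mem hc
  linarith

lemma interior_prod_iff {K T : Set Plane} {z : Phase} :
    z ∈ interior (K ×ˢ T) ↔ z.1 ∈ interior K ∧ z.2 ∈ interior T := by
  rw [interior_prod_eq, mem_prod]

lemma mem_neg_vadd_iff {C : Set Phase} {z x : Phase} : x ∈ -z +ᵥ C ↔ x + z ∈ C := by
  rw [mem_vadd_set_iff_neg_vadd_mem, neg_neg, vadd_eq_add, add_comm]

lemma neg_vadd_mem_nhds {C : Set Phase} {z : Phase} (hz : z ∈ interior C) :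
    -z +ᵥ C ∈ nhds (0 : Phase) := by
  have h : ContinuousAt (fun x : Phase => x + z) 0 := by fun_prop
  have h2 := h.preimage_mem_nhds (t := C) (by simpa using mem_interior_iff_mem_nhds.1 hz)
  refine Filter.mem_of_superset h2 fun x hx => mem_neg_vadd_iff.2 hx

/-- An arc from `x` to `y` on the boundary of `C` that follows the characteristic direction field
with unit rate, in time `R`. -/
def IsArc (C : Set Phase) (R : ℝ) (x y : Phase) : Prop :=
  ∃ (f : ℝ → Phase) (k : NNReal) (F : Set ℝ), LipschitzWith k f ∧ f 0 = x ∧ f R = y ∧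
    (∀ t ∈ Ico 0 R, gauge C (f t) = 1) ∧ F.Countable ∧
    ∀ t ∈ Ioo 0 R, t ∉ F → ∃ n ∈ subdifferential (gauge C) (f t), HasDerivAt f (J4 n) t

lemma IsArc.trans {C : Set Phase} {R₁ R₂ : ℝ} {x y w : Phase} (h₁ : 0 ≤ R₁) (h₂ : 0 ≤ R₂)
    (hxy : IsArc C R₁ x y) (hyw : IsArc C R₂ y w) : IsArc C (R₁ + R₂) x w := by
  obtain ⟨f, k, F, hf, f0, f1, fg, hF, fd⟩ := hxy
  obtain ⟨g, l, G, hg, g0, g1, gg, hG, gd⟩ := hyw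
  have e1 : ∀ t, t ≤ R₁ → f (min t R₁) + g (max (t - R₁) 0) - y = f t := by
    intro t ht
    rw [min_eq_left ht, max_eq_right (by linarith), g0]; abel
  have e2 : ∀ t, R₁ ≤ t → f (min t R₁) + g (max (t - R₁) 0) - y = g (t - R₁) := by
    intro t ht
    rw [min_eq_right ht, max_eq_left (by linarith), f1]; abel
  refine ⟨fun t => f (min t R₁) + g (max (t - R₁) 0) - y, k + l, F ∪ (fun t => t + R₁) '' G ∪ {R₁},
    ?_, ?_, ?_, ?_, ?_, ?_⟩
  · refine LipschitzWith.of_dist_le_mul fun s t => ?_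
    rw [dist_sub_right]
    refine (dist_add_add_le _ _ _ _).trans ?_
    have a1 : dist (f (min s R₁)) (f (min t R₁)) ≤ k * dist s t := by
      refine (hf.dist_le_mul _ _).trans (mul_le_mul_of_nonneg_left ?_ k.2)
      rw [Real.dist_eq, Real.dist_eq]
      simpa using abs_min_sub_min_le_max s R₁ t R₁
    have a2 : dist (g (max (s - R₁) 0)) (g (max (t - R₁) 0)) ≤ l * dist s t := by
      refine (hg.dist_le_mul _ _).trans (mul_le_mul_of_nonneg_left ?_ l.2)
      rw [Real.dist_eq, Real.dist_eq]
      simpa using abs_max_sub_max_le_max (s - R₁) 0 (t - R₁) 0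
    push_cast
    linarith
  · simp only; rw [e1 0 h₁, f0]
  · simp only; rw [e2 _ (by linarith), ← g1]; congr 1; ring
  · intro t ht
    simp only
    rcases lt_or_ge t R₁ with h | h
    · rw [e1 t h.le]; exact fg t ⟨ht.1, h⟩
    · rw [e2 t h]; exact gg _ ⟨by linarith, by linarith [ht.2]⟩
  · exact (hF.union (hG.image _)).union (countable_singleton _)
  · intro t ht htF
    simp only [mem_union, mem_image, mem_singleton_iff, not_or, not_exists, not_and] at htF
    rcases lt_trichotomy t R₁ with h | h | h
    · obtain ⟨n, hn, hd⟩ := fd t ⟨ht.1, h⟩ htF.1.1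
      refine ⟨n, by simp only; rwa [e1 t h.le], hd.congr_of_eventuallyEq ?_⟩
      filter_upwards [eventually_lt_nhds h] with s hs using e1 s hs.le
    · exact absurd h htF.2
    · obtain ⟨n, hn, hd⟩ := gd (t - R₁) ⟨by linarith, by linarith [ht.2]⟩
        (fun hm => htF.1.2 _ hm (by ring))
      refine ⟨n, by simp only; rwa [e2 t h.le], ?_⟩
      have := (hd.comp_sub_const t R₁)
      refine this.congr_of_eventuallyEq ?_
      filter_upwards [eventually_gt_nhds h] with s hs using e2 s hs.le

lemma isArc_of_normal {C : Set Phase} (hC : C ∈ nhds 0) (hc : Convex ℝ C) {n x : Phase} {τ : ℝ}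
    (hτ : 0 < τ) (hn : ∀ c ∈ C, dot n c ≤ 1) (hx : x ∈ C) (hnx : dot n x = 1)
    (hy : x + τ • J4 n ∈ C) : IsArc C τ x (x + τ • J4 n) := by
  have hmem : ∀ t ∈ Icc 0 τ, x + t • J4 n ∈ C := by
    intro t ht
    have := hc.add_smul_sub_mem hx hy (t := t / τ)
      ⟨div_nonneg ht.1 hτ.le, (div_le_one hτ).2 ht.2⟩
    rw [add_sub_cancel_left, smul_smul, div_mul_cancel₀ _ hτ.ne'] at this
    exact this
  have hdot : ∀ t : ℝ, dot n (x + t • J4 n) = 1 := fun t => by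
    rw [dot_add_right, dot_smul_right, dot_J4_self, hnx]; ring
  refine ⟨fun t => x + t • J4 n, ‖J4 n‖₊, ∅, ?_, by simp, rfl, ?_, countable_empty, ?_⟩
  · refine LipschitzWith.of_dist_le_mul fun s t => ?_
    rw [dist_add_left, dist_eq_norm, ← sub_smul, norm_smul, Real.dist_eq, mul_comm]
    simp
  · intro t ht
    exact gauge_eq_one_of_normal hC hn (hmem t ⟨ht.1, ht.2.le⟩) (hdot t)
  · intro t ht _
    refine ⟨n, mem_subdifferential_of_normal hC hn (hmem t ⟨ht.1.le, ht.2.le⟩) (hdot t), ?_⟩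
    simpa using ((hasDerivAt_id t).smul_const (J4 n)).const_add x

lemma isArc_refl (C : Set Phase) (x : Phase) : IsArc C 0 x x :=
  ⟨fun _ => x, 0, ∅, LipschitzWith.const x, rfl, rfl, by simp, countable_empty, by simp⟩

lemma IsArc.exists_closedCharacteristic {C : Set Phase} {R : ℝ} {x : Phase} (hR : 0 < R)
    (h : IsArc C R x x) : ∃ γ, IsClosedCharacteristic C γ ∧ action γ = R / 2 := by
  obtain ⟨f, k, F, hf, f0, f1, fg, hF, fd⟩ := h
  have hFc : ((fun t => R * t) ⁻¹' F).Countable :=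
    hF.preimage_of_injOn (fun a _ b _ hab => mul_left_cancel₀ hR.ne' hab)
  have hd : ∀ t ∈ Ioo (0 : ℝ) 1, t ∉ (fun t => R * t) ⁻¹' F →
      ∃ n ∈ subdifferential (gauge C) (f (R * t)),
        HasDerivAt (fun t => f (R * t)) (R • J4 n) t := by
    intro t ht htF
    obtain ⟨n, hn, hd⟩ := fd (R * t) ⟨mul_pos hR ht.1, by nlinarith [ht.2]⟩ htF
    refine ⟨n, hn, ?_⟩
    have h2 : HasDerivAt (fun t => R * t) R t := by
      simpa using (hasDerivAt_id t).const_mul R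
    exact HasDerivAt.scomp t hd h2
  have hg : ∀ t ∈ Icc (0 : ℝ) 1, gauge C (f (R * t)) = 1 := by
    intro t ht
    rcases eq_or_lt_of_le ht.2 with h | h
    · rw [h, mul_one, f1, ← f0]; exact fg 0 ⟨le_rfl, hR⟩
    · exact fg _ ⟨mul_nonneg hR.le ht.1, by nlinarith⟩
  have hae : ∀ᵐ t : ℝ, t ∉ (fun t => R * t) ⁻¹' F := hFc.ae_notMem volume
  refine ⟨fun t => f (R * t), ⟨?_, by simp [f0, f1], ?_, hg⟩, ?_⟩
  · have hl : LipschitzWith (k * R.toNNReal) (fun t => f (R * t)) := by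
      refine hf.comp (LipschitzWith.of_dist_le_mul fun s t => ?_)
      rw [Real.dist_eq, Real.dist_eq, ← mul_sub, abs_mul, abs_of_pos hR, Real.coe_toNNReal _ hR.le]
    exact (hl.lipschitzOnWith (s := uIcc 0 1)).absolutelyContinuousOnInterval
  · filter_upwards [hae] with t ht htI
    obtain ⟨n, hn, hd⟩ := hd t htI ht
    exact ⟨R, hR, n, hn, hd⟩
  · have : ∫ t in (0 : ℝ)..1, dot (J4 (deriv (fun t => f (R * t)) t)) (f (R * t)) =
        ∫ t in (0 : ℝ)..1, -R := by
      apply intervalIntegral.integral_congr_ae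
      have h1 : ∀ᵐ t : ℝ, t ≠ 1 := by simp [ae_iff]
      filter_upwards [hae, h1] with t ht ht1 htI
      rw [uIoc_of_le zero_le_one] at htI
      have htI' : t ∈ Ioo (0 : ℝ) 1 := ⟨htI.1, lt_of_le_of_ne htI.2 ht1⟩
      obtain ⟨n, hn, hd⟩ := hd t htI' ht
      rw [hd.deriv, dot_J4_smul_J4,
        (normal_of_mem_subdifferential (hg t ⟨htI.1.le, htI.2⟩) hn).2, mul_one]
    rw [action, this]
    simp only [intervalIntegral.integral_const, sub_zero, smul_eq_mul]
    ring

lemma inner_lt_of_mem_interior {T : Set Plane} {x d : Plane} {M : ℝ} (hx : x ∈ interior T)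
    (hd : d ≠ 0) (hM : ∀ y ∈ T, inner ℝ d y ≤ M) : inner ℝ d x < M := by
  have h : ContinuousAt (fun ε : ℝ => x + ε • d) 0 := by fun_prop
  have h2 := h.preimage_mem_nhds (t := T) (by simpa using mem_interior_iff_mem_nhds.1 hx)
  obtain ⟨ε, hε, h3⟩ := Metric.mem_nhds_iff.1 h2
  have h4 := hM _ (h3 (show ε / 2 ∈ Metric.ball (0 : ℝ) ε by
    rw [Metric.mem_ball, Real.dist_eq, sub_zero, abs_of_pos (by positivity)]; linarith))
  rw [inner_add_right, inner_smul_right, real_inner_self_eq_norm_sq] at h4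
  have : 0 < ε / 2 * ‖d‖ ^ 2 := by
    have := norm_pos_iff.2 hd; positivity
  linarith

section Product

variable {K T : Set Plane} {z : Phase}

lemma convex_neg_vadd_prod (hK : Convex ℝ K) (hT : Convex ℝ T) (z : Phase) :
    Convex ℝ (-z +ᵥ (K ×ˢ T)) := (hK.prod hT).vadd _

lemma isArc_fst (hK : Convex ℝ K) (hT : Convex ℝ T) (hz : z ∈ interior (K ×ˢ T))
    {q q' p : Plane} (hq : q ∈ K) (hq' : q' ∈ K) (hp : p ∈ T)
    (hN : ∀ y ∈ T, inner ℝ (q' - q) y ≤ inner ℝ (q' - q) p) :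
    0 ≤ inner ℝ (q' - q) (p - z.2) ∧
    IsArc (-z +ᵥ (K ×ˢ T)) (inner ℝ (q' - q) (p - z.2)) ((q, p) - z) ((q', p) - z) := by
  rcases eq_or_ne q' q with rfl | hne
  · simpa using isArc_refl _ _
  have hd : q' - q ≠ 0 := sub_ne_zero.2 hne
  have hpos : 0 < inner ℝ (q' - q) (p - z.2) := by
    rw [inner_sub_right]
    linarith [inner_lt_of_mem_interior (interior_prod_iff.1 hz).2 hd hN]
  refine ⟨hpos.le, ?_⟩
  set h := inner ℝ (q' - q) (p - z.2) with hh
  have e : ((q', p) - z : Phase) = ((q, p) - z) + h • J4 (0, h⁻¹ • (q' - q)) := by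
    ext1
    · simp [J4, smul_smul, hpos.ne']
    · simp [J4]
  rw [e]
  refine isArc_of_normal (neg_vadd_mem_nhds hz) (convex_neg_vadd_prod hK hT z) hpos ?_ ?_ ?_ ?_
  · intro c hc
    have hc' := (mem_neg_vadd_iff.1 hc).2
    have := hN _ hc'
    simp only [Prod.snd_add, inner_add_right] at this
    simp only [dot, inner_zero_left, inner_smul_left, conj_trivial, zero_add]
    rw [inv_mul_le_iff₀ hpos, mul_one, hh, inner_sub_right]
    linarith
  · rw [mem_neg_vadd_iff, sub_add_cancel]; exact ⟨hq, hp⟩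
  · simp only [dot, inner_zero_left, inner_smul_left, conj_trivial, zero_add, Prod.snd_sub]
    rw [← hh, inv_mul_cancel₀ hpos.ne']
  · rw [← e, mem_neg_vadd_iff, sub_add_cancel]; exact ⟨hq', hp⟩

lemma isArc_snd (hK : Convex ℝ K) (hT : Convex ℝ T) (hz : z ∈ interior (K ×ˢ T))
    {q p p' : Plane} (hq : q ∈ K) (hp : p ∈ T) (hp' : p' ∈ T)
    (hN : ∀ y ∈ K, inner ℝ (p - p') y ≤ inner ℝ (p - p') q) :
    0 ≤ inner ℝ (p - p') (q - z.1) ∧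
    IsArc (-z +ᵥ (K ×ˢ T)) (inner ℝ (p - p') (q - z.1)) ((q, p) - z) ((q, p') - z) := by
  rcases eq_or_ne p p' with rfl | hne
  · simpa using isArc_refl _ _
  have hd : p - p' ≠ 0 := sub_ne_zero.2 hne
  have hpos : 0 < inner ℝ (p - p') (q - z.1) := by
    rw [inner_sub_right]
    linarith [inner_lt_of_mem_interior (interior_prod_iff.1 hz).1 hd hN]
  refine ⟨hpos.le, ?_⟩
  set h := inner ℝ (p - p') (q - z.1) with hh
  have e : ((q, p') - z : Phase) = ((q, p) - z) + h • J4 (h⁻¹ • (p - p'), 0) := by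
    ext1
    · simp [J4]
    · simp [J4, smul_smul, hpos.ne']
  rw [e]
  refine isArc_of_normal (neg_vadd_mem_nhds hz) (convex_neg_vadd_prod hK hT z) hpos ?_ ?_ ?_ ?_
  · intro c hc
    have hc' := (mem_neg_vadd_iff.1 hc).1
    have := hN _ hc'
    simp only [Prod.fst_add, inner_add_right] at this
    simp only [dot, inner_zero_left, inner_smul_left, conj_trivial, add_zero]
    rw [inv_mul_le_iff₀ hpos, mul_one, hh, inner_sub_right]
    linarith
  · rw [mem_neg_vadd_iff, sub_add_cancel]; exact ⟨hq, hp⟩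
  · simp only [dot, inner_zero_left, inner_smul_left, conj_trivial, add_zero, Prod.fst_sub]
    rw [← hh, inv_mul_cancel₀ hpos.ne']
  · rw [← e, mem_neg_vadd_iff, sub_add_cancel]; exact ⟨hq, hp'⟩

/-- A pair of dual closed polygons inscribed in `K` and `T` is a closed characteristic. -/
lemma exists_closedCharacteristic_of_polygon (hK : Convex ℝ K) (hT : Convex ℝ T)
    (hz : z ∈ interior (K ×ˢ T)) (k w : Fin 3 → Plane) (hk : ∀ i, k i ∈ K) (hw : ∀ i, w i ∈ T)
    (hkw : ∀ i, ∀ y ∈ T, inner ℝ (k (i + 1) - k i) y ≤ inner ℝ (k (i + 1) - k i) (w i))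
    (hwk : ∀ i, ∀ y ∈ K, inner ℝ (w i - w (i + 1)) y ≤ inner ℝ (w i - w (i + 1)) (k (i + 1)))
    (hpos : 0 < ∑ i, inner ℝ (w i - w (i + 1)) (k (i + 1))) :
    ∃ γ, IsClosedCharacteristic (-z +ᵥ (K ×ˢ T)) γ ∧
      action γ = ∑ i, inner ℝ (w i - w (i + 1)) (k (i + 1)) := by
  have step : ∀ i, 0 ≤ inner ℝ (k (i + 1) - k i) (w i - z.2) +
        inner ℝ (w i - w (i + 1)) (k (i + 1) - z.1) ∧
      IsArc (-z +ᵥ (K ×ˢ T)) (inner ℝ (k (i + 1) - k i) (w i - z.2) +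
        inner ℝ (w i - w (i + 1)) (k (i + 1) - z.1)) ((k i, w i) - z)
        ((k (i + 1), w (i + 1)) - z) := by
    intro i
    obtain ⟨h1, a1⟩ := isArc_fst hK hT hz (hk i) (hk (i + 1)) (hw i) (hkw i)
    obtain ⟨h2, a2⟩ := isArc_snd hK hT hz (hk (i + 1)) (hw i) (hw (i + 1)) (hwk i)
    exact ⟨add_nonneg h1 h2, a1.trans h1 h2 a2⟩
  obtain ⟨h0, a0⟩ := step 0
  obtain ⟨h1, a1⟩ := step 1
  obtain ⟨h2, a2⟩ := step 2
  have a := (a0.trans h0 h1 a1).trans (add_nonneg h0 h1) h2 a2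
  have i1 : (0 : Fin 3) + 1 = 1 := rfl
  have i2 : (1 : Fin 3) + 1 = 2 := rfl
  have i3 : (2 : Fin 3) + 1 = 0 := rfl
  simp only [Fin.sum_univ_three, i1, i2, i3] at hpos a ⊢
  have eR : inner ℝ (k 1 - k 0) (w 0 - z.2) + inner ℝ (w 0 - w 1) (k 1 - z.1) +
      (inner ℝ (k 2 - k 1) (w 1 - z.2) + inner ℝ (w 1 - w 2) (k 2 - z.1)) +
      (inner ℝ (k 0 - k 2) (w 2 - z.2) + inner ℝ (w 2 - w 0) (k 0 - z.1)) =
      2 * (inner ℝ (w 0 - w 1) (k 1) + inner ℝ (w 1 - w 2) (k 2) + inner ℝ (w 2 - w 0) (k 0)) := by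
    simp only [inner_sub_left, inner_sub_right, real_inner_comm (w _) (k _)]
    ring
  rw [eR] at a
  obtain ⟨γ, hγ, hA⟩ := a.exists_closedCharacteristic (by linarith)
  exact ⟨γ, hγ, by rw [hA]; ring⟩

end Product

/-! ### Polygons that cannot be translated into the interior of a convex body -/

/-- The support function of a set in the plane. -/
def supp (K : Set Plane) (d : Plane) : ℝ := sSup ((fun x => inner ℝ d x) '' K)

/-- The length of the closed triangle `W` measured by the support function of `-K`. -/
def len (K : Set Plane) (W : Fin 3 → Plane) : ℝ := ∑ i, supp K (W i - W (i + 1))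

lemma bddAbove_supp {K : Set Plane} (hK : IsCompact K)
    (d : Plane) : BddAbove ((fun x => inner ℝ d x) '' K) :=
  hK.bddAbove_image (by fun_prop)

lemma inner_le_supp {K : Set Plane} (hK : IsCompact K)
    (d : Plane) {x : Plane} (hx : x ∈ K) : inner ℝ d x ≤ supp K d :=
  le_csSup (bddAbove_supp hK d) (mem_image_of_mem _ hx)

lemma exists_inner_eq_supp {K : Set Plane} (hK : IsCompact K)
    (hne : K.Nonempty) (d : Plane) : ∃ x ∈ K, inner ℝ d x = supp K d := by
  obtain ⟨x, hx, h⟩ := hK.exists_sSup_image_eq hne (f := fun x => inner ℝ d x) (by fun_prop)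
  exact ⟨x, hx, h.symm⟩

lemma continuous_supp {K : Set Plane} (hK : IsCompact K) : Continuous (supp K) :=
  hK.continuous_sSup (f := fun d x => inner ℝ d x) (by fun_prop)

lemma continuous_len {K : Set Plane} (hK : IsCompact K) : Continuous (len K) := by
  have := continuous_supp hK
  unfold len
  fun_prop

lemma supp_le {K : Set Plane} (hne : K.Nonempty) {d : Plane} {M : ℝ}
    (h : ∀ x ∈ K, inner ℝ d x ≤ M) : supp K d ≤ M :=
  csSup_le (hne.image _) (by rintro _ ⟨x, hx, rfl⟩; exact h x hx)

lemma supp_smul (K : Set Plane) {r : ℝ} (hr : 0 ≤ r) (d : Plane) :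
    supp K (r • d) = r * supp K d := by
  unfold supp
  rw [← smul_eq_mul, ← Real.sSup_smul_of_nonneg hr, ← image_smul, image_image]
  simp [inner_smul_left]

lemma len_smul (K : Set Plane) {r : ℝ} (hr : 0 ≤ r) (W : Fin 3 → Plane) :
    len K (r • W) = r * len K W := by
  simp only [len, Finset.mul_sum, Pi.smul_apply, ← smul_sub, supp_smul K hr]

lemma len_add_const (K : Set Plane) (W : Fin 3 → Plane) (s : Plane) :
    len K (fun i => W i + s) = len K W := by
  simp [len]

lemma sum_inner_const (W : Fin 3 → Plane) (z : Plane) :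
    ∑ i, inner ℝ (W i - W (i + 1)) z = 0 := by
  have i1 : (0 : Fin 3) + 1 = 1 := rfl
  have i2 : (1 : Fin 3) + 1 = 2 := rfl
  have i3 : (2 : Fin 3) + 1 = 0 := rfl
  simp only [Fin.sum_univ_three, i1, i2, i3, inner_sub_left]
  ring

lemma len_nonneg {K : Set Plane} (hK : IsCompact K) (hne : K.Nonempty) (W : Fin 3 → Plane) :
    0 ≤ len K W := by
  obtain ⟨z, hz⟩ := hne
  rw [← sum_inner_const W z]
  exact Finset.sum_le_sum fun i _ => inner_le_supp hK _ hz

/-- The length controls the distance of the vertices. -/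
lemma exists_norm_le_len {K : Set Plane} (hK : IsCompact K) (hi : (interior K).Nonempty) :
    ∃ ε > 0, ∀ W : Fin 3 → Plane, ∀ i, ε * ‖W i - W (i + 1)‖ ≤ len K W := by
  obtain ⟨z, hz⟩ := hi
  obtain ⟨ε, hε, hb⟩ := Metric.nhds_basis_closedBall.mem_iff.1 (mem_interior_iff_mem_nhds.1 hz)
  refine ⟨ε, hε, fun W i => ?_⟩
  have h1 : ∀ d : Plane, inner ℝ d z + ε * ‖d‖ ≤ supp K d := by
    intro d
    rcases eq_or_ne d 0 with rfl | hd
    · have := inner_le_supp hK 0 (interior_subset hz)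
      simpa using this
    have hx : z + (ε / ‖d‖) • d ∈ K := by
      apply hb
      rw [Metric.mem_closedBall, dist_eq_norm, add_sub_cancel_left, norm_smul, norm_div, norm_norm,
        div_mul_cancel₀ _ (norm_ne_zero_iff.2 hd), Real.norm_of_nonneg hε.le]
    have h2 := inner_le_supp hK d hx
    rw [inner_add_right, inner_smul_right, real_inner_self_eq_norm_sq] at h2
    have : ε / ‖d‖ * ‖d‖ ^ 2 = ε * ‖d‖ := by
      field_simp [norm_ne_zero_iff.2 hd]
    linarith
  calc ε * ‖W i - W (i + 1)‖ ≤ ∑ j, ε * ‖W j - W (j + 1)‖ :=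
        Finset.single_le_sum (f := fun j => ε * ‖W j - W (j + 1)‖)
          (fun j _ => by positivity) (Finset.mem_univ i)
    _ = ∑ j, (inner ℝ (W j - W (j + 1)) z + ε * ‖W j - W (j + 1)‖) := by
        rw [Finset.sum_add_distrib, sum_inner_const, zero_add]
    _ ≤ len K W := Finset.sum_le_sum fun j _ => h1 _

/-- Some translate of `W` lies in `S`. -/
def Fits (S : Set Plane) (W : Fin 3 → Plane) : Prop := ∃ s : Plane, ∀ i, W i + s ∈ S

lemma fits_of_len_nonpos {K S : Set Plane} (hK : IsConvexBody K) (hS : S.Nonempty)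
    {W : Fin 3 → Plane} (hW : len K W ≤ 0) : Fits S W := by
  obtain ⟨ε, hε, hb⟩ := exists_norm_le_len hK.1 hK.2.2
  have hz : ∀ i, W i = W (i + 1) := fun i => by
    have h1 : ε * ‖W i - W (i + 1)‖ ≤ 0 := (hb W i).trans hW
    have h2 : ‖W i - W (i + 1)‖ = 0 := by
      have := norm_nonneg (W i - W (i + 1)); nlinarith
    exact sub_eq_zero.1 (norm_eq_zero.1 h2)
  obtain ⟨x, hx⟩ := hS
  have h1 : W 1 = W 0 := (hz 0).symm
  have h2 : W 2 = W 0 := hz 2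
  refine ⟨x - W 0, fun i => ?_⟩
  fin_cases i
  · simpa using hx
  · simpa [h1] using hx
  · simpa [h2] using hx

lemma isOpen_fits_interior (T : Set Plane) : IsOpen {W | Fits (interior T) W} := by
  have : {W | Fits (interior T) W} =
      ⋃ s : Plane, ⋂ i : Fin 3, (fun W : Fin 3 → Plane => W i + s) ⁻¹' interior T := by
    ext W; simp [Fits]
  rw [this]
  refine isOpen_iUnion fun s => isOpen_iInter_of_finite fun i => ?_
  exact isOpen_interior.preimage (by fun_prop)

lemma Fits.add_const {S : Set Plane} {W : Fin 3 → Plane} {s : Plane} :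
    Fits S (fun i => W i + s) ↔ Fits S W := by
  constructor
  · rintro ⟨t, h⟩; exact ⟨s + t, fun i => by rw [← add_assoc]; exact h i⟩
  · rintro ⟨t, h⟩; exact ⟨t - s, fun i => by simpa [add_assoc] using h i⟩

lemma fits_of_forall_lt_one {T : Set Plane} (hT : IsCompact T) {W : Fin 3 → Plane}
    (h : ∀ θ ∈ Ioo (0 : ℝ) 1, Fits T (θ • W)) : Fits T W := by
  let S : Set (ℝ × Plane) := (Icc (0 : ℝ) 1 ×ˢ T) ∩
    ⋂ i : Fin 3, (fun x : ℝ × Plane => x.2 + x.1 • (W i - W 0)) ⁻¹' T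
  have hS : IsCompact S := (isCompact_Icc.prod hT).inter_right
    (isClosed_iInter fun i => hT.isClosed.preimage (by fun_prop))
  have hP : IsClosed (Prod.fst '' S) := (hS.image continuous_fst).isClosed
  have hsub : Ioo (0 : ℝ) 1 ⊆ Prod.fst '' S := by
    intro θ hθ
    obtain ⟨s, hs⟩ := h θ hθ
    refine ⟨(θ, θ • W 0 + s), ⟨⟨Ioo_subset_Icc_self hθ, hs 0⟩, ?_⟩, rfl⟩
    simp only [mem_iInter, mem_preimage]
    intro i
    have := hs i
    simp only [Pi.smul_apply] at this
    convert this using 1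
    module
  have h1 : (1 : ℝ) ∈ Prod.fst '' S := by
    refine hP.closure_subset_iff.2 hsub ?_
    rw [closure_Ioo (by norm_num)]; simp
  obtain ⟨⟨θ, y⟩, hy, rfl⟩ := h1
  refine ⟨y - W 0, fun i => ?_⟩
  have := hy.2
  simp only [mem_iInter, mem_preimage, one_smul] at this
  convert this i using 1
  abel

/-- A triangle of minimal length among those that do not fit into the interior of `T`. -/
lemma exists_minimal_not_fits {K T : Set Plane} (hK : IsCompact K) (hKi : (interior K).Nonempty)
    {W₀ : Fin 3 → Plane} (hW₀ : ¬ Fits (interior T) W₀) :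
    ∃ W, ¬ Fits (interior T) W ∧ len K W ≤ len K W₀ ∧
      ∀ W', ¬ Fits (interior T) W' → len K W ≤ len K W' := by
  obtain ⟨ε, hε, hb⟩ := exists_norm_le_len hK hKi
  let S : Set (Fin 3 → Plane) := {W | ¬ Fits (interior T) W} ∩ {W | len K W ≤ len K W₀} ∩ {W | W 0 = 0}
  have hnorm : ∀ W : Fin 3 → Plane, ¬ Fits (interior T) W →
      ¬ Fits (interior T) (fun i => W i + -W 0) := fun W h => by rwa [Fits.add_const]
  have hSc : IsClosed S := by
    refine IsClosed.inter (IsClosed.inter ?_ ?_) ?_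
    · exact (isOpen_fits_interior T).isClosed_compl
    · exact isClosed_le (continuous_len hK) continuous_const
    · exact isClosed_eq (continuous_apply 0) continuous_const
  have hSb : S ⊆ Metric.closedBall 0 (len K W₀ / ε) := by
    rintro W ⟨⟨_, hl⟩, h0⟩
    simp only [mem_ofPred_eq] at hl h0
    have hl0 : 0 ≤ len K W₀ / ε :=
      div_nonneg (len_nonneg hK (hKi.mono interior_subset) _) hε.le
    rw [mem_closedBall_zero_iff, pi_norm_le_iff_of_nonneg hl0]
    have a0 := hb W 0
    have a2 := hb W 2
    have i1 : (0 : Fin 3) + 1 = 1 := rfl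
    have i3 : (2 : Fin 3) + 1 = 0 := rfl
    rw [i1, h0, zero_sub, norm_neg] at a0
    rw [i3, h0, sub_zero] at a2
    intro i
    rw [le_div_iff₀ hε]
    fin_cases i
    · simp only [Fin.zero_eta, h0, norm_zero, zero_mul]
      exact len_nonneg hK (hKi.mono interior_subset) _
    · change ‖W 1‖ * ε ≤ _; linarith
    · change ‖W 2‖ * ε ≤ _; linarith
  have hS : IsCompact S := (isCompact_closedBall _ _).of_isClosed_subset hSc hSb
  have hne : S.Nonempty := by
    refine ⟨fun i => W₀ i + -W₀ 0, ⟨hnorm W₀ hW₀, ?_⟩, by simp⟩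
    simp only [mem_ofPred_eq, len_add_const, le_refl]
  obtain ⟨W, hWS, hmin⟩ := hS.exists_isMinOn hne (continuous_len hK).continuousOn
  refine ⟨W, hWS.1.1, hWS.1.2, fun W' hW' => ?_⟩
  rcases le_or_gt (len K W') (len K W₀) with h | h
  · have := hmin (a := fun i => W' i + -W' 0) ⟨⟨hnorm W' hW', by
      simp only [mem_ofPred_eq, len_add_const, h]⟩, by simp⟩
    simpa [len_add_const] using this
  · exact le_trans hWS.1.2 h.le

lemma exists_repr_of_functional (f : (Fin 3 → Plane) →L[ℝ] ℝ) :
    ∃ a : Fin 3 → Plane, ∀ X, f X = ∑ i, inner ℝ (a i) (X i) := by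
  refine ⟨fun i => (InnerProductSpace.toDual ℝ Plane).symm
    (f.comp (ContinuousLinearMap.single ℝ (fun _ : Fin 3 => Plane) i)), fun X => ?_⟩
  simp only [InnerProductSpace.toDual_symm_apply, ContinuousLinearMap.comp_apply,
    ContinuousLinearMap.single_apply]
  rw [← map_sum, Finset.univ_sum_single]

/-- Normals certifying that a triangle does not fit into the interior of `T`. -/
lemma exists_normals_of_not_fits {T : Set Plane} (hT : Convex ℝ T) (hTi : (interior T).Nonempty)
    {W : Fin 3 → Plane} (hW : ¬ Fits (interior T) W) :
    ∃ a : Fin 3 → Plane, a ≠ 0 ∧ ∑ i, a i = 0 ∧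
      ∀ X : Fin 3 → Plane, (∀ i, X i ∈ T) → ∑ i, inner ℝ (a i) (X i) ≤ ∑ i, inner ℝ (a i) (W i) := by
  let A : Set (Fin 3 → Plane) := Set.pi univ fun _ => interior T
  have hA : IsOpen A := isOpen_set_pi finite_univ fun _ _ => isOpen_interior
  have hAc : Convex ℝ A := convex_pi fun _ _ => hT.interior
  let B : Set (Fin 3 → Plane) := range fun s : Plane => fun i => W i + s
  have hB : Convex ℝ B := by
    rintro _ ⟨s, rfl⟩ _ ⟨t, rfl⟩ p q hp hq hpq
    refine ⟨p • s + q • t, ?_⟩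
    funext i
    simp only [Pi.add_apply, Pi.smul_apply]
    have : W i = (p + q) • W i := by rw [hpq, one_smul]
    nth_rewrite 1 [this]
    module
  have hd : Disjoint A B := by
    rw [disjoint_left]
    rintro _ hXA ⟨s, rfl⟩
    exact hW ⟨s, fun i => hXA i trivial⟩
  obtain ⟨f, u, hfA, hfB⟩ := geometric_hahn_banach_open hAc hA hB hd
  obtain ⟨a, ha⟩ := exists_repr_of_functional f
  have hB' : ∀ s : Plane, u ≤ ∑ i, inner ℝ (a i) (W i) + inner ℝ (∑ i, a i) s := by
    intro s
    have := hfB _ ⟨s, rfl⟩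
    rw [ha] at this
    simpa only [inner_add_right, Finset.sum_add_distrib, ← sum_inner] using this
  obtain ⟨x₀, hx₀⟩ := hTi
  have ha0 : a ≠ 0 := by
    rintro rfl
    have h1 := hfA (fun _ => x₀) fun _ _ => hx₀
    have h2 := hB' 0
    rw [ha] at h1
    simp at h1 h2
    linarith
  have hsum : ∑ i, a i = 0 := by
    by_contra hne
    set v := ∑ i, a i
    have hv : 0 < ‖v‖ ^ 2 := by have := norm_pos_iff.2 hne; positivity
    have h1 := hB' (((u - ∑ i, inner ℝ (a i) (W i) - 1) / ‖v‖ ^ 2) • v)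
    rw [inner_smul_right, real_inner_self_eq_norm_sq, div_mul_cancel₀ _ hv.ne'] at h1
    linarith
  refine ⟨a, ha0, hsum, fun X hX => ?_⟩
  have hle : u ≤ ∑ i, inner ℝ (a i) (W i) := by simpa [hsum] using hB' 0
  refine le_trans ?_ hle
  rw [← ha]
  have hcl : X ∈ closure A := by
    rw [closure_pi_set]
    intro i _
    rw [hT.closure_interior_eq_closure_of_nonempty_interior ⟨x₀, hx₀⟩]
    exact subset_closure (hX i)
  exact closure_minimal (fun Y hY => (hfA Y hY).le)
    (isClosed_le f.continuous continuous_const) hcl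

lemma inner_le_of_sum_le {T : Set Plane} {a V : Fin 3 → Plane} (hV : ∀ i, V i ∈ T)
    (h : ∀ X : Fin 3 → Plane, (∀ i, X i ∈ T) → ∑ i, inner ℝ (a i) (X i) ≤ ∑ i, inner ℝ (a i) (V i))
    (j : Fin 3) {y : Plane} (hy : y ∈ T) : inner ℝ (a j) y ≤ inner ℝ (a j) (V j) := by
  have := h (Function.update V j y) fun i => by
    rcases eq_or_ne i j with rfl | hij
    · simpa using hy
    · simpa [hij] using hV i
  rw [← Finset.add_sum_erase _ _ (Finset.mem_univ j),
    ← Finset.add_sum_erase _ (fun i => inner ℝ (a i) (V i)) (Finset.mem_univ j)] at this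
  have e2 : ∑ i ∈ Finset.univ.erase j, inner ℝ (a i) (Function.update V j y i) =
      ∑ i ∈ Finset.univ.erase j, inner ℝ (a i) (V i) :=
    Finset.sum_congr rfl fun i hi => by rw [Function.update_of_ne (Finset.ne_of_mem_erase hi)]
  rw [e2, Function.update_self] at this
  linarith

lemma not_fits_of_normals {T : Set Plane} {a W : Fin 3 → Plane} (ha0 : a ≠ 0) (ha : ∑ i, a i = 0)
    (h : ∀ X : Fin 3 → Plane, (∀ i, X i ∈ T) → ∑ i, inner ℝ (a i) (X i) ≤ ∑ i, inner ℝ (a i) (W i)) :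
    ¬ Fits (interior T) W := by
  rintro ⟨s, hs⟩
  obtain ⟨j, hj⟩ := Function.ne_iff.1 ha0
  have hT : ∀ i, W i + s ∈ T := fun i => interior_subset (hs i)
  have e : ∑ i, inner ℝ (a i) (W i) = ∑ i, inner ℝ (a i) (W i + s) := by
    simp only [inner_add_right, Finset.sum_add_distrib, ← sum_inner, ha, inner_zero_left, add_zero]
  have key := inner_lt_of_mem_interior (M := inner ℝ (a j) (W j + s)) (hs j) hj fun y hy =>
    inner_le_of_sum_le (V := fun i => W i + s) hT (fun X hX => (h X hX).trans e.le) j hy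
  exact lt_irrefl _ key

/-- The set whose support function is `len K`. -/
def dualPolygons (K : Set Plane) : Set (Fin 3 → Plane) :=
  (fun k : Fin 3 → Plane => fun i => k (i + 1) - k i) '' Set.pi univ fun _ => K

lemma sum_inner_dual (k W : Fin 3 → Plane) :
    ∑ i, inner ℝ (k (i + 1) - k i) (W i) = ∑ i, inner ℝ (W i - W (i + 1)) (k (i + 1)) := by
  have i1 : (0 : Fin 3) + 1 = 1 := rfl
  have i2 : (1 : Fin 3) + 1 = 2 := rfl
  have i3 : (2 : Fin 3) + 1 = 0 := rfl
  simp only [Fin.sum_univ_three, i1, i2, i3, inner_sub_left, real_inner_comm (W _) (k _)]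
  ring

lemma mem_dualPolygons {K : Set Plane} (hK : IsConvexBody K) {b : Fin 3 → Plane}
    (h : ∀ W, ∑ i, inner ℝ (b i) (W i) ≤ len K W) : b ∈ dualPolygons K := by
  have hne : K.Nonempty := hK.2.2.mono interior_subset
  have hcp : IsCompact (dualPolygons K) :=
    (isCompact_univ_pi fun _ => hK.1).image (by fun_prop)
  have hcv : Convex ℝ (dualPolygons K) := by
    have hl : IsLinearMap ℝ (fun k : Fin 3 → Plane => fun i => k (i + 1) - k i) :=
      ⟨fun x y => by funext i; simp only [Pi.add_apply]; abel,
       fun c x => by funext i; simp only [Pi.smul_apply, smul_sub]⟩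
    exact (convex_pi fun _ _ => hK.2.1).is_linear_image hl
  by_contra hb
  obtain ⟨f, u, hfM, hfb⟩ := geometric_hahn_banach_closed_point hcv hcp.isClosed hb
  obtain ⟨W, hW⟩ := exists_repr_of_functional f
  choose k hkK hk using fun i : Fin 3 => exists_inner_eq_supp hK.1 hne (W i - W (i + 1))
  have h1 := hfM _ ⟨fun i => k (i - 1), fun i _ => hkK _, rfl⟩
  rw [hW] at h1 hfb
  simp only [real_inner_comm _ (W _)] at h1 hfb
  rw [sum_inner_dual (fun i => k (i - 1)) W] at h1
  simp only [add_sub_cancel_right, hk] at h1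
  have := h W
  unfold len at this
  linarith

/-- There is a closed characteristic whose action is at most the length of a given triangle that
does not fit into the interior of `T`. -/
theorem exists_closedCharacteristic_le {K T : Set Plane} (hK : IsConvexBody K)
    (hT : IsConvexBody T) {z : Phase} (hz : z ∈ interior (K ×ˢ T)) {W₀ : Fin 3 → Plane}
    (hW₀ : ¬ Fits (interior T) W₀) :
    ∃ γ, IsClosedCharacteristic (-z +ᵥ (K ×ˢ T)) γ ∧ action γ ≤ len K W₀ := by
  obtain ⟨W₁, hW₁, hle, hmin⟩ := exists_minimal_not_fits hK.1 hK.2.2 hW₀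
  have hKne : K.Nonempty := hK.2.2.mono interior_subset
  have hpos₁ : ∀ W, ¬ Fits (interior T) W → 0 < len K W := fun W hW =>
    not_le.1 fun hle => hW (fits_of_len_nonpos hK hT.2.2 hle)
  have hfit : Fits T W₁ := by
    refine fits_of_forall_lt_one hT.1 fun θ hθ => ?_
    by_contra hn
    have h1 : ¬ Fits (interior T) (θ • W₁) := fun ⟨s, hs⟩ => hn ⟨s, fun i => interior_subset (hs i)⟩
    have h2 := hmin _ h1
    rw [len_smul K hθ.1.le] at h2
    have := hpos₁ _ hW₁
    nlinarith [hθ.2]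
  obtain ⟨s, hs⟩ := hfit
  set W : Fin 3 → Plane := fun i => W₁ i + s with hWdef
  have hW : ¬ Fits (interior T) W := by rwa [hWdef, Fits.add_const]
  have hlen : len K W = len K W₁ := len_add_const _ _ _
  obtain ⟨a, ha0, hasum, ha⟩ := exists_normals_of_not_fits hT.2.1 hT.2.2 hW
  have hN : ∀ i, ∀ y ∈ T, inner ℝ (a i) y ≤ inner ℝ (a i) (W i) := fun i y hy =>
    inner_le_of_sum_le hs ha i hy
  have hM : 0 < ∑ i, inner ℝ (a i) (W i) := by
    obtain ⟨x, hx⟩ := hT.2.2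
    obtain ⟨j, hj⟩ := Function.ne_iff.1 ha0
    have h1 : ∑ i, inner ℝ (a i) x = 0 := by rw [← sum_inner, hasum, inner_zero_left]
    rw [← h1]
    exact Finset.sum_lt_sum (fun i _ => hN i x (interior_subset hx))
      ⟨j, Finset.mem_univ _, inner_lt_of_mem_interior hx hj (hN j)⟩
  set M := ∑ i, inner ℝ (a i) (W i) with hMdef
  have hL := hpos₁ W hW
  have hμ : 0 < len K W / M := div_pos hL hM
  have hdual : (fun i => (len K W / M) • a i) ∈ dualPolygons K := by
    apply mem_dualPolygons hK
    intro X
    simp only [inner_smul_left, conj_trivial, ← Finset.mul_sum]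
    rcases le_or_gt (∑ i, inner ℝ (a i) (X i)) 0 with h | h
    · exact (mul_nonpos_of_nonneg_of_nonpos hμ.le h).trans (len_nonneg hK.1 hKne X)
    · set N := ∑ i, inner ℝ (a i) (X i) with hNdef
      have hMN : 0 ≤ M / N := (div_pos hM h).le
      have h1 : ¬ Fits (interior T) ((M / N) • X) := by
        refine not_fits_of_normals ha0 hasum fun Y hY => (ha Y hY).trans ?_
        simp only [Pi.smul_apply, inner_smul_right, ← Finset.mul_sum]
        rw [← hNdef, div_mul_cancel₀ _ h.ne']
      have h2 := hmin _ h1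
      rw [len_smul K hMN, ← hlen, div_mul_eq_mul_div, le_div_iff₀ h] at h2
      rw [div_mul_eq_mul_div, div_le_iff₀ hM]
      linarith
  obtain ⟨k, hkK, hk⟩ := hdual
  have hk' : ∀ i, k (i + 1) - k i = (len K W / M) • a i := fun i => congrFun hk i
  have hkK' : ∀ i, k i ∈ K := fun i => hkK i trivial
  have hsum : ∑ i, inner ℝ (W i - W (i + 1)) (k (i + 1)) = len K W := by
    rw [← sum_inner_dual]
    simp only [hk', inner_smul_left, conj_trivial, ← Finset.mul_sum]
    rw [← hMdef, div_mul_cancel₀ _ hM.ne']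
  have heq : ∀ i, inner ℝ (W i - W (i + 1)) (k (i + 1)) = supp K (W i - W (i + 1)) := by
    have := (Finset.sum_eq_sum_iff_of_le (s := Finset.univ)
      (f := fun i => inner ℝ (W i - W (i + 1)) (k (i + 1))) (g := fun i => supp K (W i - W (i + 1)))
      fun i _ => inner_le_supp hK.1 _ (hkK' _)).1 hsum
    exact fun i => this i (Finset.mem_univ i)
  obtain ⟨γ, hγ, hA⟩ := exists_closedCharacteristic_of_polygon hK.2.1 hT.2.1 hz k W hkK' hs
    (fun i y hy => by
      rw [hk', inner_smul_left, inner_smul_left]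
      exact mul_le_mul_of_nonneg_left (hN i y hy) hμ.le)
    (fun i y hy => by rw [heq]; exact inner_le_supp hK.1 _ hy) (by rw [hsum]; exact hL)
  exact ⟨γ, hγ, by rw [hA, hsum, hlen]; exact hle⟩

/-- Triangles whose length is at most the capacity fit into `T`. -/
theorem IsEHZCapacity.fits {K T : Set Plane} (hK : IsConvexBody K) (hT : IsConvexBody T) {c : ℝ}
    (hc : IsEHZCapacity (K ×ˢ T) c) {W : Fin 3 → Plane} (hW : len K W ≤ c) : Fits T W := by
  obtain ⟨z₁, hz₁⟩ := hK.2.2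
  obtain ⟨z₂, hz₂⟩ := hT.2.2
  have hz : (z₁, z₂) ∈ interior (K ×ˢ T) := interior_prod_iff.2 ⟨hz₁, hz₂⟩
  have key : ∀ X, len K X < c → Fits T X := by
    intro X hX
    by_contra hn
    obtain ⟨γ, hγ, hA⟩ := exists_closedCharacteristic_le hK hT hz (W₀ := X)
      fun ⟨s, hs⟩ => hn ⟨s, fun i => interior_subset (hs i)⟩
    have := hc.2 ⟨_, hz, γ, hγ, rfl⟩
    linarith
  rcases (len_nonneg hK.1 ⟨z₁, interior_subset hz₁⟩ W).eq_or_lt with h0 | h0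
  · exact fits_of_len_nonpos hK (hT.2.2.mono interior_subset) h0.ge
  · refine fits_of_forall_lt_one hT.1 fun θ hθ => key _ ?_
    rw [len_smul K hθ.1.le]
    nlinarith [hθ.2]

/-- A lower bound for all actions that is the length of a triangle which does not fit into the
interior of `T` is the capacity. -/
theorem isEHZCapacity_of_not_fits {K T : Set Plane} (hK : IsConvexBody K) (hT : IsConvexBody T)
    {c : ℝ} {W : Fin 3 → Plane} (hW : ¬ Fits (interior T) W) (hlen : len K W ≤ c)
    (hlow : ∀ z ∈ interior (K ×ˢ T), ∀ γ, IsClosedCharacteristic (-z +ᵥ (K ×ˢ T)) γ →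
      c ≤ action γ) : IsEHZCapacity (K ×ˢ T) c := by
  obtain ⟨z₁, hz₁⟩ := hK.2.2
  obtain ⟨z₂, hz₂⟩ := hT.2.2
  have hz : (z₁, z₂) ∈ interior (K ×ˢ T) := interior_prod_iff.2 ⟨hz₁, hz₂⟩
  obtain ⟨γ, hγ, hA⟩ := exists_closedCharacteristic_le hK hT hz hW
  refine ⟨⟨_, hz, γ, hγ, le_antisymm (hA.trans hlen) (hlow _ hz γ hγ)⟩, ?_⟩
  rintro _ ⟨z, hz, γ, hγ, rfl⟩
  exact hlow z hz γ hγ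

/-! ### Lower bounds for the action -/

lemma absolutelyContinuous_comp {X Y : Type*} [PseudoMetricSpace X] [PseudoMetricSpace Y]
    {f : ℝ → X} {a b : ℝ} (hf : AbsolutelyContinuousOnInterval f a b) {g : X → Y} {C : NNReal}
    (hg : LipschitzWith C g) : AbsolutelyContinuousOnInterval (fun t => g (f t)) a b := by
  unfold AbsolutelyContinuousOnInterval at hf ⊢
  refine squeeze_zero (fun E => Finset.sum_nonneg fun _ _ => dist_nonneg)
    (g := fun E => C * ∑ i ∈ Finset.range E.1, dist (f (E.2 i).1) (f (E.2 i).2)) (fun E => ?_) ?_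
  · rw [Finset.mul_sum]
    exact Finset.sum_le_sum fun i _ => hg.dist_le_mul _ _
  · simpa using hf.const_mul (C : ℝ)

lemma absolutelyContinuous_clm {E F : Type*} [NormedAddCommGroup E] [NormedSpace ℝ E]
    [NormedAddCommGroup F] [NormedSpace ℝ F] {f : ℝ → E} {a b : ℝ}
    (hf : AbsolutelyContinuousOnInterval f a b) (g : E →L[ℝ] F) :
    AbsolutelyContinuousOnInterval (fun t => g (f t)) a b :=
  absolutelyContinuous_comp hf g.lipschitz

lemma absolutelyContinuous_apply {q : ℝ → Plane} {a b : ℝ}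
    (hq : AbsolutelyContinuousOnInterval q a b) (i : Fin 2) :
    AbsolutelyContinuousOnInterval (fun t => q t i) a b :=
  absolutelyContinuous_clm hq (EuclideanSpace.proj i)

lemma hasDerivAt_apply {q : ℝ → Plane} {v : Plane} {t : ℝ} (h : HasDerivAt q v t) (i : Fin 2) :
    HasDerivAt (fun s => q s i) (v i) t :=
  (EuclideanSpace.proj (𝕜 := ℝ) i).hasFDerivAt.comp_hasDerivAt t h

lemma inner_plane (x y : Plane) : inner ℝ x y = x 0 * y 0 + x 1 * y 1 := by
  simp [PiLp.inner_apply, Fin.sum_univ_two, mul_comm]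

/-- The integral of `⟨q', p⟩`. -/
def pairing (q p : ℝ → Plane) (a b : ℝ) : ℝ :=
  ∫ t in a..b, (deriv (fun s => q s 0) t * p t 0 + deriv (fun s => q s 1) t * p t 1)

section Pairing

variable {q p : ℝ → Plane} {a b : ℝ}

lemma intervalIntegrable_pairing (hq : AbsolutelyContinuousOnInterval q a b)
    (hp : ContinuousOn p (uIcc a b)) :
    IntervalIntegrable (fun t => deriv (fun s => q s 0) t * p t 0 + deriv (fun s => q s 1) t * p t 1)
      volume a b := by
  have h : ∀ i, ContinuousOn (fun t => p t i) (uIcc a b) := fun i =>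
    (EuclideanSpace.proj (𝕜 := ℝ) i).continuous.comp_continuousOn hp
  exact ((absolutelyContinuous_apply hq 0).intervalIntegrable_deriv.mul_continuousOn (h 0)).add
    ((absolutelyContinuous_apply hq 1).intervalIntegrable_deriv.mul_continuousOn (h 1))

lemma pairing_const (hq : AbsolutelyContinuousOnInterval q a b) (w : Plane) :
    pairing q (fun _ => w) a b = inner ℝ (q b - q a) w := by
  have h0 := absolutelyContinuous_apply hq 0
  have h1 := absolutelyContinuous_apply hq 1
  unfold pairing
  rw [intervalIntegral.integral_add (h0.intervalIntegrable_deriv.mul_const _)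
    (h1.intervalIntegrable_deriv.mul_const _), intervalIntegral.integral_mul_const,
    intervalIntegral.integral_mul_const, h0.integral_deriv_eq_sub, h1.integral_deriv_eq_sub,
    inner_plane]
  simp

lemma pairing_add_pairing (hq : AbsolutelyContinuousOnInterval q a b)
    (hp : AbsolutelyContinuousOnInterval p a b) :
    pairing q p a b + pairing p q a b = inner ℝ (q b) (p b) - inner ℝ (q a) (p a) := by
  unfold pairing
  rw [← intervalIntegral.integral_add (intervalIntegrable_pairing hq hp.continuousOn)
    (intervalIntegrable_pairing hp hq.continuousOn)]
  have h : ∀ i, ∫ t in a..b, deriv (fun s => q s i) t * p t i + q t i * deriv (fun s => p s i) t =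
      q b i * p b i - q a i * p a i := fun i =>
    (absolutelyContinuous_apply hq i).integral_deriv_mul_eq_sub (absolutelyContinuous_apply hp i)
  have hi : ∀ i, IntervalIntegrable
      (fun t => deriv (fun s => q s i) t * p t i + q t i * deriv (fun s => p s i) t) volume a b :=
    fun i => ((absolutelyContinuous_apply hq i).intervalIntegrable_deriv.mul_continuousOn
      (absolutelyContinuous_apply hp i).continuousOn).add
      ((absolutelyContinuous_apply hp i).intervalIntegrable_deriv.continuousOn_mul
      (absolutelyContinuous_apply hq i).continuousOn)
  rw [inner_plane, inner_plane]
  calc _ = ∫ t in a..b, ((deriv (fun s => q s 0) t * p t 0 + q t 0 * deriv (fun s => p s 0) t) +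
        (deriv (fun s => q s 1) t * p t 1 + q t 1 * deriv (fun s => p s 1) t)) := by
        congr 1; funext t; ring
    _ = _ := by rw [intervalIntegral.integral_add (hi 0) (hi 1), h 0, h 1]; ring

lemma pairing_split (hq : AbsolutelyContinuousOnInterval q 0 1)
    (hp : AbsolutelyContinuousOnInterval p 0 1) {r s t : ℝ} (hr : r ∈ Icc (0 : ℝ) 1)
    (hs : s ∈ Icc (0 : ℝ) 1) (ht : t ∈ Icc (0 : ℝ) 1) :
    pairing q p r s + pairing q p s t = pairing q p r t := by
  have h : ∀ x ∈ Icc (0 : ℝ) 1, ∀ y ∈ Icc (0 : ℝ) 1, uIcc x y ⊆ uIcc 0 1 := fun x hx y hy => by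
    rw [uIcc_of_le (zero_le_one' ℝ)]; exact ordConnected_Icc.uIcc_subset hx hy
  exact intervalIntegral.integral_add_adjacent_intervals
    (intervalIntegrable_pairing (hq.mono (h r hr s hs)) (hp.mono (h r hr s hs)).continuousOn)
    (intervalIntegrable_pairing (hq.mono (h s hs t ht)) (hp.mono (h s hs t ht)).continuousOn)

end Pairing

lemma ae_deriv_eq_zero {f : ℝ → ℝ} (hf : AbsolutelyContinuousOnInterval f 0 1) (h01 : f 0 = f 1)
    (h : ∀ᵐ t : ℝ, t ∈ Ioo (0 : ℝ) 1 → 0 ≤ deriv f t) :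
    ∀ᵐ t : ℝ, t ∈ Ioo (0 : ℝ) 1 → deriv f t = 0 := by
  have hi := hf.integral_deriv_eq_sub
  have hint := hf.intervalIntegrable_deriv
  rw [intervalIntegrable_iff_integrableOn_Ioo_of_le zero_le_one] at hint
  rw [h01, sub_self, intervalIntegral.integral_of_le zero_le_one, integral_Ioc_eq_integral_Ioo] at hi
  have h1 : 0 ≤ᵐ[volume.restrict (Ioo (0 : ℝ) 1)] deriv f :=
    (ae_restrict_iff' measurableSet_Ioo).2 h
  have h2 := (integral_eq_zero_iff_of_nonneg_ae h1 hint).1 hi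
  exact (ae_restrict_iff' measurableSet_Ioo).1 h2

lemma not_ae_notMem_Ioo (h : ∀ᵐ t : ℝ, t ∉ Ioo (0 : ℝ) 1) : False := by
  have : volume (Ioo (0 : ℝ) 1) = 0 := by
    rw [← nonpos_iff_eq_zero]
    refine le_trans (measure_mono fun t ht => ?_) (ae_iff.1 h).le
    simpa using ht
  simp at this

/-- The two components of a closed characteristic on the boundary of `K × T`, up to a sign which
makes the notion symmetric in the two factors. -/
structure IsCharPair (σ : ℝ) (K T : Set Plane) (q p : ℝ → Plane) : Prop where
  sign : σ * σ = 1
  acq : AbsolutelyContinuousOnInterval q 0 1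
  acp : AbsolutelyContinuousOnInterval p 0 1
  closedq : q 0 = q 1
  closedp : p 0 = p 1
  memq : ∀ t ∈ Icc (0 : ℝ) 1, q t ∈ K
  memp : ∀ t ∈ Icc (0 : ℝ) 1, p t ∈ T
  velocity : ∀ᵐ t : ℝ, t ∈ Ioo (0 : ℝ) 1 → ∃ A B : Plane, (A ≠ 0 ∨ B ≠ 0) ∧
    HasDerivAt q (-σ • B) t ∧ HasDerivAt p (σ • A) t ∧
    (∀ y ∈ K, inner ℝ A y ≤ inner ℝ A (q t)) ∧ ∀ y ∈ T, inner ℝ B y ≤ inner ℝ B (p t)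

namespace IsCharPair

variable {σ : ℝ} {K T : Set Plane} {q p : ℝ → Plane}

lemma swap (h : IsCharPair σ K T q p) : IsCharPair (-σ) T K p q where
  sign := by rw [neg_mul_neg]; exact h.sign
  acq := h.acp
  acp := h.acq
  closedq := h.closedp
  closedp := h.closedq
  memq := h.memp
  memp := h.memq
  velocity := by
    filter_upwards [h.velocity] with t ht htI
    obtain ⟨A, B, hne, hq, hp, hA, hB⟩ := ht htI
    exact ⟨B, A, hne.symm, by rwa [neg_neg], hq, hB, hA⟩

lemma pairing_swap (h : IsCharPair σ K T q p) : pairing p q 0 1 = -pairing q p 0 1 := by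
  have := pairing_add_pairing h.acq h.acp
  rw [h.closedq, h.closedp, sub_self] at this
  linarith

/-- The action of an arc is at least the length of its chord. -/
lemma inner_le_pairing (h : IsCharPair σ K T q p) {s t : ℝ} (hs : 0 ≤ s) (hst : s ≤ t) (ht : t ≤ 1)
    {w : Plane} (hw : w ∈ T) : -σ * inner ℝ (q t - q s) w ≤ -σ * pairing q p s t := by
  have hsub : uIcc s t ⊆ uIcc 0 1 := by
    rw [uIcc_of_le hst, uIcc_of_le (zero_le_one' ℝ)]; exact Icc_subset_Icc hs ht
  have hq := h.acq.mono hsub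
  have hp := h.acp.mono hsub
  rw [← pairing_const hq w]
  unfold pairing
  rw [← intervalIntegral.integral_const_mul, ← intervalIntegral.integral_const_mul]
  refine intervalIntegral.integral_mono_ae_restrict hst
    ((intervalIntegrable_pairing hq continuousOn_const).const_mul _)
    ((intervalIntegrable_pairing hq hp.continuousOn).const_mul _) ?_
  rw [Filter.EventuallyLE, ae_restrict_iff' measurableSet_Icc]
  have h0 : ∀ᵐ x : ℝ, x ≠ 0 := by simp [ae_iff]
  have h1 : ∀ᵐ x : ℝ, x ≠ 1 := by simp [ae_iff]
  filter_upwards [h.velocity, h0, h1] with x hx hx0 hx1 hxI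
  obtain ⟨A, B, -, hqd, -, -, hB⟩ := hx ⟨lt_of_le_of_ne (hs.trans hxI.1) hx0.symm,
    lt_of_le_of_ne (hxI.2.trans ht) hx1⟩
  have hBw := hB w hw
  rw [inner_plane, inner_plane] at hBw
  rw [(hasDerivAt_apply hqd 0).deriv, (hasDerivAt_apply hqd 1).deriv]
  simp only [PiLp.smul_apply, smul_eq_mul]
  calc -σ * (-σ * B 0 * w 0 + -σ * B 1 * w 1) = (σ * σ) * (B 0 * w 0 + B 1 * w 1) := by ring
    _ ≤ (σ * σ) * (B 0 * p x 0 + B 1 * p x 1) := by rw [h.sign]; linarith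
    _ = _ := by ring

lemma three_le (h : IsCharPair σ K T q p) {s₁ s₂ s₃ : ℝ} (h₁ : 0 ≤ s₁) (h₁₂ : s₁ ≤ s₂)
    (h₂₃ : s₂ ≤ s₃) (h₃ : s₃ ≤ 1) {w₁ w₂ w₃ : Plane} (hw₁ : w₁ ∈ T) (hw₂ : w₂ ∈ T) (hw₃ : w₃ ∈ T) :
    -σ * (inner ℝ (q s₂ - q s₁) w₁ + inner ℝ (q s₃ - q s₂) w₂ + inner ℝ (q s₁ - q s₃) w₃) ≤
      -σ * pairing q p 0 1 := by
  have e1 := h.inner_le_pairing le_rfl h₁ (by linarith) hw₃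
  have e2 := h.inner_le_pairing h₁ h₁₂ (by linarith) hw₁
  have e3 := h.inner_le_pairing (by linarith) h₂₃ h₃ hw₂
  have e4 := h.inner_le_pairing (by linarith) h₃ le_rfl hw₃
  have i0 : (0 : ℝ) ∈ Icc (0 : ℝ) 1 := by simp
  have i1 : (1 : ℝ) ∈ Icc (0 : ℝ) 1 := by simp
  have j1 : s₁ ∈ Icc (0 : ℝ) 1 := ⟨h₁, by linarith⟩
  have j2 : s₂ ∈ Icc (0 : ℝ) 1 := ⟨by linarith, by linarith⟩
  have j3 : s₃ ∈ Icc (0 : ℝ) 1 := ⟨by linarith, h₃⟩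
  rw [← pairing_split h.acq h.acp i0 j1 i1, ← pairing_split h.acq h.acp j1 j2 i1,
    ← pairing_split h.acq h.acp j2 j3 i1]
  simp only [inner_sub_left, h.closedq] at *
  linarith

/-- The action is at least the length of an inscribed triangle, traversed in time order. -/
lemma cyclic_le (h : IsCharPair σ K T q p) {s : Fin 3 → ℝ} (hs : ∀ i, s i ∈ Icc (0 : ℝ) 1)
    (hord : (s 0 ≤ s 1 ∧ s 1 ≤ s 2) ∨ (s 1 ≤ s 2 ∧ s 2 ≤ s 0) ∨ (s 2 ≤ s 0 ∧ s 0 ≤ s 1))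
    {w : Fin 3 → Plane} (hw : ∀ i, w i ∈ T) :
    -σ * (inner ℝ (q (s 1) - q (s 0)) (w 0) + inner ℝ (q (s 2) - q (s 1)) (w 1) +
      inner ℝ (q (s 0) - q (s 2)) (w 2)) ≤ -σ * pairing q p 0 1 := by
  rcases hord with ⟨a, b⟩ | ⟨a, b⟩ | ⟨a, b⟩
  · exact h.three_le (hs 0).1 a b (hs 2).2 (hw 0) (hw 1) (hw 2)
  · have := h.three_le (hs 1).1 a b (hs 0).2 (hw 1) (hw 2) (hw 0)
    linarith
  · have := h.three_le (hs 2).1 a b (hs 1).2 (hw 2) (hw 0) (hw 1)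
    linarith

/-- The action is at least the length of an inscribed segment, traversed twice. -/
lemma two_le (h : IsCharPair σ K T q p) {s t : ℝ} (hs : s ∈ Icc (0 : ℝ) 1) (ht : t ∈ Icc (0 : ℝ) 1)
    {w₁ w₂ : Plane} (hw₁ : w₁ ∈ T) (hw₂ : w₂ ∈ T) :
    -σ * inner ℝ (q t - q s) (w₁ - w₂) ≤ -σ * pairing q p 0 1 := by
  rcases le_total s t with hst | hst
  · have := h.three_le hs.1 hst le_rfl ht.2 hw₁ hw₁ hw₂
    simp only [inner_sub_left, inner_sub_right] at *
    linarith
  · have := h.three_le ht.1 hst le_rfl hs.2 hw₂ hw₁ hw₁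
    simp only [inner_sub_left, inner_sub_right] at *
    linarith

/-- The first component cannot be translated into the interior of `K`. -/
lemma not_translate (h : IsCharPair σ K T q p) (hTi : (interior T).Nonempty) (s : Plane) :
    ¬ ∀ t ∈ Icc (0 : ℝ) 1, q t + s ∈ interior K := by
  intro hs
  have hneg : ∀ t ∈ Icc (0 : ℝ) 1, ∀ A : Plane, A ≠ 0 → (∀ y ∈ K, inner ℝ A y ≤ inner ℝ A (q t)) →
      inner ℝ A s < 0 := by
    intro t ht A hA hN
    have := inner_lt_of_mem_interior (hs t ht) hA hN
    rw [inner_add_right] at this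
    linarith
  have hacL : ∀ (r : ℝ → Plane), AbsolutelyContinuousOnInterval r 0 1 → ∀ v : Plane,
      AbsolutelyContinuousOnInterval (fun t => inner ℝ v (r t)) 0 1 := fun r hr v =>
    absolutelyContinuous_clm hr (innerSL ℝ v)
  have hdL : ∀ (r : ℝ → Plane) (v b : Plane) (t : ℝ), HasDerivAt r b t →
      HasDerivAt (fun t => inner ℝ v (r t)) (inner ℝ v b) t := fun r v b t hr =>
    (innerSL ℝ v).hasFDerivAt.comp_hasDerivAt t hr
  have hA0 : ∀ᵐ t : ℝ, t ∈ Ioo (0 : ℝ) 1 → HasDerivAt p 0 t := by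
    have h1 := ae_deriv_eq_zero (hacL p h.acp (-σ • s)) (by rw [h.closedp]) (by
      filter_upwards [h.velocity] with t ht htI
      obtain ⟨A, B, -, -, hp, hA, -⟩ := ht htI
      rw [(hdL p _ _ t hp).deriv, inner_smul_left, inner_smul_right, conj_trivial, real_inner_comm]
      rcases eq_or_ne A 0 with rfl | hne
      · simp
      · have := hneg t (Ioo_subset_Icc_self htI) A hne hA
        calc (0 : ℝ) ≤ (σ * σ) * -inner ℝ A s := by rw [h.sign]; linarith
          _ = _ := by ring)
    filter_upwards [h1, h.velocity] with t h1 ht htI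
    obtain ⟨A, B, -, -, hp, hA, -⟩ := ht htI
    have h1 := h1 htI
    rw [(hdL p _ _ t hp).deriv, inner_smul_left, inner_smul_right, conj_trivial,
      real_inner_comm] at h1
    rcases eq_or_ne A 0 with rfl | hne
    · simpa using hp
    · have := hneg t (Ioo_subset_Icc_self htI) A hne hA
      have e : -σ * (σ * inner ℝ A s) = -((σ * σ) * inner ℝ A s) := by ring
      rw [e, h.sign] at h1
      linarith
  have h0 : ∀ᵐ x : ℝ, x ≠ 0 := by simp [ae_iff]
  have h1 : ∀ᵐ x : ℝ, x ≠ 1 := by simp [ae_iff]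
  obtain ⟨c, hc⟩ := h.acp.const_of_ae_hasDerivAt_zero (by
    filter_upwards [hA0, h0, h1] with t ht ht0 ht1 htI
    rw [uIcc_of_le zero_le_one] at htI
    exact ht ⟨lt_of_le_of_ne htI.1 ht0.symm, lt_of_le_of_ne htI.2 ht1⟩)
  rw [uIcc_of_le zero_le_one] at hc
  obtain ⟨x₀, hx₀⟩ := hTi
  have hder : ∀ᵐ t : ℝ, t ∈ Ioo (0 : ℝ) 1 →
      0 < deriv (fun t => inner ℝ (σ • (x₀ - c)) (q t)) t := by
    filter_upwards [hA0, h.velocity] with t hA0 ht htI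
    obtain ⟨A, B, hne, hq, hp, -, hB⟩ := ht htI
    have hA : A = 0 := by
      have := hp.unique (hA0 htI)
      have h2 : (σ * σ) • A = 0 := by rw [mul_smul, this, smul_zero]
      rwa [h.sign, one_smul] at h2
    have hB0 : B ≠ 0 := hne.resolve_left (not_not.2 hA)
    have hlt := inner_lt_of_mem_interior hx₀ hB0 hB
    rw [hc t (Ioo_subset_Icc_self htI)] at hlt
    rw [(hdL q _ _ t hq).deriv, inner_smul_left, inner_smul_right, conj_trivial, real_inner_comm,
      inner_sub_right]
    calc (0 : ℝ) < (σ * σ) * (inner ℝ B c - inner ℝ B x₀) := by rw [h.sign]; linarith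
      _ = _ := by ring
  have hz := ae_deriv_eq_zero (hacL q h.acq (σ • (x₀ - c))) (by rw [h.closedq]) (by
    filter_upwards [hder] with t ht htI using (ht htI).le)
  apply not_ae_notMem_Ioo
  filter_upwards [hder, hz] with t h1 h2 htI
  exact (h1 htI).ne' (h2 htI)

end IsCharPair

lemma IsClosedCharacteristic.isCharPair {K T : Set Plane} (hK : IsConvexBody K)
    (hT : IsConvexBody T) {z : Phase} (hz : z ∈ interior (K ×ˢ T)) {γ : ℝ → Phase}
    (h : IsClosedCharacteristic (-z +ᵥ (K ×ˢ T)) γ) :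
    IsCharPair (-1) K T (fun t => (γ t).1 + z.1) (fun t => (γ t).2 + z.2) := by
  have hC := neg_vadd_mem_nhds hz
  have hCc : IsClosed (-z +ᵥ (K ×ˢ T)) := (hK.1.isClosed.prod hT.1.isClosed).vadd _
  have hmem : ∀ t ∈ Icc (0 : ℝ) 1, γ t + z ∈ K ×ˢ T := by
    intro t ht
    have h1 := (gauge_le_one_iff_mem_closure (convex_neg_vadd_prod hK.2.1 hT.2.1 z) hC).1
      (h.boundary t ht).le
    rw [hCc.closure_eq] at h1
    exact mem_neg_vadd_iff.1 h1
  have acq' : AbsolutelyContinuousOnInterval (fun t => (γ t).1) 0 1 :=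
    absolutelyContinuous_clm h.absCont (ContinuousLinearMap.fst ℝ Plane Plane)
  have acp' : AbsolutelyContinuousOnInterval (fun t => (γ t).2) 0 1 :=
    absolutelyContinuous_clm h.absCont (ContinuousLinearMap.snd ℝ Plane Plane)
  have hiso : ∀ v : Plane, LipschitzWith 1 (fun x : Plane => x + v) := fun v =>
    (isometry_add_right v).lipschitz
  have acq : AbsolutelyContinuousOnInterval (fun t => (γ t).1 + z.1) 0 1 :=
    absolutelyContinuous_comp (g := fun x => x + z.1) acq' (hiso z.1)
  have acp : AbsolutelyContinuousOnInterval (fun t => (γ t).2 + z.2) 0 1 :=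
    absolutelyContinuous_comp (g := fun x => x + z.2) acp' (hiso z.2)
  refine ⟨by norm_num, acq, acp, by simp only [h.closed], by simp only [h.closed],
    fun t ht => (hmem t ht).1, fun t ht => (hmem t ht).2, ?_⟩
  filter_upwards [h.velocity] with t ht htI
  obtain ⟨r, hr, n, hn, hd⟩ := ht htI
  obtain ⟨hn1, hn2⟩ := normal_of_mem_subdifferential (h.boundary t (Ioo_subset_Icc_self htI)) hn
  have hm := hmem t (Ioo_subset_Icc_self htI)
  have hd1 : HasDerivAt (fun t => (γ t).1) (r • n.2) t :=
    (ContinuousLinearMap.fst ℝ Plane Plane).hasFDerivAt.comp_hasDerivAt t hd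
  have hd2 : HasDerivAt (fun t => (γ t).2) (r • -n.1) t :=
    (ContinuousLinearMap.snd ℝ Plane Plane).hasFDerivAt.comp_hasDerivAt t hd
  refine ⟨r • n.1, r • n.2, ?_, ?_, ?_, ?_, ?_⟩
  · by_contra hcon
    push Not at hcon
    have e1 := (smul_eq_zero.1 hcon.1).resolve_left hr.ne'
    have e2 := (smul_eq_zero.1 hcon.2).resolve_left hr.ne'
    simp [dot, e1, e2] at hn2
  · simpa using hd1.add_const z.1
  · simpa using hd2.add_const z.2
  · intro y hy
    have := hn1 ((y, (γ t).2 + z.2) - z) (mem_neg_vadd_iff.2 (by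
      rw [sub_add_cancel]; exact ⟨hy, hm.2⟩))
    simp only [dot, Prod.fst_sub, Prod.snd_sub, add_sub_cancel_right, inner_sub_right] at this hn2
    rw [inner_smul_left, inner_smul_left, conj_trivial]
    refine mul_le_mul_of_nonneg_left ?_ hr.le
    rw [inner_add_right]; linarith
  · intro y hy
    have := hn1 (((γ t).1 + z.1, y) - z) (mem_neg_vadd_iff.2 (by
      rw [sub_add_cancel]; exact ⟨hm.1, hy⟩))
    simp only [dot, Prod.fst_sub, Prod.snd_sub, add_sub_cancel_right, inner_sub_right] at this hn2
    rw [inner_smul_left, inner_smul_left, conj_trivial]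
    refine mul_le_mul_of_nonneg_left ?_ hr.le
    rw [inner_add_right]; linarith

lemma IsClosedCharacteristic.exists_isCharPair {K T : Set Plane} (hK : IsConvexBody K)
    (hT : IsConvexBody T) {z : Phase} (hz : z ∈ interior (K ×ˢ T)) {γ : ℝ → Phase}
    (h : IsClosedCharacteristic (-z +ᵥ (K ×ˢ T)) γ) :
    ∃ q p, IsCharPair (-1) K T q p ∧ action γ = pairing q p 0 1 := by
  have hpair := h.isCharPair hK hT hz
  refine ⟨_, _, hpair, ?_⟩
  set q := fun t => (γ t).1 + z.1 with hq
  set p := fun t => (γ t).2 + z.2 with hp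
  have c1 := pairing_const hpair.acq z.2
  have c2 := pairing_const hpair.acp z.1
  rw [hpair.closedq, sub_self, inner_zero_left] at c1
  rw [hpair.closedp, sub_self, inner_zero_left] at c2
  have i1 := intervalIntegrable_pairing hpair.acq hpair.acp.continuousOn
  have i2 := intervalIntegrable_pairing hpair.acp hpair.acq.continuousOn
  have i3 := intervalIntegrable_pairing hpair.acq (p := fun _ => z.2) continuousOn_const
  have i4 := intervalIntegrable_pairing hpair.acp (p := fun _ => z.1) continuousOn_const
  have key : ∫ t in (0 : ℝ)..1, dot (J4 (deriv γ t)) (γ t) =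
      (pairing p q 0 1 - pairing p (fun _ => z.1) 0 1) -
      (pairing q p 0 1 - pairing q (fun _ => z.2) 0 1) := by
    unfold pairing
    rw [← intervalIntegral.integral_sub i2 i4, ← intervalIntegral.integral_sub i1 i3,
      ← intervalIntegral.integral_sub (i2.sub i4) (i1.sub i3)]
    apply intervalIntegral.integral_congr_ae
    have h1 : ∀ᵐ t : ℝ, t ≠ 1 := by simp [ae_iff]
    filter_upwards [h.velocity, h1] with t ht ht1 htI
    rw [uIoc_of_le zero_le_one] at htI
    obtain ⟨r, hr, n, hn, hd⟩ := ht ⟨htI.1, lt_of_le_of_ne htI.2 ht1⟩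
    have hd1 : HasDerivAt (fun t => (γ t).1) (r • J4 n).1 t :=
      (ContinuousLinearMap.fst ℝ Plane Plane).hasFDerivAt.comp_hasDerivAt t hd
    have hd2 : HasDerivAt (fun t => (γ t).2) (r • J4 n).2 t :=
      (ContinuousLinearMap.snd ℝ Plane Plane).hasFDerivAt.comp_hasDerivAt t hd
    have hq' : HasDerivAt q (r • J4 n).1 t := hd1.add_const z.1
    have hp' : HasDerivAt p (r • J4 n).2 t := hd2.add_const z.2
    rw [hd.deriv, (hasDerivAt_apply hq' 0).deriv, (hasDerivAt_apply hq' 1).deriv,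
      (hasDerivAt_apply hp' 0).deriv, (hasDerivAt_apply hp' 1).deriv]
    simp only [dot, J4, inner_plane, hq, hp, PiLp.add_apply, Prod.smul_fst, Prod.smul_snd,
      PiLp.neg_apply, PiLp.smul_apply, smul_eq_mul]
    ring
  rw [action, key, c1, c2, hpair.pairing_swap]
  ring

/-! ### Convex bodies and equality cases -/

lemma isConvexBody_of_volume_pos {S : Set Plane} (hS : IsCompact S) (hc : Convex ℝ S)
    (hv : 0 < volume.real S) : IsConvexBody S := by
  refine ⟨hS, hc, ?_⟩
  by_contra hne
  rw [not_nonempty_iff_eq_empty] at hne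
  have h := hc.addHaar_frontier volume
  rw [frontier, hne, sdiff_empty, hS.isClosed.closure_eq] at h
  simp [Measure.real, h] at hv

lemma IsConvexBody.volume_pos {S : Set Plane} (hS : IsConvexBody S) : 0 < volume.real S :=
  ENNReal.toReal_pos ((isOpen_interior.measure_pos volume hS.2.2).trans_le
    (measure_mono interior_subset)).ne' (volume_ne_top_of_isCompact hS.1)

lemma IsConvexBody.vadd_smul {S : Set Plane} (hS : IsConvexBody S) {r : ℝ} (hr : 0 < r)
    (s : Plane) : IsConvexBody (s +ᵥ r • S) :=
  isConvexBody_of_volume_pos ((hS.1.smul r).vadd s) ((hS.2.1.smul r).vadd s) (by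
    rw [volume_real_vadd, volume_real_smul]
    have := hS.volume_pos
    positivity)

lemma IsEHZCapacity.nonneg {K T : Set Plane} (hK : IsConvexBody K) (hT : IsConvexBody T) {c : ℝ}
    (hc : IsEHZCapacity (K ×ˢ T) c) : 0 ≤ c := by
  obtain ⟨z, hz, γ, hγ, rfl⟩ := hc.1
  obtain ⟨q, p, h, hA⟩ := hγ.exists_isCharPair hK hT hz
  obtain ⟨w, hw⟩ := hT.2.2
  have := h.two_le (s := 0) (t := 0) (by simp) (by simp) (interior_subset hw) (interior_subset hw)
  simp only [sub_self, inner_zero_right, mul_zero, neg_neg, one_mul] at this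
  rwa [hA]

lemma volume_real_prod (K T : Set Plane) :
    volume.real (K ×ˢ T) = volume.real K * volume.real T := by
  rw [Measure.volume_eq_prod, measureReal_prod_prod]

lemma IsEqualityCase.exists_pos {K T : Set Plane} (h : IsEqualityCase K T) :
    ∃ c : ℝ, 0 < c ∧ IsEHZCapacity (K ×ˢ T) c ∧ volume.real K * volume.real T = c ^ 2 / 2 := by
  obtain ⟨hK, hT, c, hc, hv⟩ := h
  rw [volume_real_prod] at hv
  refine ⟨c, lt_of_le_of_ne (hc.nonneg hK hT) ?_, hc, hv⟩
  rintro rfl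
  have := mul_pos hK.volume_pos hT.volume_pos
  norm_num at hv
  rcases hv with h | h <;> simp [h] at this

lemma mem_vadd_smul {S : Set Plane} {s x : Plane} {r : ℝ} :
    x ∈ s +ᵥ r • S ↔ ∃ y ∈ S, x = s + r • y := by
  simp only [mem_vadd_set, mem_smul_set, vadd_eq_add]
  constructor
  · rintro ⟨_, ⟨y, hy, rfl⟩, rfl⟩; exact ⟨y, hy, rfl⟩
  · rintro ⟨y, hy, rfl⟩; exact ⟨_, ⟨y, hy, rfl⟩, rfl⟩

lemma vadd_smul_convexHull_subset {A T : Set Plane} (hT : Convex ℝ T) {s : Plane} {r : ℝ}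
    (h : ∀ x ∈ A, s + r • x ∈ T) : s +ᵥ r • convexHull ℝ A ⊆ T := by
  rw [← convexHull_smul, ← convexHull_vadd]
  refine convexHull_min ?_ hT
  intro x hx
  obtain ⟨y, hy, rfl⟩ := mem_vadd_smul.1 hx
  exact h y hy

lemma isCompact_convexHull_of_finite {A : Set Plane} (hA : A.Finite) :
    IsCompact (convexHull ℝ A) := hA.isCompact_convexHull ℝ

lemma inner_le_of_mem_convexHull {A : Set Plane} {d : Plane} {M : ℝ}
    (h : ∀ x ∈ A, inner ℝ d x ≤ M) : ∀ x ∈ convexHull ℝ A, inner ℝ d x ≤ M :=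
  convexHull_min h (convex_halfSpace_le
    ⟨fun x y => inner_add_right d x y, fun c x => inner_smul_right d x c⟩ M)

/-! ### Triangles -/

lemma inner_J2 (a b : Plane) : inner ℝ (J2 a) b = cross b a := by
  rw [inner_plane]; simp [J2, cross]; ring

/-- The rotation `J2` as a linear map. -/
def J2Lin : Plane →ₗ[ℝ] Plane where
  toFun := J2
  map_add' x y := by ext i; fin_cases i <;> simp [J2]; ring
  map_smul' r x := by ext i; fin_cases i <;> simp [J2]

lemma J2_sub (a b : Plane) : J2 (a - b) = J2 a - J2 b := map_sub J2Lin a b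

lemma cross_J2 (a b : Plane) : cross (J2 a) (J2 b) = cross a b := by
  simp [cross, J2]; ring

lemma J2_image_convexHull (A : Set Plane) : J2 '' convexHull ℝ A = convexHull ℝ (J2 '' A) :=
  J2Lin.image_convexHull A

lemma convex_cross_nonneg (u a : Plane) : Convex ℝ {x | 0 ≤ cross u (x - a)} := by
  have : {x | 0 ≤ cross u (x - a)} = {x | cross u a ≤ cross u x} := by
    ext x; simp [cross_sub]
  rw [this]
  exact convex_halfSpace_ge (isLinearMap_cross _) _

/-- A convex set containing a triangle and a reflected copy has at least twice its area. -/
lemma two_triangles_le {H : Set Plane} (hc : Convex ℝ H) (hH : volume H ≠ ⊤) {u₀ u₁ u₂ t : Plane}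
    (h0 : u₀ ∈ H) (h1 : u₁ ∈ H) (h2 : u₂ ∈ H) (k0 : t - u₀ ∈ H) (k1 : t - u₁ ∈ H) (k2 : t - u₂ ∈ H)
    (hX : 0 ≤ cross (u₁ - u₀) (u₂ - u₀)) : cross (u₁ - u₀) (u₂ - u₀) ≤ volume.real H := by
  set X := cross (u₁ - u₀) (u₂ - u₀) with hXdef
  have s0 : cross (u₂ - u₁) (u₀ - u₁) = X := by
    simp only [hXdef, cross, PiLp.sub_apply]; ring
  have s1 : cross (u₀ - u₂) (u₁ - u₂) = X := by
    simp only [hXdef, cross, PiLp.sub_apply]; ring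
  have single : ∀ a b c d : Plane, a ∈ H → b ∈ H → c ∈ H → d ∈ H →
      cross (b - a) (d - a) = X → cross (b - a) (c - a) ≤ -X → X ≤ volume.real H := by
    intro a b c d ha hb hc' hd hX1 hX2
    have := quad_le hc hH ha hc' hb hd
    rw [show cross (b - a) (d - c) = cross (b - a) (d - a) - cross (b - a) (c - a) by
      simp only [cross, PiLp.sub_apply]; ring, hX1] at this
    have h2 := le_abs_self (X - cross (b - a) (c - a))
    linarith
  by_cases c0 : cross (u₂ - u₁) (t - u₀ - u₁) ≤ -X
  · exact single u₁ u₂ (t - u₀) u₀ h1 h2 k0 h0 s0 c0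
  by_cases c1 : cross (u₀ - u₂) (t - u₁ - u₂) ≤ -X
  · exact single u₂ u₀ (t - u₁) u₁ h2 h0 k1 h1 s1 c1
  by_cases c2 : cross (u₁ - u₀) (t - u₂ - u₀) ≤ -X
  · exact single u₀ u₁ (t - u₂) u₂ h0 h1 k2 h2 rfl c2
  push Not at c0 c1 c2
  have z : ∀ a b : Plane, 0 ≤ cross (b - a) (a - a) ∧ 0 ≤ cross (b - a) (b - a) := fun a b => by
    constructor <;> apply le_of_eq <;> simp only [cross, PiLp.sub_apply] <;> ring
  have e1 := cut_le hc hH h1 h2 k0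
  set H1 := H ∩ {x | 0 ≤ cross (u₂ - u₁) (x - u₁)} with hH1
  have hc1 : Convex ℝ H1 := hc.inter (convex_cross_nonneg _ _)
  have hv1 : volume H1 ≠ ⊤ := volume_inter_ne_top hH _
  have a10 : u₀ ∈ H1 := ⟨h0, by rw [mem_ofPred_eq, s0]; exact hX⟩
  have a11 : u₁ ∈ H1 := ⟨h1, (z u₁ u₂).1⟩
  have a12 : u₂ ∈ H1 := ⟨h2, (z u₁ u₂).2⟩
  have b11 : t - u₁ ∈ H1 := ⟨k1, by
    have : cross (u₂ - u₁) (t - u₁ - u₁) = cross (u₂ - u₁) (t - u₀ - u₁) + X := by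
      rw [← s0]; simp only [cross, PiLp.sub_apply]; ring
    rw [mem_ofPred_eq, this]; linarith⟩
  have b12 : t - u₂ ∈ H1 := ⟨k2, by
    have : cross (u₂ - u₁) (t - u₂ - u₁) = cross (u₂ - u₁) (t - u₀ - u₁) + X := by
      rw [← s0]; simp only [cross, PiLp.sub_apply]; ring
    rw [mem_ofPred_eq, this]; linarith⟩
  have e2 := cut_le hc1 hv1 a12 a10 b11
  set H2 := H1 ∩ {x | 0 ≤ cross (u₀ - u₂) (x - u₂)} with hH2
  have hc2 : Convex ℝ H2 := hc1.inter (convex_cross_nonneg _ _)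
  have hv2 : volume H2 ≠ ⊤ := volume_inter_ne_top hv1 _
  have a20 : u₀ ∈ H2 := ⟨a10, (z u₂ u₀).2⟩
  have a21 : u₁ ∈ H2 := ⟨a11, by rw [mem_ofPred_eq, s1]; exact hX⟩
  have a22 : u₂ ∈ H2 := ⟨a12, (z u₂ u₀).1⟩
  have b22 : t - u₂ ∈ H2 := ⟨b12, by
    have : cross (u₀ - u₂) (t - u₂ - u₂) = cross (u₀ - u₂) (t - u₁ - u₂) + X := by
      rw [← s1]; simp only [cross, PiLp.sub_apply]; ring
    rw [mem_ofPred_eq, this]; linarith⟩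
  have e3 := cut_le hc2 hv2 a20 a21 b22
  have e4 := triangle_le (hc2.inter (convex_cross_nonneg (u₁ - u₀) u₀))
    (volume_inter_ne_top hv2 _) ⟨a20, (z u₀ u₁).1⟩ ⟨a21, (z u₀ u₁).2⟩ (c := u₂) ⟨a22, hX⟩
  rw [← hXdef, abs_of_nonneg hX] at e4
  have tot : cross (u₂ - u₁) (t - u₀ - u₁) + cross (u₀ - u₂) (t - u₁ - u₂) +
      cross (u₁ - u₀) (t - u₂ - u₀) = -X := by
    simp only [hXdef, cross, PiLp.sub_apply]; ring
  linarith

section Triangle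

variable {v₀ v₁ v₂ : Plane}

lemma mem_triangle_of_cross_nonneg (hX : 0 < cross (v₁ - v₀) (v₂ - v₀)) {x : Plane}
    (h0 : 0 ≤ cross (v₂ - v₁) (x - v₁)) (h1 : 0 ≤ cross (v₀ - v₂) (x - v₂))
    (h2 : 0 ≤ cross (v₁ - v₀) (x - v₀)) : x ∈ convexHull ℝ {v₀, v₁, v₂} := by
  rw [mem_convexHull_triple]
  set X := cross (v₁ - v₀) (v₂ - v₀) with hXd
  have hs : cross (v₂ - v₁) (x - v₁) + cross (v₀ - v₂) (x - v₂) + cross (v₁ - v₀) (x - v₀) = X := by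
    simp only [hXd, cross, PiLp.sub_apply]; ring
  refine ⟨cross (v₀ - v₂) (x - v₂) / X, cross (v₁ - v₀) (x - v₀) / X, by positivity, by positivity,
    ?_, ?_⟩
  · rw [← add_div, div_le_one hX]; linarith
  · have hX' := hX.ne'
    ext i
    simp only [PiLp.add_apply, PiLp.smul_apply, smul_eq_mul, PiLp.sub_apply]
    field_simp
    simp only [hXd, cross, PiLp.sub_apply]
    fin_cases i <;> simp only [Fin.zero_eta, Fin.mk_one] <;> ring

lemma cross_nonneg_of_mem_triangle (hX : 0 < cross (v₁ - v₀) (v₂ - v₀)) {x : Plane}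
    (hx : x ∈ convexHull ℝ {v₀, v₁, v₂}) : 0 ≤ cross (v₂ - v₁) (x - v₁) := by
  refine convexHull_min ?_ (convex_cross_nonneg (v₂ - v₁) v₁) hx
  have e : cross (v₂ - v₁) (v₀ - v₁) = cross (v₁ - v₀) (v₂ - v₀) := by
    simp only [cross, PiLp.sub_apply]; ring
  rintro y (rfl | rfl | rfl)
  · rw [mem_ofPred_eq, e]; exact hX.le
  · simp [cross]
  · simp [cross]; apply le_of_eq; ring

lemma mem_interior_triangle (hX : 0 < cross (v₁ - v₀) (v₂ - v₀)) {x : Plane}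
    (h0 : 0 < cross (v₂ - v₁) (x - v₁)) (h1 : 0 < cross (v₀ - v₂) (x - v₂))
    (h2 : 0 < cross (v₁ - v₀) (x - v₀)) : x ∈ interior (convexHull ℝ {v₀, v₁, v₂}) := by
  have ho : ∀ u a : Plane, IsOpen {x : Plane | 0 < cross u (x - a)} := fun u a =>
    isOpen_lt continuous_const ((continuous_cross u).comp (continuous_id.sub continuous_const))
  refine interior_maximal (t := {x | 0 < cross (v₂ - v₁) (x - v₁)} ∩
    {x | 0 < cross (v₀ - v₂) (x - v₂)} ∩ {x | 0 < cross (v₁ - v₀) (x - v₀)}) ?_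
    (((ho _ _).inter (ho _ _)).inter (ho _ _)) ⟨⟨h0, h1⟩, h2⟩
  rintro y ⟨⟨a, b⟩, c⟩
  exact mem_triangle_of_cross_nonneg hX (le_of_lt a) (le_of_lt b) (le_of_lt c)

/-- The first component of a closed characteristic touches the side opposite to `v₀`. -/
lemma IsCharPair.touches_side {σ : ℝ} {T : Set Plane} {q p : ℝ → Plane}
    (hX : 0 < cross (v₁ - v₀) (v₂ - v₀)) (h : IsCharPair σ (convexHull ℝ {v₀, v₁, v₂}) T q p)
    (hTi : (interior T).Nonempty) :
    ∃ t ∈ Icc (0 : ℝ) 1, cross (v₂ - v₁) (q t - v₁) = 0 := by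
  have hqc : ContinuousOn q (Icc 0 1) := by
    have := h.acq.continuousOn; rwa [uIcc_of_le zero_le_one] at this
  obtain ⟨t₀, ht₀, hmin⟩ := isCompact_Icc.exists_isMinOn (nonempty_Icc.2 (zero_le_one' ℝ))
    (f := fun t => cross (v₂ - v₁) (q t - v₁))
    ((continuous_cross _).comp_continuousOn (hqc.sub continuousOn_const))
  by_contra hcon
  push Not at hcon
  have X1 : cross (v₂ - v₁) (v₀ - v₁) = cross (v₁ - v₀) (v₂ - v₀) := by
    simp only [cross, PiLp.sub_apply]; ring
  have X2 : cross (v₀ - v₂) (v₁ - v₂) = cross (v₁ - v₀) (v₂ - v₀) := by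
    simp only [cross, PiLp.sub_apply]; ring
  have s1 : ({v₀, v₁, v₂} : Set Plane) = {v₁, v₂, v₀} := by
    ext; simp only [mem_insert_iff, mem_singleton_iff]; tauto
  have s2 : ({v₀, v₁, v₂} : Set Plane) = {v₂, v₀, v₁} := by
    ext; simp only [mem_insert_iff, mem_singleton_iff]; tauto
  set X := cross (v₁ - v₀) (v₂ - v₀) with hXd
  set μ := cross (v₂ - v₁) (q t₀ - v₁) with hμ
  have hμ0 : 0 < μ := lt_of_le_of_ne (cross_nonneg_of_mem_triangle hX (h.memq t₀ ht₀))
    (hcon t₀ ht₀).symm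
  set ε := μ / (2 * X) with hε
  have hε0 : 0 < ε := by positivity
  have hεX : ε * X = μ / 2 := by rw [hε]; field_simp
  refine h.not_translate hTi (ε • ((1 / 2 : ℝ) • (v₁ + v₂) - v₀)) fun t ht => ?_
  have hm := h.memq t ht
  have b0 : μ ≤ cross (v₂ - v₁) (q t - v₁) := hmin ht
  have b1 : 0 ≤ cross (v₀ - v₂) (q t - v₂) :=
    cross_nonneg_of_mem_triangle (v₀ := v₁) (v₁ := v₂) (v₂ := v₀) (by rw [X1]; exact hX) (s1 ▸ hm)
  have b2 : 0 ≤ cross (v₁ - v₀) (q t - v₀) :=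
    cross_nonneg_of_mem_triangle (v₀ := v₂) (v₁ := v₀) (v₂ := v₁) (by rw [X2]; exact hX) (s2 ▸ hm)
  have key : ∀ u a : Plane, cross u (q t + ε • ((1 / 2 : ℝ) • (v₁ + v₂) - v₀) - a) =
      cross u (q t - a) + ε * cross u ((1 / 2 : ℝ) • (v₁ + v₂) - v₀) := fun u a => by
    simp only [cross, PiLp.sub_apply, PiLp.add_apply, PiLp.smul_apply, smul_eq_mul]; ring
  have d0 : cross (v₂ - v₁) ((1 / 2 : ℝ) • (v₁ + v₂) - v₀) = -X := by
    simp only [hXd, cross, PiLp.sub_apply, PiLp.add_apply, PiLp.smul_apply, smul_eq_mul]; ring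
  have d1 : cross (v₀ - v₂) ((1 / 2 : ℝ) • (v₁ + v₂) - v₀) = X / 2 := by
    simp only [hXd, cross, PiLp.sub_apply, PiLp.add_apply, PiLp.smul_apply, smul_eq_mul]; ring
  have d2 : cross (v₁ - v₀) ((1 / 2 : ℝ) • (v₁ + v₂) - v₀) = X / 2 := by
    simp only [hXd, cross, PiLp.sub_apply, PiLp.add_apply, PiLp.smul_apply, smul_eq_mul]; ring
  apply mem_interior_triangle hX
  · rw [key, d0]; linarith
  · rw [key, d1]; nlinarith
  · rw [key, d2]; nlinarith

lemma pairing_ge_of_triangle {T : Set Plane} {q p : ℝ → Plane}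
    (hX : 0 < cross (v₁ - v₀) (v₂ - v₀)) (h : IsCharPair (-1) (convexHull ℝ {v₀, v₁, v₂}) T q p)
    (hTi : (interior T).Nonempty) {r : ℝ} {s s' : Plane}
    (h0 : s + r • J2 v₀ ∈ T) (h1 : s + r • J2 v₁ ∈ T) (h2 : s + r • J2 v₂ ∈ T)
    (k0 : s' - r • J2 v₀ ∈ T) (k1 : s' - r • J2 v₁ ∈ T) (k2 : s' - r • J2 v₂ ∈ T) :
    r * cross (v₁ - v₀) (v₂ - v₀) ≤ pairing q p 0 1 := by
  have X1 : cross (v₂ - v₁) (v₀ - v₁) = cross (v₁ - v₀) (v₂ - v₀) := by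
    simp only [cross, PiLp.sub_apply]; ring
  have X2 : cross (v₀ - v₂) (v₁ - v₂) = cross (v₁ - v₀) (v₂ - v₀) := by
    simp only [cross, PiLp.sub_apply]; ring
  have s1 : ({v₀, v₁, v₂} : Set Plane) = {v₁, v₂, v₀} := by
    ext; simp only [mem_insert_iff, mem_singleton_iff]; tauto
  have s2 : ({v₀, v₁, v₂} : Set Plane) = {v₂, v₀, v₁} := by
    ext; simp only [mem_insert_iff, mem_singleton_iff]; tauto
  obtain ⟨t0, ht0, e0⟩ := h.touches_side hX hTi
  obtain ⟨t1, ht1, e1⟩ := IsCharPair.touches_side (v₀ := v₁) (v₁ := v₂) (v₂ := v₀)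
    (by rw [X1]; exact hX) (s1 ▸ h) hTi
  obtain ⟨t2, ht2, e2⟩ := IsCharPair.touches_side (v₀ := v₂) (v₁ := v₀) (v₂ := v₁)
    (by rw [X2]; exact hX) (s2 ▸ h) hTi
  have mem3 : ∀ (a b c : ℝ), a ∈ Icc (0 : ℝ) 1 → b ∈ Icc (0 : ℝ) 1 → c ∈ Icc (0 : ℝ) 1 →
      ∀ i, (![a, b, c] : Fin 3 → ℝ) i ∈ Icc (0 : ℝ) 1 := by
    intro a b c ha hb hc i; fin_cases i <;> assumption
  have memT : ∀ (a b c : Plane), a ∈ T → b ∈ T → c ∈ T → ∀ i, (![a, b, c] : Fin 3 → Plane) i ∈ T := by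
    intro a b c ha hb hc i; fin_cases i <;> assumption
  have cyc : (t0 ≤ t1 ∧ t1 ≤ t2) ∨ (t1 ≤ t2 ∧ t2 ≤ t0) ∨ (t2 ≤ t0 ∧ t0 ≤ t1) →
      r * cross (v₁ - v₀) (v₂ - v₀) ≤ pairing q p 0 1 := by
    intro ho
    have := h.cyclic_le (mem3 t0 t1 t2 ht0 ht1 ht2) ho (memT _ _ _ k2 k0 k1)
    simp only [neg_neg, one_mul, Matrix.cons_val_zero, Matrix.cons_val_one, Matrix.cons_val] at this
    refine le_trans (le_of_eq ?_) this
    simp only [inner_plane, cross, J2, PiLp.sub_apply, PiLp.smul_apply, smul_eq_mul,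
      Matrix.cons_val_zero, Matrix.cons_val_one] at e0 e1 e2 ⊢
    linear_combination r * (e0 + e1 + e2)
  have anti : (t0 ≤ t2 ∧ t2 ≤ t1) ∨ (t2 ≤ t1 ∧ t1 ≤ t0) ∨ (t1 ≤ t0 ∧ t0 ≤ t2) →
      r * cross (v₁ - v₀) (v₂ - v₀) ≤ pairing q p 0 1 := by
    intro ho
    have := h.cyclic_le (mem3 t0 t2 t1 ht0 ht2 ht1) ho (memT _ _ _ h1 h0 h2)
    simp only [neg_neg, one_mul, Matrix.cons_val_zero, Matrix.cons_val_one, Matrix.cons_val] at this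
    refine le_trans (le_of_eq ?_) this
    simp only [inner_plane, cross, J2, PiLp.sub_apply, PiLp.add_apply, PiLp.smul_apply, smul_eq_mul,
      Matrix.cons_val_zero, Matrix.cons_val_one] at e0 e1 e2 ⊢
    linear_combination r * (e0 + e1 + e2)
  rcases le_total t0 t1 with a | a <;> rcases le_total t1 t2 with b | b <;>
    rcases le_total t0 t2 with c | c
  · exact cyc (Or.inl ⟨a, b⟩)
  · exact cyc (Or.inl ⟨a, b⟩)
  · exact anti (Or.inl ⟨c, b⟩)
  · exact cyc (Or.inr (Or.inr ⟨c, a⟩))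
  · exact anti (Or.inr (Or.inr ⟨a, c⟩))
  · exact cyc (Or.inr (Or.inl ⟨b, c⟩))
  · exact anti (Or.inr (Or.inl ⟨b, a⟩))
  · exact anti (Or.inr (Or.inl ⟨b, a⟩))

end Triangle

lemma convex_unitSquare : Convex ℝ unitSquare := by
  rintro x ⟨hx0, hx1⟩ y ⟨hy0, hy1⟩ a b ha hb hab
  refine ⟨?_, ?_⟩
  · simpa using convex_Icc (0 : ℝ) 1 hx0 hy0 ha hb hab
  · simpa using convex_Icc (0 : ℝ) 1 hx1 hy1 ha hb hab

section DoubleHull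

variable {v₀ v₁ v₂ : Plane}

lemma doubleHull_triangle (t : Plane) :
    doubleHull (convexHull ℝ {v₀, v₁, v₂}) t =
      convexHull ℝ ({J2 v₀, J2 v₁, J2 v₂} ∪ {t - J2 v₀, t - J2 v₁, t - J2 v₂}) := by
  have e : t +ᵥ -({J2 v₀, J2 v₁, J2 v₂} : Set Plane) = {t - J2 v₀, t - J2 v₁, t - J2 v₂} := by
    rw [← Set.image_neg_eq_neg, ← image_vadd, image_image]
    simp only [image_insert_eq, image_singleton, vadd_eq_add, sub_eq_add_neg]
  have hJ : J2 '' ({v₀, v₁, v₂} : Set Plane) = {J2 v₀, J2 v₁, J2 v₂} := by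
    simp only [image_insert_eq, image_singleton]
  unfold doubleHull
  rw [J2_image_convexHull, hJ, ← convexHull_neg, ← convexHull_vadd, e,
    convexHull_convexHull_union_left, convexHull_convexHull_union_right]

lemma isCompact_doubleHull (t : Plane) :
    IsCompact (doubleHull (convexHull ℝ {v₀, v₁, v₂}) t) := by
  rw [doubleHull_triangle]
  exact isCompact_convexHull_of_finite (Set.toFinite _)

lemma convex_doubleHull (D : Set Plane) (t : Plane) : Convex ℝ (doubleHull D t) :=
  convex_convexHull ℝ _

lemma mem_doubleHull (t : Plane) :
    (J2 v₀ ∈ doubleHull (convexHull ℝ {v₀, v₁, v₂}) t ∧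
      J2 v₁ ∈ doubleHull (convexHull ℝ {v₀, v₁, v₂}) t ∧
      J2 v₂ ∈ doubleHull (convexHull ℝ {v₀, v₁, v₂}) t) ∧
    (t - J2 v₀ ∈ doubleHull (convexHull ℝ {v₀, v₁, v₂}) t ∧
      t - J2 v₁ ∈ doubleHull (convexHull ℝ {v₀, v₁, v₂}) t ∧
      t - J2 v₂ ∈ doubleHull (convexHull ℝ {v₀, v₁, v₂}) t) := by
  rw [doubleHull_triangle]
  refine ⟨⟨?_, ?_, ?_⟩, ⟨?_, ?_, ?_⟩⟩ <;> apply subset_convexHull <;> simp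

lemma le_volume_doubleHull (hX : 0 < cross (v₁ - v₀) (v₂ - v₀)) (t : Plane) :
    cross (v₁ - v₀) (v₂ - v₀) ≤ volume.real (doubleHull (convexHull ℝ {v₀, v₁, v₂}) t) := by
  obtain ⟨⟨a0, a1, a2⟩, b0, b1, b2⟩ := mem_doubleHull (v₀ := v₀) (v₁ := v₁) (v₂ := v₂) t
  have e : cross (J2 v₁ - J2 v₀) (J2 v₂ - J2 v₀) = cross (v₁ - v₀) (v₂ - v₀) := by
    rw [← J2_sub, ← J2_sub, cross_J2]
  rw [← e] at hX ⊢
  exact two_triangles_le (convex_doubleHull _ _) (volume_ne_top_of_isCompact (isCompact_doubleHull t))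
    a0 a1 a2 b0 b1 b2 hX.le

lemma exists_volume_doubleHull_le (hX : 0 < cross (v₁ - v₀) (v₂ - v₀)) :
    ∃ t, volume.real (doubleHull (convexHull ℝ {v₀, v₁, v₂}) t) ≤ cross (v₁ - v₀) (v₂ - v₀) := by
  refine ⟨J2 v₁ + J2 v₂, ?_⟩
  rw [doubleHull_triangle]
  set u₀ := J2 v₀ with h0
  set u₁ := J2 v₁ with h1
  set u₂ := J2 v₂ with h2
  have e : cross (u₁ - u₀) (u₂ - u₀) = cross (v₁ - v₀) (v₂ - v₀) := by
    rw [h0, h1, h2, ← J2_sub, ← J2_sub, cross_J2]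
  have hsub : convexHull ℝ ({u₀, u₁, u₂} ∪ {u₁ + u₂ - u₀, u₁ + u₂ - u₁, u₁ + u₂ - u₂}) ⊆
      u₀ +ᵥ (basisMap (u₁ - u₀) (u₂ - u₀) '' unitSquare) := by
    refine convexHull_min ?_ ((convex_unitSquare.linear_image _).vadd _)
    have key : ∀ a b : ℝ, a ∈ Icc (0 : ℝ) 1 → b ∈ Icc (0 : ℝ) 1 →
        u₀ + (a • (u₁ - u₀) + b • (u₂ - u₀)) ∈
          u₀ +ᵥ (basisMap (u₁ - u₀) (u₂ - u₀) '' unitSquare) := fun a b ha hb =>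
      vadd_mem_vadd_set ⟨!₂[a, b], ⟨by simpa using ha, by simpa using hb⟩, by simp [basisMap_apply]⟩
    have z : (0 : ℝ) ∈ Icc (0 : ℝ) 1 := by simp
    have o : (1 : ℝ) ∈ Icc (0 : ℝ) 1 := by simp
    rintro x ((rfl | rfl | rfl) | (rfl | rfl | rfl))
    · convert key 0 0 z z using 1; module
    · convert key 1 0 o z using 1; module
    · convert key 0 1 z o using 1; module
    · convert key 1 1 o o using 1; module
    · convert key 0 1 z o using 1; module
    · convert key 1 0 o z using 1; module
  have hfin : volume (u₀ +ᵥ (basisMap (u₁ - u₀) (u₂ - u₀) '' unitSquare)) ≠ ⊤ := by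
    rw [measure_vadd, Measure.addHaar_image_linearMap, volume_unitSquare]
    simp
  refine (measureReal_mono hsub hfin).trans ?_
  rw [volume_real_vadd, volume_real_image, det_basisMap, volume_real_unitSquare, e, abs_of_pos hX,
    mul_one]

lemma mem_minimalHulls_iff (hX : 0 < cross (v₁ - v₀) (v₂ - v₀)) {S : Set Plane} :
    S ∈ minimalHulls (convexHull ℝ {v₀, v₁, v₂}) ↔
      ∃ t, S = doubleHull (convexHull ℝ {v₀, v₁, v₂}) t ∧
        volume.real S = cross (v₁ - v₀) (v₂ - v₀) := by
  have hfin : ∀ t, volume (doubleHull (convexHull ℝ {v₀, v₁, v₂}) t) ≠ ⊤ := fun t =>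
    volume_ne_top_of_isCompact (isCompact_doubleHull t)
  constructor
  · rintro ⟨t, hmin, rfl⟩
    obtain ⟨t', ht'⟩ := exists_volume_doubleHull_le hX
    refine ⟨t, rfl, le_antisymm ?_ (le_volume_doubleHull hX t)⟩
    exact (ENNReal.toReal_mono (hfin t') (hmin t')).trans ht'
  · rintro ⟨t, rfl, hv⟩
    refine ⟨t, fun t' => ?_, rfl⟩
    rw [← ENNReal.toReal_le_toReal (hfin t) (hfin t')]
    exact hv.le.trans (le_volume_doubleHull hX t')

lemma supp_side_le (hX : 0 < cross (v₁ - v₀) (v₂ - v₀)) :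
    supp (convexHull ℝ {v₀, v₁, v₂}) (J2 (v₂ - v₁)) ≤ cross v₁ v₂ := by
  refine supp_le ⟨v₀, subset_convexHull ℝ _ (by simp)⟩ fun x hx => ?_
  have := cross_nonneg_of_mem_triangle hX hx
  rw [inner_J2]
  simp only [cross, PiLp.sub_apply] at this ⊢
  linarith

lemma supp_sides_le (hX : 0 < cross (v₁ - v₀) (v₂ - v₀)) :
    supp (convexHull ℝ {v₀, v₁, v₂}) (J2 (v₂ - v₁)) +
      supp (convexHull ℝ {v₀, v₁, v₂}) (J2 (v₀ - v₂)) +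
      supp (convexHull ℝ {v₀, v₁, v₂}) (J2 (v₁ - v₀)) ≤ cross (v₁ - v₀) (v₂ - v₀) := by
  have X1 : cross (v₂ - v₁) (v₀ - v₁) = cross (v₁ - v₀) (v₂ - v₀) := by
    simp only [cross, PiLp.sub_apply]; ring
  have X2 : cross (v₀ - v₂) (v₁ - v₂) = cross (v₁ - v₀) (v₂ - v₀) := by
    simp only [cross, PiLp.sub_apply]; ring
  have s1 : ({v₁, v₂, v₀} : Set Plane) = {v₀, v₁, v₂} := by
    ext; simp only [mem_insert_iff, mem_singleton_iff]; tauto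
  have s2 : ({v₂, v₀, v₁} : Set Plane) = {v₀, v₁, v₂} := by
    ext; simp only [mem_insert_iff, mem_singleton_iff]; tauto
  have h0 := supp_side_le hX
  have h1 := supp_side_le (v₀ := v₁) (v₁ := v₂) (v₂ := v₀) (by rw [X1]; exact hX)
  have h2 := supp_side_le (v₀ := v₂) (v₁ := v₀) (v₂ := v₁) (by rw [X2]; exact hX)
  rw [s1] at h1
  rw [s2] at h2
  have : cross v₁ v₂ + cross v₂ v₀ + cross v₀ v₁ = cross (v₁ - v₀) (v₂ - v₀) := by
    simp only [cross, PiLp.sub_apply]; ring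
  linarith

lemma len_triangle_le (hX : 0 < cross (v₁ - v₀) (v₂ - v₀)) {r : ℝ} (hr : 0 ≤ r) :
    len (convexHull ℝ {v₀, v₁, v₂}) (r • ![J2 v₀, J2 v₂, J2 v₁]) ≤
      r * cross (v₁ - v₀) (v₂ - v₀) ∧
    len (convexHull ℝ {v₀, v₁, v₂}) (r • ![-J2 v₀, -J2 v₁, -J2 v₂]) ≤
      r * cross (v₁ - v₀) (v₂ - v₀) := by
  have h := supp_sides_le hX
  have i1 : (0 : Fin 3) + 1 = 1 := rfl
  have i2 : (1 : Fin 3) + 1 = 2 := rfl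
  have i3 : (2 : Fin 3) + 1 = 0 := rfl
  have n : ∀ a b : Plane, -J2 a - -J2 b = J2 b - J2 a := fun a b => by abel
  rw [len_smul _ hr, len_smul _ hr]
  constructor
  · refine mul_le_mul_of_nonneg_left (le_trans (le_of_eq ?_) h) hr
    simp only [len, Fin.sum_univ_three, i1, i2, i3, Matrix.cons_val_zero, Matrix.cons_val_one,
      Matrix.cons_val, J2_sub]
    ring
  · refine mul_le_mul_of_nonneg_left (le_trans (le_of_eq ?_) h) hr
    simp only [len, Fin.sum_univ_three, i1, i2, i3, Matrix.cons_val_zero, Matrix.cons_val_one,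
      Matrix.cons_val, J2_sub, n]
    ring

lemma isConvexBody_triangle (hX : 0 < cross (v₁ - v₀) (v₂ - v₀)) :
    IsConvexBody (convexHull ℝ {v₀, v₁, v₂}) :=
  isConvexBody_of_volume_pos (isCompact_convexHull_of_finite (Set.toFinite _))
    (convex_convexHull ℝ _) (by rw [volume_real_triangle, abs_of_pos hX]; linarith)

/-- A convex body containing copies of `r J D` and `-r J D` has area at least `2 r² vol D`. -/
lemma scaled_two_triangles_le (hX : 0 < cross (v₁ - v₀) (v₂ - v₀)) {T : Set Plane}
    (hT : IsConvexBody T) {r : ℝ} {s s' : Plane}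
    (h0 : s + r • J2 v₀ ∈ T) (h1 : s + r • J2 v₁ ∈ T) (h2 : s + r • J2 v₂ ∈ T)
    (k0 : s' - r • J2 v₀ ∈ T) (k1 : s' - r • J2 v₁ ∈ T) (k2 : s' - r • J2 v₂ ∈ T) :
    r ^ 2 * cross (v₁ - v₀) (v₂ - v₀) ≤ volume.real T := by
  have e : cross (s + r • J2 v₁ - (s + r • J2 v₀)) (s + r • J2 v₂ - (s + r • J2 v₀)) =
      r ^ 2 * cross (v₁ - v₀) (v₂ - v₀) := by
    rw [← cross_J2 (v₁ - v₀), J2_sub, J2_sub]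
    simp only [cross, PiLp.sub_apply, PiLp.add_apply, PiLp.smul_apply, smul_eq_mul]; ring
  rw [← e]
  refine two_triangles_le (t := s + s') hT.2.1 (volume_ne_top_of_isCompact hT.1) h0 h1 h2 ?_ ?_ ?_
    (by rw [e]; positivity)
  · convert k0 using 1; abel
  · convert k1 using 1; abel
  · convert k2 using 1; abel

theorem isEqualityCase_triangle_iff (hX : 0 < cross (v₁ - v₀) (v₂ - v₀)) (T : Set Plane) :
    IsEqualityCase (convexHull ℝ {v₀, v₁, v₂}) T ↔
      ∃ S ∈ minimalHulls (convexHull ℝ {v₀, v₁, v₂}), IsScaledTranslate S T := by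
  have hD := isConvexBody_triangle hX
  have hvD : volume.real (convexHull ℝ {v₀, v₁, v₂}) = cross (v₁ - v₀) (v₂ - v₀) / 2 := by
    rw [volume_real_triangle, abs_of_pos hX]
  have hlen := fun {r : ℝ} (hr : 0 ≤ r) => len_triangle_le hX hr
  set D := convexHull ℝ {v₀, v₁, v₂} with hDdef
  set X := cross (v₁ - v₀) (v₂ - v₀) with hXdef
  constructor
  · intro h
    have hT := h.2.1
    obtain ⟨c, hc0, hc, hv⟩ := h.exists_pos
    set r := c / X with hr
    have hr0 : 0 < r := div_pos hc0 hX
    have hrX : r * X = c := by rw [hr]; field_simp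
    obtain ⟨hl1, hl2⟩ := hlen hr0.le
    rw [hrX] at hl1 hl2
    obtain ⟨s, hs⟩ := hc.fits hD hT hl1
    obtain ⟨s', hs'⟩ := hc.fits hD hT hl2
    have a0 : s + r • J2 v₀ ∈ T := by rw [add_comm]; exact hs 0
    have a2 : s + r • J2 v₂ ∈ T := by rw [add_comm]; exact hs 1
    have a1 : s + r • J2 v₁ ∈ T := by rw [add_comm]; exact hs 2
    have b0 : s' - r • J2 v₀ ∈ T := by
      rw [sub_eq_add_neg, ← smul_neg, add_comm]; exact hs' 0
    have b1 : s' - r • J2 v₁ ∈ T := by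
      rw [sub_eq_add_neg, ← smul_neg, add_comm]; exact hs' 1
    have b2 : s' - r • J2 v₂ ∈ T := by
      rw [sub_eq_add_neg, ← smul_neg, add_comm]; exact hs' 2
    have hvT : volume.real T = r ^ 2 * X := by
      rw [hvD, ← hrX] at hv
      have : X / 2 * volume.real T = X / 2 * (r ^ 2 * X) := by rw [hv]; ring
      exact mul_left_cancel₀ (by positivity) this
    set t := r⁻¹ • (s' - s) with ht
    have hrt : ∀ u : Plane, s + r • (t - u) = s' - r • u := fun u => by
      rw [smul_sub, ht, smul_smul, mul_inv_cancel₀ hr0.ne', one_smul]; abel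
    have hsub : s +ᵥ r • doubleHull D t ⊆ T := by
      rw [hDdef, doubleHull_triangle]
      refine vadd_smul_convexHull_subset hT.2.1 ?_
      rintro x ((rfl | rfl | rfl) | (rfl | rfl | rfl))
      · exact a0
      · exact a1
      · exact a2
      · rw [hrt]; exact b0
      · rw [hrt]; exact b1
      · rw [hrt]; exact b2
    have hvS : volume.real (s +ᵥ r • doubleHull D t) = r ^ 2 * volume.real (doubleHull D t) := by
      rw [volume_real_vadd, volume_real_smul]
    have hlow : X ≤ volume.real (doubleHull D t) := le_volume_doubleHull hX t
    have heq := eq_of_subset_of_volume_le hT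
      (((isCompact_doubleHull t).smul r).vadd s).isClosed hsub (by
        rw [← hDdef, hvS, hvT]; exact mul_le_mul_of_nonneg_left hlow (by positivity))
    rw [← hDdef] at heq
    refine ⟨doubleHull D t, (mem_minimalHulls_iff hX).2 ⟨t, rfl, ?_⟩, r, hr0, s, heq.symm⟩
    rw [← heq, hvS] at hvT
    exact mul_left_cancel₀ (by positivity) hvT
  · rintro ⟨S, hS, r, hr, s, rfl⟩
    obtain ⟨t, rfl, hvS⟩ := (mem_minimalHulls_iff hX).1 hS
    obtain ⟨⟨a0, a1, a2⟩, b0, b1, b2⟩ := mem_doubleHull (v₀ := v₀) (v₁ := v₁) (v₂ := v₂) t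
    rw [← hDdef] at a0 a1 a2 b0 b1 b2 hvS
    have hSb : IsConvexBody (doubleHull D t) := isConvexBody_of_volume_pos (isCompact_doubleHull t)
      (convex_doubleHull _ _) (by rw [hvS]; exact hX)
    have hT := hSb.vadd_smul hr s
    set T := s +ᵥ r • doubleHull D t with hTdef
    have hvT : volume.real T = r ^ 2 * X := by
      rw [hTdef, volume_real_vadd, volume_real_smul, hvS]
    have m : ∀ u ∈ doubleHull D t, s + r • u ∈ T := fun u hu => mem_vadd_smul.2 ⟨u, hu, rfl⟩
    have m' : ∀ u, t - u ∈ doubleHull D t → (s + r • t) - r • u ∈ T := fun u hu => by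
      have := m _ hu
      rwa [smul_sub, ← add_sub_assoc] at this
    have hlow : ∀ z ∈ interior (D ×ˢ T), ∀ γ, IsClosedCharacteristic (-z +ᵥ (D ×ˢ T)) γ →
        r * X ≤ action γ := by
      intro z hz γ hγ
      obtain ⟨q, p, h, hA⟩ := hγ.exists_isCharPair hD hT hz
      rw [hA]
      exact pairing_ge_of_triangle hX h hT.2.2 (m _ a0) (m _ a1) (m _ a2) (m' _ b0) (m' _ b1)
        (m' _ b2)
    have hcap : IsEHZCapacity (D ×ˢ T) (r * X) := by
      by_cases f1 : Fits (interior T) (r • ![J2 v₀, J2 v₂, J2 v₁])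
      · refine isEHZCapacity_of_not_fits hD hT ?_ (hlen hr.le).2 hlow
        intro f2
        obtain ⟨s₁, hs₁⟩ := f1
        obtain ⟨s₂, hs₂⟩ := f2
        have ev : ∀ (W : Fin 3 → Plane) (s : Plane), (∀ i, (r • W) i + s ∈ interior T) →
            ∀ᶠ ρ in nhds r, ∀ i, (ρ • W) i + s ∈ T := by
          intro W s hs
          rw [Filter.eventually_all]
          intro i
          have hcont : ContinuousAt (fun ρ : ℝ => (ρ • W) i + s) r := by
            simp only [Pi.smul_apply]; fun_prop
          exact hcont.eventually_mem (mem_interior_iff_mem_nhds.1 (hs i))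
        have hev := (ev _ _ hs₁).and (ev _ _ hs₂)
        obtain ⟨ρ, hρ, g1, g2⟩ : ∃ ρ, r < ρ ∧ (∀ i, (ρ • ![J2 v₀, J2 v₂, J2 v₁]) i + s₁ ∈ T) ∧
            ∀ i, (ρ • ![-J2 v₀, -J2 v₁, -J2 v₂]) i + s₂ ∈ T := by
          obtain ⟨ε, hε, hb⟩ := Metric.eventually_nhds_iff.1 hev
          refine ⟨r + ε / 2, by linarith, hb ?_⟩
          rw [Real.dist_eq, add_sub_cancel_left, abs_of_pos (by positivity)]; linarith
        have := scaled_two_triangles_le hX hT (r := ρ) (s := s₁) (s' := s₂)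
          (by rw [add_comm]; exact g1 0) (by rw [add_comm]; exact g1 2)
          (by rw [add_comm]; exact g1 1)
          (by rw [sub_eq_add_neg, ← smul_neg, add_comm]; exact g2 0)
          (by rw [sub_eq_add_neg, ← smul_neg, add_comm]; exact g2 1)
          (by rw [sub_eq_add_neg, ← smul_neg, add_comm]; exact g2 2)
        rw [hvT] at this
        have h2 : r ^ 2 < ρ ^ 2 := by nlinarith
        have := le_of_mul_le_mul_right this hX
        linarith
      · exact isEHZCapacity_of_not_fits hD hT f1 (hlen hr.le).1 hlow
    refine ⟨hD, hT, r * X, hcap, ?_⟩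
    rw [volume_real_prod, hvD, hvT]
    ring

end DoubleHull

lemma cross_ne_zero_of_affineIndependent {v : Fin 3 → Plane} (hv : AffineIndependent ℝ v) :
    cross (v 1 - v 0) (v 2 - v 0) ≠ 0 := by
  intro h
  have key : ∀ s t : ℝ, s • (v 1 - v 0) + t • (v 2 - v 0) = 0 → s = 0 ∧ t = 0 := by
    intro s t hst
    have h1 := (affineIndependent_iff.1 hv) Finset.univ ![-s - t, s, t]
      (by simp [Fin.sum_univ_three]; ring) (by
        rw [← hst]
        simp [Fin.sum_univ_three]
        module)
    exact ⟨by simpa using h1 1 (Finset.mem_univ _), by simpa using h1 2 (Finset.mem_univ _)⟩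
  set a := v 1 - v 0
  set b := v 2 - v 0
  have c0 : b 0 • a + (-a 0) • b = 0 := by
    ext i; fin_cases i
    · simp; ring
    · simp only [cross] at h; simp; linarith
  have c1 : b 1 • a + (-a 1) • b = 0 := by
    ext i; fin_cases i
    · simp only [cross] at h; simp; linarith
    · simp; ring
  have d0 := key _ _ c0
  have d1 := key _ _ c1
  have ha : a = 0 := by
    ext i; fin_cases i
    · simpa using d0.2
    · simpa using d1.2
  have := key 1 0 (by rw [ha]; simp)
  exact one_ne_zero this.1

lemma IsTriangle.exists_vertices {D : Set Plane} (h : IsTriangle D) :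
    ∃ v₀ v₁ v₂ : Plane, 0 < cross (v₁ - v₀) (v₂ - v₀) ∧ D = convexHull ℝ {v₀, v₁, v₂} := by
  obtain ⟨v, hv, rfl⟩ := h
  have hr : range v = {v 0, v 1, v 2} := by
    ext x
    simp only [mem_range, Fin.exists_fin_succ, mem_insert_iff, mem_singleton_iff, eq_comm (a := x)]
    simp
  rcases lt_or_gt_of_ne (cross_ne_zero_of_affineIndependent hv) with h | h
  · refine ⟨v 0, v 2, v 1, ?_, ?_⟩
    · have : cross (v 2 - v 0) (v 1 - v 0) = -cross (v 1 - v 0) (v 2 - v 0) := by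
        simp only [cross]; ring
      linarith
    · rw [hr]; congr 1; ext; simp only [mem_insert_iff, mem_singleton_iff]; tauto
  · exact ⟨v 0, v 1, v 2, h, by rw [hr]⟩

/-! ### Diamonds and parallelograms -/

lemma diamond_eq (a₁ a₂ : ℝ) :
    diamond a₁ a₂ = convexHull ℝ {!₂[a₁, 0], !₂[a₁, 1], !₂[0, a₂], !₂[1, a₂]} := by
  apply Subset.antisymm
  · refine convexHull_min ?_ (convex_convexHull ℝ _)
    have hc := convex_convexHull ℝ ({!₂[a₁, 0], !₂[a₁, 1], !₂[0, a₂], !₂[1, a₂]} : Set Plane)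
    rintro p (⟨hp0, hp1⟩ | ⟨hp0, hp1⟩)
    · have := hc (x := !₂[a₁, 0]) (subset_convexHull ℝ _ (by simp)) (y := !₂[a₁, 1])
        (subset_convexHull ℝ _ (by simp)) (a := 1 - p 1) (b := p 1) (by linarith [hp1.2]) hp1.1
        (by ring)
      convert this using 1
      ext i; fin_cases i
      · simp [hp0]; ring
      · simp
    · have := hc (x := !₂[0, a₂]) (subset_convexHull ℝ _ (by simp)) (y := !₂[1, a₂])
        (subset_convexHull ℝ _ (by simp)) (a := 1 - p 0) (b := p 0) (by linarith [hp0.2]) hp0.1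
        (by ring)
      convert this using 1
      ext i; fin_cases i
      · simp
      · simp [hp1]; ring
  · refine convexHull_mono ?_
    rintro p (rfl | rfl | rfl | rfl)
    · exact Or.inl ⟨by simp, by simp⟩
    · exact Or.inl ⟨by simp, by simp⟩
    · exact Or.inr ⟨by simp, by simp⟩
    · exact Or.inr ⟨by simp, by simp⟩

lemma vertices_mem_diamond (a₁ a₂ : ℝ) : !₂[a₁, 0] ∈ diamond a₁ a₂ ∧ !₂[a₁, 1] ∈ diamond a₁ a₂ ∧
    !₂[0, a₂] ∈ diamond a₁ a₂ ∧ !₂[1, a₂] ∈ diamond a₁ a₂ := by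
  rw [diamond_eq]
  refine ⟨?_, ?_, ?_, ?_⟩ <;> exact subset_convexHull ℝ _ (by simp)

lemma isCompact_diamond (a₁ a₂ : ℝ) : IsCompact (diamond a₁ a₂) := by
  rw [diamond_eq]; exact isCompact_convexHull_of_finite (Set.toFinite _)

lemma diamond_subset_unitSquare {a₁ a₂ : ℝ} (h₁ : a₁ ∈ Icc (0 : ℝ) 1) (h₂ : a₂ ∈ Icc (0 : ℝ) 1) :
    diamond a₁ a₂ ⊆ unitSquare := by
  refine convexHull_min ?_ convex_unitSquare
  rintro p (⟨hp0, hp1⟩ | ⟨hp0, hp1⟩)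
  · exact ⟨by rw [hp0]; exact h₁, hp1⟩
  · exact ⟨hp0, by rw [hp1]; exact h₂⟩

lemma volume_diamond_le {a₁ a₂ : ℝ} (h₁ : a₁ ∈ Icc (0 : ℝ) 1) (h₂ : a₂ ∈ Icc (0 : ℝ) 1) :
    volume.real (diamond a₁ a₂) ≤ 1 / 2 := by
  obtain ⟨l1, u1⟩ := h₁
  obtain ⟨l2, u2⟩ := h₂
  have p1 : 0 ≤ a₁ * a₂ := mul_nonneg l1 l2
  have p2 : 0 ≤ a₁ * (1 - a₂) := mul_nonneg l1 (by linarith)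
  have p3 : 0 ≤ (1 - a₁) * a₂ := mul_nonneg (by linarith) l2
  have p4 : 0 ≤ (1 - a₁) * (1 - a₂) := mul_nonneg (by linarith) (by linarith)
  have sq : ∀ x y : ℝ, x ∈ Icc (0 : ℝ) 1 → y ∈ Icc (0 : ℝ) 1 → !₂[x, y] ∈ unitSquare :=
    fun x y hx hy => ⟨by simpa using hx, by simpa using hy⟩
  have z : (0 : ℝ) ∈ Icc (0 : ℝ) 1 := by simp
  have o : (1 : ℝ) ∈ Icc (0 : ℝ) 1 := by simp
  have cr : ∀ x y x' y' x'' y'' : ℝ, cross (!₂[x, y] - !₂[x', y'] : Plane) (!₂[x'', y''] - !₂[x', y']) =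
      (x - x') * (y'' - y') - (y - y') * (x'' - x') := fun x y x' y' x'' y'' => by simp [cross]
  have step : ∀ (H : Set Plane) (x y x' y' x'' y'' : ℝ), !₂[x'', y''] ∈ H →
      0 ≤ (x - x') * (y'' - y') - (y - y') * (x'' - x') →
      !₂[x'', y''] ∈ H ∩ {w | 0 ≤ cross (!₂[x, y] - !₂[x', y'] : Plane) (w - !₂[x', y'])} :=
    fun H x y x' y' x'' y'' hH h => ⟨hH, by rw [mem_ofPred_eq, cr]; exact h⟩
  have A0 := sq a₁ 0 ⟨l1, u1⟩ z
  have B0 := sq a₁ 1 ⟨l1, u1⟩ o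
  have C0 := sq 0 a₂ z ⟨l2, u2⟩
  have D0 := sq 1 a₂ o ⟨l2, u2⟩
  have c1 := cut_le convex_unitSquare unitSquare_volume_ne_top C0 A0 (sq 0 0 z z)
  rw [cr] at c1
  have hc1 := convex_unitSquare.inter (convex_cross_nonneg (!₂[a₁, 0] - !₂[0, a₂] : Plane) !₂[0, a₂])
  have hv1 := volume_inter_ne_top unitSquare_volume_ne_top
    {w : Plane | 0 ≤ cross (!₂[a₁, 0] - !₂[0, a₂] : Plane) (w - !₂[0, a₂])}
  have A1 := step unitSquare a₁ 0 0 a₂ _ _ A0 (by nlinarith)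
  have B1 := step unitSquare a₁ 0 0 a₂ _ _ B0 (by nlinarith)
  have C1 := step unitSquare a₁ 0 0 a₂ _ _ C0 (by nlinarith)
  have D1 := step unitSquare a₁ 0 0 a₂ _ _ D0 (by nlinarith)
  have X1 := step unitSquare a₁ 0 0 a₂ _ _ (sq 1 0 o z) (by nlinarith)
  have Y1 := step unitSquare a₁ 0 0 a₂ _ _ (sq 1 1 o o) (by nlinarith)
  have Z1 := step unitSquare a₁ 0 0 a₂ _ _ (sq 0 1 z o) (by nlinarith)
  set H1 := unitSquare ∩ {w | 0 ≤ cross (!₂[a₁, 0] - !₂[0, a₂] : Plane) (w - !₂[0, a₂])}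
  have c2 := cut_le hc1 hv1 A1 D1 X1
  rw [cr] at c2
  have hc2 := hc1.inter (convex_cross_nonneg (!₂[1, a₂] - !₂[a₁, 0] : Plane) !₂[a₁, 0])
  have hv2 := volume_inter_ne_top hv1
    {w : Plane | 0 ≤ cross (!₂[1, a₂] - !₂[a₁, 0] : Plane) (w - !₂[a₁, 0])}
  have A2 := step H1 1 a₂ a₁ 0 _ _ A1 (by nlinarith)
  have B2 := step H1 1 a₂ a₁ 0 _ _ B1 (by nlinarith)
  have C2 := step H1 1 a₂ a₁ 0 _ _ C1 (by nlinarith)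
  have D2 := step H1 1 a₂ a₁ 0 _ _ D1 (by nlinarith)
  have Y2 := step H1 1 a₂ a₁ 0 _ _ Y1 (by nlinarith)
  have Z2 := step H1 1 a₂ a₁ 0 _ _ Z1 (by nlinarith)
  set H2 := H1 ∩ {w | 0 ≤ cross (!₂[1, a₂] - !₂[a₁, 0] : Plane) (w - !₂[a₁, 0])}
  have c3 := cut_le hc2 hv2 D2 B2 Y2
  rw [cr] at c3
  have hc3 := hc2.inter (convex_cross_nonneg (!₂[a₁, 1] - !₂[1, a₂] : Plane) !₂[1, a₂])
  have hv3 := volume_inter_ne_top hv2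
    {w : Plane | 0 ≤ cross (!₂[a₁, 1] - !₂[1, a₂] : Plane) (w - !₂[1, a₂])}
  have A3 := step H2 a₁ 1 1 a₂ _ _ A2 (by nlinarith)
  have B3 := step H2 a₁ 1 1 a₂ _ _ B2 (by nlinarith)
  have C3 := step H2 a₁ 1 1 a₂ _ _ C2 (by nlinarith)
  have D3 := step H2 a₁ 1 1 a₂ _ _ D2 (by nlinarith)
  have Z3 := step H2 a₁ 1 1 a₂ _ _ Z2 (by nlinarith)
  set H3 := H2 ∩ {w | 0 ≤ cross (!₂[a₁, 1] - !₂[1, a₂] : Plane) (w - !₂[1, a₂])}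
  have c4 := cut_le hc3 hv3 B3 C3 Z3
  rw [cr] at c4
  have hc4 := hc3.inter (convex_cross_nonneg (!₂[0, a₂] - !₂[a₁, 1] : Plane) !₂[a₁, 1])
  have hv4 := volume_inter_ne_top hv3
    {w : Plane | 0 ≤ cross (!₂[0, a₂] - !₂[a₁, 1] : Plane) (w - !₂[a₁, 1])}
  have A4 := step H3 0 a₂ a₁ 1 _ _ A3 (by nlinarith)
  have B4 := step H3 0 a₂ a₁ 1 _ _ B3 (by nlinarith)
  have C4 := step H3 0 a₂ a₁ 1 _ _ C3 (by nlinarith)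
  have D4 := step H3 0 a₂ a₁ 1 _ _ D3 (by nlinarith)
  set H4 := H3 ∩ {w | 0 ≤ cross (!₂[0, a₂] - !₂[a₁, 1] : Plane) (w - !₂[a₁, 1])}
  have hsub : diamond a₁ a₂ ⊆ H4 := by
    rw [diamond_eq]
    refine convexHull_min ?_ hc4
    rintro p (rfl | rfl | rfl | rfl) <;> assumption
  have hle := measureReal_mono (μ := volume) hsub hv4
  rw [volume_real_unitSquare] at c1
  nlinarith

lemma volume_diamond {a₁ a₂ : ℝ} (h₁ : a₁ ∈ Icc (0 : ℝ) 1) (h₂ : a₂ ∈ Icc (0 : ℝ) 1) :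
    volume.real (diamond a₁ a₂) = 1 / 2 := by
  refine le_antisymm (volume_diamond_le h₁ h₂) ?_
  obtain ⟨A, B, C, D⟩ := vertices_mem_diamond a₁ a₂
  have := quad_le (convex_convexHull ℝ _)
    (volume_ne_top_of_isCompact (isCompact_diamond a₁ a₂)) A C B D
  refine le_trans (le_of_eq ?_) this
  simp [cross]

lemma isConvexBody_diamond {a₁ a₂ : ℝ} (h₁ : a₁ ∈ Icc (0 : ℝ) 1) (h₂ : a₂ ∈ Icc (0 : ℝ) 1) :
    IsConvexBody (diamond a₁ a₂) :=
  isConvexBody_of_volume_pos (isCompact_diamond a₁ a₂) (convex_convexHull ℝ _)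
    (by rw [volume_diamond h₁ h₂]; norm_num)

/-- The parallelogram with given bounds on two linear functionals. -/
def slab (f₁ f₂ : Plane) (x y a : ℝ) : Set Plane :=
  {v | inner ℝ f₁ v ∈ Icc x (x + a) ∧ inner ℝ f₂ v ∈ Icc y (y + a)}

lemma exists_inner_eq {f₁ f₂ : Plane} (hf : cross f₁ f₂ ≠ 0) (c₁ c₂ : ℝ) :
    ∃ s : Plane, inner ℝ f₁ s = c₁ ∧ inner ℝ f₂ s = c₂ := by
  refine ⟨(cross f₁ f₂)⁻¹ • !₂[c₁ * f₂ 1 - c₂ * f₁ 1, c₂ * f₁ 0 - c₁ * f₂ 0], ?_, ?_⟩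
  · rw [inner_smul_right, inner_plane, inv_mul_eq_iff_eq_mul₀ hf]
    simp [cross]; ring
  · rw [inner_smul_right, inner_plane, inv_mul_eq_iff_eq_mul₀ hf]
    simp [cross]; ring

/-- A component of a closed characteristic in a parallelogram meets a pair of opposite sides. -/
lemma IsCharPair.slab_le {σ : ℝ} {f₁ f₂ : Plane} (hf : cross f₁ f₂ ≠ 0) {x y a : ℝ} {T : Set Plane}
    {q p : ℝ → Plane} (h : IsCharPair σ (slab f₁ f₂ x y a) T q p) (hTi : (interior T).Nonempty)
    {r : ℝ} {w₁ w₂ : Plane} (h1 : w₁ ∈ T) (h1' : w₁ + r • f₁ ∈ T) (h2 : w₂ ∈ T)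
    (h2' : w₂ + r • f₂ ∈ T) : a * r ≤ -σ * pairing q p 0 1 := by
  have hqc : ContinuousOn q (Icc 0 1) := by
    have := h.acq.continuousOn; rwa [uIcc_of_le zero_le_one] at this
  have hcont : ∀ f : Plane, ContinuousOn (fun t => inner ℝ f (q t)) (Icc 0 1) := fun f =>
    continuousOn_const.inner hqc
  have hne : (Icc (0 : ℝ) 1).Nonempty := nonempty_Icc.2 (zero_le_one' ℝ)
  have touch : ∀ f w : Plane, w ∈ T → w + r • f ∈ T → ∀ s ∈ Icc (0 : ℝ) 1, ∀ t ∈ Icc (0 : ℝ) 1,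
      inner ℝ f (q t) = inner ℝ f (q s) + a → a * r ≤ -σ * pairing q p 0 1 := by
    intro f w hw hw' s hs t ht hst
    have e : inner ℝ (q t - q s) f = a := by
      rw [inner_sub_left, real_inner_comm, hst, real_inner_comm (q s)]; ring
    have k1 := h.two_le hs ht hw' hw
    have k2 := h.two_le hs ht hw hw'
    have d1 : w + r • f - w = r • f := by abel
    have d2 : w - (w + r • f) = -(r • f) := by abel
    rw [d1, inner_smul_right, e] at k1
    rw [d2, inner_neg_right, inner_smul_right, e] at k2
    rcases mul_self_eq_one_iff.1 h.sign with hσ | hσ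
    · rw [hσ] at k2 ⊢; linarith
    · rw [hσ] at k1 ⊢; linarith
  by_contra hcon
  have shift : ∀ (f w : Plane) (c : ℝ), w ∈ T → w + r • f ∈ T →
      (∀ t ∈ Icc (0 : ℝ) 1, inner ℝ f (q t) ∈ Icc c (c + a)) →
      ∃ d : ℝ, ∀ t ∈ Icc (0 : ℝ) 1, inner ℝ f (q t) + d ∈ Ioo c (c + a) := by
    intro f w c hw hw' hm
    obtain ⟨s, hs, hmin⟩ := isCompact_Icc.exists_isMinOn hne (hcont f)
    obtain ⟨t, ht, hmax⟩ := isCompact_Icc.exists_isMaxOn hne (hcont f)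
    have hlt : inner ℝ f (q t) < inner ℝ f (q s) + a := by
      refine lt_of_le_of_ne (by linarith [(hm t ht).2, (hm s hs).1]) fun he => ?_
      exact hcon (touch f w hw hw' s hs t ht he)
    refine ⟨c + a / 2 - (inner ℝ f (q s) + inner ℝ f (q t)) / 2, fun t' ht' => ?_⟩
    have m1 : inner ℝ f (q s) ≤ inner ℝ f (q t') := hmin ht'
    have m2 : inner ℝ f (q t') ≤ inner ℝ f (q t) := hmax ht'
    constructor <;> linarith
  obtain ⟨d₁, hd₁⟩ := shift f₁ w₁ x h1 h1' fun t ht => (h.memq t ht).1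
  obtain ⟨d₂, hd₂⟩ := shift f₂ w₂ y h2 h2' fun t ht => (h.memq t ht).2
  obtain ⟨s, hs₁, hs₂⟩ := exists_inner_eq hf d₁ d₂
  refine h.not_translate hTi s fun t ht => ?_
  have ho : ∀ (f : Plane) (c : ℝ), IsOpen {v : Plane | inner ℝ f v ∈ Ioo c (c + a)} := fun f c =>
    isOpen_Ioo.preimage (by fun_prop : Continuous fun v : Plane => inner ℝ f v)
  refine interior_maximal (t := {v : Plane | inner ℝ f₁ v ∈ Ioo x (x + a)} ∩
    {v : Plane | inner ℝ f₂ v ∈ Ioo y (y + a)}) ?_ ((ho _ _).inter (ho _ _)) ⟨?_, ?_⟩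
  · rintro v ⟨hv1, hv2⟩
    exact ⟨Ioo_subset_Icc_self hv1, Ioo_subset_Icc_self hv2⟩
  · rw [mem_ofPred_eq, inner_add_right, hs₁]; exact hd₁ t ht
  · rw [mem_ofPred_eq, inner_add_right, hs₂]; exact hd₂ t ht

/-- A segment that spans the width of `T` does not fit into the interior of `T`. -/
lemma not_fits_segment {T : Set Plane} {f d : Plane} {x a : ℝ} (hf : f ≠ 0)
    (hT : ∀ v ∈ T, inner ℝ f v ∈ Icc x (x + a)) (hd : inner ℝ f d = a) :
    ¬ Fits (interior T) ![0, d, d] := by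
  rintro ⟨s, hs⟩
  have h0 := hs 0
  have h1 := hs 1
  simp only [Matrix.cons_val_zero, Matrix.cons_val_one, zero_add] at h0 h1
  have k1 := inner_lt_of_mem_interior h1 hf fun y hy => (hT y hy).2
  have k0 := inner_lt_of_mem_interior (d := -f) (M := -x) h0 (neg_ne_zero.2 hf) fun y hy => by
    rw [inner_neg_left]; linarith [(hT y hy).1]
  rw [inner_add_right, hd] at k1
  rw [inner_neg_left] at k0
  linarith

lemma len_segment_le {K : Set Plane} (hne : K.Nonempty) {d : Plane} {x a : ℝ}
    (h : ∀ v ∈ K, inner ℝ d v ∈ Icc x (x + a)) : len K ![0, d, d] ≤ a := by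
  have i1 : (0 : Fin 3) + 1 = 1 := rfl
  have i2 : (1 : Fin 3) + 1 = 2 := rfl
  have i3 : (2 : Fin 3) + 1 = 0 := rfl
  simp only [len, Fin.sum_univ_three, i1, i2, i3, Matrix.cons_val_zero, Matrix.cons_val_one,
    Matrix.cons_val, sub_self, zero_sub, sub_zero]
  have e1 : supp K (-d) ≤ -x := supp_le hne fun v hv => by
    rw [inner_neg_left]; linarith [(h v hv).1]
  have e2 : supp K d ≤ x + a := supp_le hne fun v hv => (h v hv).2
  have e3 : supp K 0 ≤ 0 := supp_le hne fun v hv => by simp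
  linarith

lemma inner_basis (v : Plane) : inner ℝ (!₂[1, 0] : Plane) v = v 0 ∧
    inner ℝ (!₂[0, 1] : Plane) v = v 1 := by
  rw [inner_plane, inner_plane]; simp

/-- The axis-parallel square as a translate of a multiple of the unit square. -/
lemma square_eq (x y : ℝ) {a : ℝ} (ha : 0 < a) :
    ({p | p 0 ∈ Icc x (x + a) ∧ p 1 ∈ Icc y (y + a)} : Set Plane) = !₂[x, y] +ᵥ a • unitSquare := by
  ext p
  rw [mem_vadd_smul]
  constructor
  · rintro ⟨h0, h1⟩
    refine ⟨!₂[(p 0 - x) / a, (p 1 - y) / a], ⟨?_, ?_⟩, ?_⟩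
    · simp only [Matrix.cons_val_zero]
      exact ⟨div_nonneg (by linarith [h0.1]) ha.le, by rw [div_le_one ha]; linarith [h0.2]⟩
    · simp only [Matrix.cons_val_one, Matrix.cons_val_zero]
      exact ⟨div_nonneg (by linarith [h1.1]) ha.le, by rw [div_le_one ha]; linarith [h1.2]⟩
    · ext i; fin_cases i
      · simp; field_simp; ring
      · simp; field_simp; ring
  · rintro ⟨v, ⟨h0, h1⟩, rfl⟩
    simp only [mem_ofPred_eq, PiLp.add_apply, PiLp.smul_apply, smul_eq_mul,
      Matrix.cons_val_zero, Matrix.cons_val_one, mem_Icc]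
    refine ⟨⟨?_, ?_⟩, ?_, ?_⟩ <;> nlinarith [h0.1, h0.2, h1.1, h1.2]

lemma isCompact_unitSquare : IsCompact unitSquare := by
  have : unitSquare = WithLp.toLp 2 '' (Icc (0 : Fin 2 → ℝ) 1) := by
    ext x
    simp only [unitSquare, mem_image]
    constructor
    · intro h
      refine ⟨x.ofLp, ⟨fun i => ?_, fun i => ?_⟩, by simp⟩
      · fin_cases i; exacts [h.1.1, h.2.1]
      · fin_cases i; exacts [h.1.2, h.2.2]
    · rintro ⟨y, hy, rfl⟩
      exact ⟨⟨hy.1 0, hy.2 0⟩, ⟨hy.1 1, hy.2 1⟩⟩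
  rw [this]
  exact isCompact_Icc.image (PiLp.continuous_toLp 2 _)

lemma isConvexBody_unitSquare : IsConvexBody unitSquare :=
  isConvexBody_of_volume_pos isCompact_unitSquare convex_unitSquare
    (by rw [volume_real_unitSquare]; norm_num)

theorem isEqualityCase_square_iff (x y : ℝ) {a : ℝ} (ha : 0 < a) (T : Set Plane) :
    IsEqualityCase {p | p 0 ∈ Icc x (x + a) ∧ p 1 ∈ Icc y (y + a)} T ↔
      ∃ a₁ ∈ Icc (0 : ℝ) 1, ∃ a₂ ∈ Icc (0 : ℝ) 1, IsScaledTranslate (diamond a₁ a₂) T := by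
  set S : Set Plane := {p | p 0 ∈ Icc x (x + a) ∧ p 1 ∈ Icc y (y + a)} with hS
  have hSb : IsConvexBody S := by
    rw [hS, square_eq x y ha]; exact isConvexBody_unitSquare.vadd_smul ha _
  have hSv : volume.real S = a ^ 2 := by
    rw [hS, square_eq x y ha, volume_real_vadd, volume_real_smul, volume_real_unitSquare, mul_one]
  have hSne : S.Nonempty := hSb.2.2.mono interior_subset
  have hSs : S = slab !₂[1, 0] !₂[0, 1] x y a := by
    ext v
    simp only [hS, slab, mem_ofPred_eq, (inner_basis v).1, (inner_basis v).2]
  have len0 : ∀ r : ℝ, 0 ≤ r → len S ![0, r • !₂[1, 0], r • !₂[1, 0]] ≤ a * r := fun r hr =>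
    len_segment_le hSne (x := r * x) fun v hv => by
      have h0 := hv.1
      rw [inner_smul_left, (inner_basis v).1, conj_trivial]
      constructor <;> nlinarith [h0.1, h0.2]
  have len1 : ∀ r : ℝ, 0 ≤ r → len S ![0, r • !₂[0, 1], r • !₂[0, 1]] ≤ a * r := fun r hr =>
    len_segment_le hSne (x := r * y) fun v hv => by
      have h0 := hv.2
      rw [inner_smul_left, (inner_basis v).2, conj_trivial]
      constructor <;> nlinarith [h0.1, h0.2]
  constructor
  · intro h
    have hT := h.2.1
    obtain ⟨c, hc0, hc, hv⟩ := h.exists_pos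
    set r := c / a with hr
    have hr0 : 0 < r := div_pos hc0 ha
    have har : a * r = c := by rw [hr]; field_simp
    obtain ⟨s, hs⟩ := hc.fits hSb hT ((len0 r hr0.le).trans har.le)
    obtain ⟨s', hs'⟩ := hc.fits hSb hT ((len1 r hr0.le).trans har.le)
    have m0 : s ∈ T := by simpa using hs 0
    have m1 : r • !₂[1, 0] + s ∈ T := hs 1
    have n0 : s' ∈ T := by simpa using hs' 0
    have n1 : r • !₂[0, 1] + s' ∈ T := hs' 1
    have hvT : volume.real T = r ^ 2 / 2 := by
      rw [hSv, ← har] at hv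
      have : a ^ 2 * volume.real T = a ^ 2 * (r ^ 2 / 2) := by rw [hv]; ring
      exact mul_left_cancel₀ (by positivity) this
    have tri : ∀ u v w : Plane, u ∈ T → v ∈ T → w ∈ T → cross (v - u) (w - u) ≤ r ^ 2 := by
      intro u v w hu hv hw
      have h1 := triangle_le hT.2.1 (volume_ne_top_of_isCompact hT.1) hu hv hw
      have h2 := le_abs_self (cross (v - u) (w - u))
      linarith
    have b1 : s' 0 - s 0 ≤ r := by
      have := tri s s' _ m0 n0 n1
      simp [cross] at this
      nlinarith
    have b2 : s 0 ≤ s' 0 := by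
      have := tri _ _ _ m1 n1 n0
      simp [cross] at this
      nlinarith
    have b3 : s 1 - s' 1 ≤ r := by
      have := tri s' _ s n0 m1 m0
      simp [cross] at this
      nlinarith
    have b4 : s' 1 ≤ s 1 := by
      have := tri _ s _ n1 m0 m1
      simp [cross] at this
      nlinarith
    have h₁ : (s' 0 - s 0) / r ∈ Icc (0 : ℝ) 1 :=
      ⟨div_nonneg (by linarith) hr0.le, by rw [div_le_one hr0]; linarith⟩
    have h₂ : (s 1 - s' 1) / r ∈ Icc (0 : ℝ) 1 :=
      ⟨div_nonneg (by linarith) hr0.le, by rw [div_le_one hr0]; linarith⟩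
    refine ⟨_, h₁, _, h₂, r, hr0, !₂[s 0, s' 1], ?_⟩
    symm
    refine eq_of_subset_of_volume_le hT (((isCompact_diamond _ _).smul r).vadd _).isClosed ?_ ?_
    · rw [diamond_eq]
      refine vadd_smul_convexHull_subset hT.2.1 ?_
      rintro v (rfl | rfl | rfl | rfl)
      · convert n0 using 1
        ext i; fin_cases i <;> simp; field_simp; ring
      · convert n1 using 1
        ext i; fin_cases i <;> simp
        · field_simp; ring
        · ring
      · convert m0 using 1
        ext i; fin_cases i <;> simp; field_simp; ring
      · convert m1 using 1
        ext i; fin_cases i <;> simp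
        · ring
        · field_simp; ring
    · rw [volume_real_vadd, volume_real_smul, volume_diamond h₁ h₂, hvT]
      linarith
  · rintro ⟨a₁, h₁, a₂, h₂, r, hr, s, rfl⟩
    have hT := (isConvexBody_diamond h₁ h₂).vadd_smul hr s
    obtain ⟨A, B, C, D⟩ := vertices_mem_diamond a₁ a₂
    have m : ∀ u ∈ diamond a₁ a₂, s + r • u ∈ s +ᵥ r • diamond a₁ a₂ := fun u hu =>
      mem_vadd_smul.2 ⟨u, hu, rfl⟩
    have hne : (!₂[1, 0] : Plane) ≠ 0 := by
      intro h; simpa using congrArg (fun v : Plane => v 0) h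
    refine ⟨hSb, hT, a * r, isEHZCapacity_of_not_fits hSb hT (W := ![0, r • !₂[1, 0], r • !₂[1, 0]])
      ?_ (len0 r hr.le) ?_, ?_⟩
    · refine not_fits_segment (f := !₂[1, 0]) (x := s 0) (a := r) hne ?_ ?_
      · intro v hv
        obtain ⟨u, hu, rfl⟩ := mem_vadd_smul.1 hv
        have hu' := (diamond_subset_unitSquare h₁ h₂ hu).1
        rw [(inner_basis _).1]
        simp only [PiLp.add_apply, PiLp.smul_apply, smul_eq_mul, mem_Icc]
        constructor <;> nlinarith [hu'.1, hu'.2]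
      · rw [(inner_basis _).1]; simp
    · intro z hz γ hγ
      obtain ⟨q, p, h, hA⟩ := hγ.exists_isCharPair hSb hT hz
      rw [hSs] at h
      have := h.slab_le (by simp [cross]) hT.2.2 (r := r) (m _ C) (by
        convert m _ D using 1; ext i; fin_cases i <;> simp) (m _ A) (by
        convert m _ B using 1; ext i; fin_cases i <;> simp)
      rw [hA]; linarith
    · rw [volume_real_prod, hSv, volume_real_vadd, volume_real_smul, volume_diamond h₁ h₂]
      ring

/-! ### Rigidity of the square -/

/-- The direction of the diagonal of the unit square. -/
def diag : Plane := !₂[1, 1]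

/-- The height of a point over the line spanned by the diagonal. -/
def level (x : Plane) : ℝ := cross (-diag) x

lemma level_eq (x : Plane) : level x = x 0 - x 1 := by simp [level, cross, diag]; ring

/-- The area of the part of `T` between two lines parallel to the diagonal. -/
def stripArea (T : Set Plane) (u w : ℝ) : ℝ :=
  volume.real (T ∩ ({x | u ≤ level x} ∩ {x | level x ≤ w}))

/-- `T` contains a chord of length `l` at level `s`, parallel to the diagonal. -/
def Chord (T : Set Plane) (s l : ℝ) : Prop := ∃ a, a ∈ T ∧ a + l • diag ∈ T ∧ level a = s

lemma level_add_smul_diag (a : Plane) (l : ℝ) : level (a + l • diag) = level a := by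
  simp [level_eq, diag]

lemma stripArea_add {T : Set Plane} (hT : IsConvexBody T)
    {u v w : ℝ} (huv : u ≤ v) (hvw : v ≤ w) :
    stripArea T u v + stripArea T v w = stripArea T u w := by
  have hne : -diag ≠ 0 := by
    intro h; simpa [diag] using congrArg (fun v : Plane => v 0) h
  have h := volume_real_split (H := T ∩ ({x | u ≤ level x} ∩ {x | level x ≤ w}))
    (volume_inter_ne_top (volume_ne_top_of_isCompact hT.1) _) hne v
  unfold stripArea
  rw [← h]
  congr 2
  · ext x
    simp only [mem_inter_iff, mem_ofPred_eq, level]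
    constructor
    · rintro ⟨a, b, c⟩; exact ⟨⟨a, b, by linarith⟩, c⟩
    · rintro ⟨⟨a, b, _⟩, c⟩; exact ⟨a, b, c⟩
  · ext x
    simp only [mem_inter_iff, mem_ofPred_eq, level]
    constructor
    · rintro ⟨a, b, c⟩; exact ⟨⟨a, by linarith, c⟩, b⟩
    · rintro ⟨⟨a, _, c⟩, b⟩; exact ⟨a, b, c⟩

lemma stripArea_le {T : Set Plane} (hT : IsConvexBody T)
    (u w : ℝ) : stripArea T u w ≤ volume.real T :=
  measureReal_mono inter_subset_left (volume_ne_top_of_isCompact hT.1)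

lemma chord_le {T : Set Plane} (hT : IsConvexBody T)
    {s₁ s₂ l₁ l₂ : ℝ} (h₁ : Chord T s₁ l₁) (h₂ : Chord T s₂ l₂) (h : s₁ ≤ s₂) :
    (s₂ - s₁) * (l₁ + l₂) / 2 ≤ stripArea T s₁ s₂ := by
  obtain ⟨a, ha, ha', rfl⟩ := h₁
  obtain ⟨b, hb, hb', rfl⟩ := h₂
  have hc : Convex ℝ (T ∩ ({x | level a ≤ level x} ∩ {x | level x ≤ level b})) :=
    hT.2.1.inter ((convex_halfSpace_ge (isLinearMap_cross _) _).inter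
      (convex_halfSpace_le (isLinearMap_cross _) _))
  have hf := volume_inter_ne_top (volume_ne_top_of_isCompact hT.1)
    ({x | level a ≤ level x} ∩ {x | level x ≤ level b})
  have q := quad_le hc hf (a := a) (b := a + l₁ • diag) (c := b + l₂ • diag) (d := b)
    ⟨ha, le_refl (level a), h⟩
    ⟨ha', (level_add_smul_diag a l₁).ge, (level_add_smul_diag a l₁).le.trans h⟩
    ⟨hb', h.trans (level_add_smul_diag b l₂).ge, (level_add_smul_diag b l₂).le⟩
    ⟨hb, h, le_refl (level b)⟩
  have e : cross (b + l₂ • diag - a) (b - (a + l₁ • diag)) = -((level b - level a) * (l₁ + l₂)) := by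
    simp [cross, level_eq, diag]; ring
  rw [e, abs_neg] at q
  have := le_abs_self ((level b - level a) * (l₁ + l₂))
  unfold stripArea
  linarith

lemma chords_two {T : Set Plane} (hT : IsConvexBody T)
    {s₁ s₂ l₁ l₂ : ℝ} (c₁ : Chord T s₁ l₁) (c₂ : Chord T s₂ l₂) (h₁ : s₁ ≤ s₂) :
    (s₂ - s₁) * (l₁ + l₂) / 2 ≤ volume.real T :=
  (chord_le hT c₁ c₂ h₁).trans (stripArea_le hT _ _)

lemma chords_three {T : Set Plane} (hT : IsConvexBody T)
    {s₁ s₂ s₃ l₁ l₂ l₃ : ℝ} (c₁ : Chord T s₁ l₁) (c₂ : Chord T s₂ l₂)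
    (c₃ : Chord T s₃ l₃) (h₁ : s₁ ≤ s₂) (h₂ : s₂ ≤ s₃) :
    (s₂ - s₁) * (l₁ + l₂) / 2 + (s₃ - s₂) * (l₂ + l₃) / 2 ≤ volume.real T := by
  have := stripArea_add hT h₁ h₂
  linarith [chord_le hT c₁ c₂ h₁, chord_le hT c₂ c₃ h₂, stripArea_le hT s₁ s₃]

lemma chords_four {T : Set Plane} (hT : IsConvexBody T)
    {s₁ s₂ s₃ s₄ l₁ l₂ l₃ l₄ : ℝ} (c₁ : Chord T s₁ l₁) (c₂ : Chord T s₂ l₂)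
    (c₃ : Chord T s₃ l₃) (c₄ : Chord T s₄ l₄) (h₁ : s₁ ≤ s₂) (h₂ : s₂ ≤ s₃) (h₃ : s₃ ≤ s₄) :
    (s₂ - s₁) * (l₁ + l₂) / 2 + (s₃ - s₂) * (l₂ + l₃) / 2 + (s₄ - s₃) * (l₃ + l₄) / 2 ≤
      volume.real T := by
  have e1 := stripArea_add hT h₁ h₂
  have e2 := stripArea_add hT (h₁.trans h₂) h₃
  linarith [chord_le hT c₁ c₂ h₁, chord_le hT c₂ c₃ h₂, chord_le hT c₃ c₄ h₃,
    stripArea_le hT s₁ s₄]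

lemma chords_five {T : Set Plane} (hT : IsConvexBody T)
    {s₁ s₂ s₃ s₄ s₅ l₁ l₂ l₃ l₄ l₅ : ℝ} (c₁ : Chord T s₁ l₁) (c₂ : Chord T s₂ l₂)
    (c₃ : Chord T s₃ l₃) (c₄ : Chord T s₄ l₄) (c₅ : Chord T s₅ l₅) (h₁ : s₁ ≤ s₂) (h₂ : s₂ ≤ s₃)
    (h₃ : s₃ ≤ s₄) (h₄ : s₄ ≤ s₅) :
    (s₂ - s₁) * (l₁ + l₂) / 2 + (s₃ - s₂) * (l₂ + l₃) / 2 + (s₄ - s₃) * (l₃ + l₄) / 2 +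
      (s₅ - s₄) * (l₄ + l₅) / 2 ≤ volume.real T := by
  have e1 := stripArea_add hT h₁ h₂
  have e2 := stripArea_add hT (h₁.trans h₂) h₃
  have e3 := stripArea_add hT ((h₁.trans h₂).trans h₃) h₄
  linarith [chord_le hT c₁ c₂ h₁, chord_le hT c₂ c₃ h₂, chord_le hT c₃ c₄ h₃,
    chord_le hT c₄ c₅ h₄, stripArea_le hT s₁ s₅]

/-- The positions of the chords of a convex body of area `1`. -/
lemma levels_of_chords {T : Set Plane} (hT : IsConvexBody T)
    (hv : volume.real T ≤ 1) {m ζ α δ : ℝ} (hm0 : 0 < m) (hm1 : m < 1)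
    (c0 : Chord T ζ 0) (c1 : Chord T (ζ + α) (1 - m)) (c2 : Chord T (ζ + 1 + m) (1 - m))
    (c3 : Chord T (ζ + α + 1 + m) 0) (cD : Chord T (ζ + δ) 1) (hα : α ≤ 1 - m) :
    α = 1 - m ∧ δ = 1 := by
  have hbig : 1 < (1 + m) * (2 - m) / 2 := by nlinarith
  have hmm : 0 < m * (1 - m) := mul_pos hm0 (by linarith)
  have hα0 : 0 < α := by
    by_contra hα0
    push Not at hα0
    rcases le_or_gt α δ with h1 | h1
    · rcases le_or_gt δ (1 + m) with h2 | h2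
      · have := chords_three hT c1 cD c2 (by linarith) (by linarith)
        nlinarith
      · have := chords_two hT c1 cD (by linarith)
        nlinarith
    · have := chords_two hT cD c2 (by linarith)
      nlinarith
  have hδ1 : α ≤ δ := by
    by_contra h
    push Not at h
    rcases le_or_gt δ 0 with h0 | h0
    · have := chords_two hT cD c2 (by linarith)
      nlinarith
    · have := chords_four hT c0 cD c2 c3 (by linarith) (by linarith) (by linarith)
      have h2 : 0 < (α - δ) * (1 - m) := mul_pos (by linarith) (by linarith)
      nlinarith
  have hδ2 : δ ≤ 1 + m := by
    by_contra h
    push Not at h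
    rcases le_or_gt (α + 1 + m) δ with h0 | h0
    · have := chords_two hT c1 cD (by linarith)
      nlinarith
    · have := chords_four hT c0 c1 cD c3 (by linarith) (by linarith) (by linarith)
      have h2 : 0 < (δ - 1 - m) * (1 - m) := mul_pos (by linarith) (by linarith)
      nlinarith
  have hα1 : α = 1 - m := by
    have := chords_five hT c0 c1 cD c2 c3 (by linarith) (by linarith) (by linarith) (by linarith)
    refine le_antisymm hα ?_
    have h2 : m * (1 - m - α) ≤ 0 := by nlinarith
    nlinarith
  refine ⟨hα1, ?_⟩
  subst hα1
  have k1 := chords_four hT c0 cD c2 c3 (by linarith) (by linarith) (by linarith)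
  have k2 := chords_four hT c0 c1 cD c3 (by linarith) (by linarith) (by linarith)
  have e1 : (1 - m) * (1 - δ) ≤ 0 := by nlinarith
  have e2 : (1 - m) * (δ - 1) ≤ 0 := by nlinarith
  nlinarith

/-- A convex body of area `1` that contains translates of the diagonal of the unit square and of
two thin triangles is a translate of the unit square. -/
theorem eq_unitSquare_of_fits {T : Set Plane} (hT : IsConvexBody T)
    (hv : volume.real T ≤ 1) {m : ℝ} (hm0 : 0 < m) (hm1 : m < 1)
    (fD : Fits T ![0, diag, diag]) (f1 : Fits T ![(1 - m) • diag, 0, !₂[1, -m]])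
    (f2 : Fits T ![(1 - m) • diag, 0, !₂[-m, 1]]) : ∃ s : Plane, T = s +ᵥ unitSquare := by
  obtain ⟨x, hx⟩ := fD
  obtain ⟨b, hb⟩ := f1
  obtain ⟨b', hb'⟩ := f2
  have x0 : x ∈ T := by simpa using hx 0
  have x1 : x + diag ∈ T := by rw [add_comm]; exact hx 1
  have b1 : b + (1 - m) • diag ∈ T := by rw [add_comm]; exact hb 0
  have b0 : b ∈ T := by simpa using hb 1
  have b2 : b + !₂[1, -m] ∈ T := by rw [add_comm]; exact hb 2
  have b1' : b' + (1 - m) • diag ∈ T := by rw [add_comm]; exact hb' 0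
  have b0' : b' ∈ T := by simpa using hb' 1
  have b2' : b' + !₂[-m, 1] ∈ T := by rw [add_comm]; exact hb' 2
  set ζ := level b' - 1 - m with hζ
  set α := level b - ζ with hα
  set δ := level x - ζ with hδ
  have l2 : level (b + !₂[1, -m]) = level b + 1 + m := by simp [level_eq]; ring
  have l2' : level (b' + !₂[-m, 1]) = ζ := by simp [hζ, level_eq]; ring
  have c0 : Chord T ζ 0 := ⟨_, b2', by simpa using b2', l2'⟩
  have c1 : Chord T (ζ + α) (1 - m) := ⟨b, b0, b1, by rw [hα]; ring⟩
  have c2 : Chord T (ζ + 1 + m) (1 - m) := ⟨b', b0', b1', by rw [hζ]; ring⟩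
  have c3 : Chord T (ζ + α + 1 + m) 0 := ⟨_, b2, by simpa using b2, by rw [l2, hα]; ring⟩
  have cD : Chord T (ζ + δ) 1 := ⟨x, x0, by simpa using x1, by rw [hδ]; ring⟩
  have hα1 : α ≤ 1 - m := by
    have q := quad_le hT.2.1 (volume_ne_top_of_isCompact hT.1) x0 b2 x1 b2'
    have e : cross (x + diag - x) (b' + !₂[-m, 1] - (b + !₂[1, -m])) = α + 1 + m := by
      simp [cross, hα, hζ, level_eq, diag]; ring
    rw [e] at q
    linarith [le_abs_self (α + 1 + m)]
  obtain ⟨eα, eδ⟩ := levels_of_chords hT hv hm0 hm1 c0 c1 c2 c3 cD hα1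
  have hb0 : b 1 = b 0 - (x 0 - x 1) + m := by
    have : level b - level x = -m := by linarith
    rw [level_eq, level_eq] at this; linarith
  have hb'0 : b' 1 = b' 0 - (x 0 - x 1) - m := by
    have : level b' - level x = m := by linarith
    rw [level_eq, level_eq] at this; linarith
  set μ := b 0 - x 0 with hμ
  set lam := b' 0 - x 0 - m with hlam
  -- the chord spanned by the thin triangle and the chord of the quadrilateral agree
  have long : ∀ s d : ℝ, Chord T s (1 - m + d) →
      (s = ζ + (1 - m) ∨ s = ζ + 1 + m) → d ≤ 0 := by
    intro s d hc hs
    have cD' : Chord T (ζ + 1) 1 := by rw [eδ] at cD; exact cD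
    have c3' : Chord T (ζ + 2) 0 := by
      convert c3 using 1; rw [eα]; ring
    rcases hs with rfl | rfl
    · have := chords_four hT c0 hc cD' c3' (by linarith) (by linarith) (by linarith)
      nlinarith
    · have := chords_four hT c0 cD' hc c3' (by linarith) (by linarith) (by linarith)
      nlinarith
  have comb : ∀ u v : Plane, u ∈ T → v ∈ T → m • u + (1 - m) • v ∈ T := fun u v hu hv =>
    hT.2.1 hu hv hm0.le (by linarith) (by ring)
  have t0 := comb _ _ b2' x0
  have t1 := comb _ _ b2' x1
  have t0' := comb _ _ b2 x0
  have t1' := comb _ _ b2 x1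
  have lev1 : level b = ζ + (1 - m) := by linarith
  have lev2 : level b' = ζ + 1 + m := by linarith
  have E1 : m * lam = μ := by
    apply le_antisymm
    · have := long (ζ + (1 - m)) (m * lam - μ) ⟨b, b0, by
        convert t1 using 1
        ext i; fin_cases i <;> simp [diag, hb0, hb'0, hμ, hlam] <;> ring, lev1⟩ (Or.inl rfl)
      linarith
    · have := long (ζ + (1 - m)) (μ - m * lam)
        ⟨m • (b' + !₂[-m, 1]) + (1 - m) • x, t0, by
          convert b1 using 1
          ext i; fin_cases i <;> simp [diag, hb0, hb'0, hμ, hlam] <;> ring, by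
          rw [← lev1, level_eq, level_eq]; simp [hb0, hb'0]; ring⟩ (Or.inl rfl)
      linarith
  have E2 : m * μ = lam := by
    apply le_antisymm
    · have := long (ζ + 1 + m) (m * μ - lam) ⟨b', b0', by
        convert t1' using 1
        ext i; fin_cases i <;> simp [diag, hb0, hb'0, hμ, hlam] <;> ring, lev2⟩ (Or.inr rfl)
      linarith
    · have := long (ζ + 1 + m) (lam - m * μ)
        ⟨m • (b + !₂[1, -m]) + (1 - m) • x, t0', by
          convert b1' using 1
          ext i; fin_cases i <;> simp [diag, hb0, hb'0, hμ, hlam] <;> ring, by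
          rw [← lev2, level_eq, level_eq]; simp [hb0, hb'0]; ring⟩ (Or.inr rfl)
      linarith
  have hμ0 : μ = 0 := by
    have h1 : (1 - m * m) * μ = 0 := by rw [← E2] at E1; linarith
    have h2 : (1 - m * m) ≠ 0 := by nlinarith
    exact (mul_eq_zero.1 h1).resolve_left h2
  have hlam0 : lam = 0 := by rw [← E2, hμ0, mul_zero]
  have p10 : x + !₂[1, 0] ∈ T := by
    convert b2 using 1
    ext i; fin_cases i <;> simp
    · linarith
    · rw [hb0]; linarith
  have p01 : x + !₂[0, 1] ∈ T := by
    convert b2' using 1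
    ext i; fin_cases i <;> simp
    · linarith
    · rw [hb'0]; linarith
  refine ⟨x, ?_⟩
  symm
  refine eq_of_subset_of_volume_le hT (isCompact_unitSquare.vadd x).isClosed ?_ (by
    rw [volume_real_vadd, volume_real_unitSquare]; exact hv)
  intro y hy
  obtain ⟨w, hw, rfl⟩ := mem_vadd_set.1 hy
  have hcv : Convex ℝ T := hT.2.1
  have r0 := hcv x0 p10 (a := 1 - w 0) (b := w 0) (by linarith [hw.1.2]) hw.1.1 (by ring)
  have r1 := hcv p01 x1 (a := 1 - w 0) (b := w 0) (by linarith [hw.1.2]) hw.1.1 (by ring)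
  have r := hcv r0 r1 (a := 1 - w 1) (b := w 1) (by linarith [hw.2.2]) hw.2.1 (by ring)
  convert r using 1
  ext i; fin_cases i <;> simp [diag] <;> ring

lemma eq_basisMap (f : Plane →ₗ[ℝ] Plane) : f = basisMap (f !₂[1, 0]) (f !₂[0, 1]) := by
  ext1 x
  have hx : x = x 0 • !₂[1, 0] + x 1 • !₂[0, 1] := by
    ext i; fin_cases i <;> simp
  conv_lhs => rw [hx, map_add, map_smul, map_smul]
  rfl

lemma adjoint_apply (f : Plane →ₗ[ℝ] Plane) (v : Plane) :
    LinearMap.adjoint f v 0 = inner ℝ (f !₂[1, 0]) v ∧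
      LinearMap.adjoint f v 1 = inner ℝ (f !₂[0, 1]) v := by
  rw [← LinearMap.adjoint_inner_right, ← LinearMap.adjoint_inner_right, (inner_basis _).1,
    (inner_basis _).2]
  exact ⟨rfl, rfl⟩

lemma det_adjoint (f : Plane →ₗ[ℝ] Plane) :
    LinearMap.det (LinearMap.adjoint f) = LinearMap.det f := by
  rw [eq_basisMap (LinearMap.adjoint f), det_basisMap]
  conv_rhs => rw [eq_basisMap f, det_basisMap]
  simp only [cross, (adjoint_apply f _).1, (adjoint_apply f _).2, inner_plane]
  simp
  ring

section Dual

variable (φ : Plane ≃ₗ[ℝ] Plane)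

lemma inner_adjoint_symm (d k : Plane) :
    inner ℝ (LinearMap.adjoint (φ.symm : Plane →ₗ[ℝ] Plane) d) (φ k) = inner ℝ d k := by
  rw [LinearMap.adjoint_inner_left]; simp

lemma adjoint_adjoint_symm (v : Plane) :
    LinearMap.adjoint (φ : Plane →ₗ[ℝ] Plane)
      (LinearMap.adjoint (φ.symm : Plane →ₗ[ℝ] Plane) v) = v := by
  refine ext_inner_right ℝ fun w => ?_
  rw [LinearMap.adjoint_inner_left, LinearMap.adjoint_inner_left]; simp

lemma adjoint_symm_adjoint (v : Plane) :
    LinearMap.adjoint (φ.symm : Plane →ₗ[ℝ] Plane)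
      (LinearMap.adjoint (φ : Plane →ₗ[ℝ] Plane) v) = v := by
  refine ext_inner_right ℝ fun w => ?_
  rw [LinearMap.adjoint_inner_left, LinearMap.adjoint_inner_left]; simp

lemma cross_map_ne_zero : cross (φ !₂[1, 0]) (φ !₂[0, 1]) ≠ 0 := by
  have := φ.isUnit_det'.ne_zero
  rwa [eq_basisMap (φ : Plane →ₗ[ℝ] Plane), det_basisMap] at this

lemma vadd_smul_dual_eq_slab (s : Plane) {r : ℝ} (hr : 0 < r) :
    s +ᵥ r • (LinearMap.adjoint (φ.symm : Plane →ₗ[ℝ] Plane) '' unitSquare) =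
      slab (φ !₂[1, 0]) (φ !₂[0, 1]) (inner ℝ (φ !₂[1, 0]) s) (inner ℝ (φ !₂[0, 1]) s) r := by
  have hA := fun v => adjoint_apply (φ : Plane →ₗ[ℝ] Plane) v
  simp only [LinearEquiv.coe_coe] at hA
  ext v
  rw [mem_vadd_smul]
  constructor
  · rintro ⟨_, ⟨y, ⟨hy0, hy1⟩, rfl⟩, rfl⟩
    simp only [slab, mem_ofPred_eq, ← (hA _).1, ← (hA _).2, map_add, map_smul,
      adjoint_adjoint_symm, PiLp.add_apply, PiLp.smul_apply, smul_eq_mul, mem_Icc]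
    refine ⟨⟨?_, ?_⟩, ?_, ?_⟩ <;> nlinarith [hy0.1, hy0.2, hy1.1, hy1.2]
  · rintro ⟨⟨h0, h0'⟩, h1, h1'⟩
    rw [← (hA _).1, ← (hA _).1] at h0 h0'
    rw [← (hA _).2, ← (hA _).2] at h1 h1'
    refine ⟨_, ⟨r⁻¹ • LinearMap.adjoint (φ : Plane →ₗ[ℝ] Plane) (v - s), ⟨?_, ?_⟩, rfl⟩, ?_⟩
    · simp only [map_sub, PiLp.smul_apply, PiLp.sub_apply, smul_eq_mul, mem_Icc]
      rw [inv_mul_le_iff₀ hr]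
      exact ⟨mul_nonneg (inv_nonneg.2 hr.le) (by linarith), by linarith⟩
    · simp only [map_sub, PiLp.smul_apply, PiLp.sub_apply, smul_eq_mul, mem_Icc]
      rw [inv_mul_le_iff₀ hr]
      exact ⟨mul_nonneg (inv_nonneg.2 hr.le) (by linarith), by linarith⟩
    · rw [map_smul, adjoint_symm_adjoint, smul_inv_smul₀ hr.ne']; abel

lemma unitSquare_eq_convexHull :
    unitSquare = convexHull ℝ {0, !₂[1, 0], !₂[1, 0] + !₂[0, 1], !₂[0, 1]} := by
  apply Subset.antisymm
  · rintro w ⟨h0, h1⟩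
    have hc := convex_convexHull ℝ
      ({0, !₂[1, 0], !₂[1, 0] + !₂[0, 1], !₂[0, 1]} : Set Plane)
    have r0 := hc (x := 0) (subset_convexHull ℝ _ (by simp)) (y := !₂[1, 0])
      (subset_convexHull ℝ _ (by simp)) (a := 1 - w 0) (b := w 0) (by linarith [h0.2]) h0.1 (by ring)
    have r1 := hc (x := !₂[0, 1]) (subset_convexHull ℝ _ (by simp)) (y := !₂[1, 0] + !₂[0, 1])
      (subset_convexHull ℝ _ (by simp)) (a := 1 - w 0) (b := w 0) (by linarith [h0.2]) h0.1 (by ring)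
    have r := hc r0 r1 (a := 1 - w 1) (b := w 1) (by linarith [h1.2]) h1.1 (by ring)
    convert r using 1
    ext i; fin_cases i <;> simp <;> ring
  · refine convexHull_min ?_ convex_unitSquare
    rintro v (rfl | rfl | rfl | rfl) <;> simp [unitSquare]

lemma linearIndependent_of_cross_ne_zero {u v : Plane} (h : cross u v ≠ 0) :
    LinearIndependent ℝ ![u, v] := by
  rw [LinearIndependent.pair_iff]
  intro s t hst
  have e0 := congrArg (fun w : Plane => w 0) hst
  have e1 := congrArg (fun w : Plane => w 1) hst
  simp at e0 e1
  constructor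
  · refine (mul_eq_zero.1 (?_ : s * cross u v = 0)).resolve_right h
    simp only [cross]; linear_combination v 1 * e0 - v 0 * e1
  · refine (mul_eq_zero.1 (?_ : t * cross u v = 0)).resolve_right h
    simp only [cross]; linear_combination u 0 * e1 - u 1 * e0

lemma isParallelogram_dual :
    IsParallelogram (LinearMap.adjoint (φ.symm : Plane →ₗ[ℝ] Plane) '' unitSquare) := by
  set M := LinearMap.adjoint (φ.symm : Plane →ₗ[ℝ] Plane)
  refine ⟨0, M !₂[1, 0], M !₂[0, 1], linearIndependent_of_cross_ne_zero ?_, ?_⟩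
  · rw [← det_basisMap, ← eq_basisMap, det_adjoint]
    exact φ.symm.isUnit_det'.ne_zero
  · rw [unitSquare_eq_convexHull, LinearMap.image_convexHull]
    simp [image_insert_eq]

variable {φ} {c₀ : Plane} {α : ℝ}

/-- Inscribed triangles of the second factor, after normalizing the first factor to a diamond. -/
lemma IsEHZCapacity.fits_dual {T : Set Plane} {c : ℝ} (hc : 0 < c)
    (hQ : IsConvexBody (c₀ +ᵥ (φ '' diamond α α))) (hT : IsConvexBody T)
    (hcap : IsEHZCapacity ((c₀ +ᵥ (φ '' diamond α α)) ×ˢ T) c) {W : Fin 3 → Plane} (B : Fin 3 → ℝ)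
    (hB : ∑ i, B i ≤ 1)
    (hW : ∀ i, ∀ k ∈ ({!₂[α, 0], !₂[α, 1], !₂[0, α], !₂[1, α]} : Set Plane),
      inner ℝ (W i - W (i + 1)) k ≤ B i) :
    Fits (c⁻¹ • (LinearMap.adjoint (φ : Plane →ₗ[ℝ] Plane) '' T)) W := by
  set M := LinearMap.adjoint (φ.symm : Plane →ₗ[ℝ] Plane) with hM
  obtain ⟨s, hs⟩ := hcap.fits hQ hT (W := fun i => c • M (W i)) (by
    have h1 : ∀ i, supp (c₀ +ᵥ (φ '' diamond α α)) (c • M (W i) - c • M (W (i + 1))) ≤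
        inner ℝ (c • M (W i) - c • M (W (i + 1))) c₀ + c * B i := by
      intro i
      refine supp_le (hQ.2.2.mono interior_subset) ?_
      intro x hx
      obtain ⟨_, ⟨k, hk, rfl⟩, rfl⟩ := mem_vadd_set.1 hx
      rw [diamond_eq] at hk
      have h2 := inner_le_of_mem_convexHull (hW i) k hk
      rw [vadd_eq_add, inner_add_right]
      gcongr
      rw [← smul_sub, ← map_sub, inner_smul_left, hM, inner_adjoint_symm, conj_trivial]
      gcongr
    calc len (c₀ +ᵥ (φ '' diamond α α)) (fun i => c • M (W i))
        ≤ ∑ i, (inner ℝ (c • M (W i) - c • M (W (i + 1))) c₀ + c * B i) :=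
          Finset.sum_le_sum fun i _ => h1 i
      _ = c * ∑ i, B i := by
          rw [Finset.sum_add_distrib, sum_inner_const (fun i => c • M (W i)), zero_add,
            Finset.mul_sum]
      _ ≤ c := by nlinarith)
  refine ⟨c⁻¹ • LinearMap.adjoint (φ : Plane →ₗ[ℝ] Plane) s, fun i => ?_⟩
  refine mem_smul_set.2 ⟨_, ⟨_, hs i, rfl⟩, ?_⟩
  simp only [hM, map_add, map_smul, adjoint_adjoint_symm, smul_add, inv_smul_smul₀ hc.ne']

lemma isConvexBody_diamond_image (hα : α ∈ Icc (0 : ℝ) 1) :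
    IsConvexBody (c₀ +ᵥ (φ '' diamond α α)) ∧
      volume.real (c₀ +ᵥ (φ '' diamond α α)) = |LinearMap.det (φ : Plane →ₗ[ℝ] Plane)| / 2 := by
  have hv : volume.real (c₀ +ᵥ (φ '' diamond α α)) =
      |LinearMap.det (φ : Plane →ₗ[ℝ] Plane)| / 2 := by
    have := volume_real_image (φ : Plane →ₗ[ℝ] Plane) (diamond α α)
    rw [LinearEquiv.coe_coe] at this
    rw [volume_real_vadd, this, volume_diamond hα hα]; ring
  have hd : 0 < |LinearMap.det (φ : Plane →ₗ[ℝ] Plane)| := abs_pos.2 φ.isUnit_det'.ne_zero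
  refine ⟨isConvexBody_of_volume_pos ?_ ?_ (by rw [hv]; positivity), hv⟩
  · exact ((isCompact_diamond α α).image
      (φ : Plane →ₗ[ℝ] Plane).continuous_of_finiteDimensional).vadd c₀
  · exact ((convex_convexHull ℝ _).linear_image (φ : Plane →ₗ[ℝ] Plane)).vadd c₀

lemma IsEqualityCase.isScaledTranslate_dual (hα0 : 0 < α) (hα1 : α < 1 / 2) {T : Set Plane}
    (h : IsEqualityCase (c₀ +ᵥ (φ '' diamond α α)) T) :
    IsScaledTranslate (LinearMap.adjoint (φ.symm : Plane →ₗ[ℝ] Plane) '' unitSquare) T := by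
  have hα : α ∈ Icc (0 : ℝ) 1 := ⟨hα0.le, by linarith⟩
  obtain ⟨hQ, hQv⟩ := isConvexBody_diamond_image (φ := φ) (c₀ := c₀) hα
  have hT := h.2.1
  obtain ⟨c, hc0, hc, hv⟩ := h.exists_pos
  set A := LinearMap.adjoint (φ : Plane →ₗ[ℝ] Plane) with hA
  have hT'v : volume.real (c⁻¹ • (A '' T)) = 1 := by
    rw [volume_real_smul, volume_real_image, hA, det_adjoint]
    rw [hQv] at hv
    have : |LinearMap.det (φ : Plane →ₗ[ℝ] Plane)| * volume.real T = c ^ 2 := by linarith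
    rw [this]; field_simp
  have hT' : IsConvexBody (c⁻¹ • (A '' T)) := isConvexBody_of_volume_pos
    ((hT.1.image A.continuous_of_finiteDimensional).smul _) ((hT.2.1.linear_image A).smul _)
    (by rw [hT'v]; norm_num)
  obtain ⟨m, hm⟩ : ∃ m, m = α / (1 - α) := ⟨_, rfl⟩
  have hmα : m * (1 - α) = α := by rw [hm]; field_simp [show 1 - α ≠ 0 by linarith]
  have hm0 : 0 < m := by rw [hm]; exact div_pos hα0 (by linarith)
  have hm1 : m < 1 := by rw [hm, div_lt_one (by linarith)]; linarith
  have i1 : (0 : Fin 3) + 1 = 1 := rfl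
  have i2 : (1 : Fin 3) + 1 = 2 := rfl
  have i3 : (2 : Fin 3) + 1 = 0 := rfl
  have fD : Fits (c⁻¹ • (A '' T)) ![0, diag, diag] := by
    refine hc.fits_dual hc0 hQ hT ![-α, 0, 1 + α] (by simp [Fin.sum_univ_three]) fun i k hk => ?_
    fin_cases i <;> rcases hk with (rfl | rfl | rfl | rfl) <;>
      simp [i1, i2, i3, diag, inner_plane]
    all_goals linarith
  have f1 : Fits (c⁻¹ • (A '' T)) ![(1 - m) • diag, 0, !₂[1, -m]] := by
    refine hc.fits_dual hc0 hQ hT ![(1 - m) * (1 + α), m * α, m * α]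
      (by simp [Fin.sum_univ_three]; linarith) fun i k hk => ?_
    fin_cases i <;> rcases hk with (rfl | rfl | rfl | rfl) <;>
      simp [i1, i2, i3, diag, inner_plane] <;> nlinarith
  have f2 : Fits (c⁻¹ • (A '' T)) ![(1 - m) • diag, 0, !₂[-m, 1]] := by
    refine hc.fits_dual hc0 hQ hT ![(1 - m) * (1 + α), m * α, m * α]
      (by simp [Fin.sum_univ_three]; linarith) fun i k hk => ?_
    fin_cases i <;> rcases hk with (rfl | rfl | rfl | rfl) <;>
      simp [i1, i2, i3, diag, inner_plane] <;> nlinarith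
  obtain ⟨s, hs⟩ := eq_unitSquare_of_fits hT' hT'v.le hm0 hm1 fD f1 f2
  refine ⟨c, hc0, c • LinearMap.adjoint (φ.symm : Plane →ₗ[ℝ] Plane) s, ?_⟩
  ext x
  rw [mem_vadd_smul]
  constructor
  · intro hx
    have : c⁻¹ • A x ∈ s +ᵥ unitSquare := hs ▸ smul_mem_smul_set (mem_image_of_mem A hx)
    obtain ⟨y, hy, hxy⟩ := mem_vadd_set.1 this
    refine ⟨_, mem_image_of_mem _ hy, ?_⟩
    rw [← smul_add, ← map_add, ← vadd_eq_add, hxy, map_smul, hA, adjoint_symm_adjoint,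
      smul_inv_smul₀ hc0.ne']
  · rintro ⟨_, ⟨y, hy, rfl⟩, rfl⟩
    have : s + y ∈ c⁻¹ • (A '' T) := hs ▸ mem_vadd_set.2 ⟨y, hy, rfl⟩
    obtain ⟨_, ⟨x, hx, rfl⟩, hxy⟩ := mem_smul_set.1 this
    rw [← smul_add, ← map_add, ← hxy, map_smul, hA, adjoint_symm_adjoint, smul_inv_smul₀ hc0.ne']
    exact hx

lemma isEqualityCase_dual (hα : α ∈ Icc (0 : ℝ) 1) {T : Set Plane}
    (h : IsScaledTranslate (LinearMap.adjoint (φ.symm : Plane →ₗ[ℝ] Plane) '' unitSquare) T) :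
    IsEqualityCase (c₀ +ᵥ (φ '' diamond α α)) T := by
  obtain ⟨r, hr, s, rfl⟩ := h
  obtain ⟨hQ, hQv⟩ := isConvexBody_diamond_image (φ := φ) (c₀ := c₀) hα
  have hd : 0 < |LinearMap.det (φ : Plane →ₗ[ℝ] Plane)| := abs_pos.2 φ.isUnit_det'.ne_zero
  have hdet : LinearMap.det (φ.symm : Plane →ₗ[ℝ] Plane) =
      (LinearMap.det (φ : Plane →ₗ[ℝ] Plane))⁻¹ := LinearEquiv.det_coe_symm φ
  have hPv : volume.real (LinearMap.adjoint (φ.symm : Plane →ₗ[ℝ] Plane) '' unitSquare) =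
      |LinearMap.det (φ : Plane →ₗ[ℝ] Plane)|⁻¹ := by
    rw [volume_real_image, det_adjoint, volume_real_unitSquare, mul_one, hdet, abs_inv]
  have hP : IsConvexBody (LinearMap.adjoint (φ.symm : Plane →ₗ[ℝ] Plane) '' unitSquare) :=
    isConvexBody_of_volume_pos
      (isCompact_unitSquare.image (LinearMap.continuous_of_finiteDimensional _))
      (convex_unitSquare.linear_image _) (by rw [hPv]; positivity)
  have hT := hP.vadd_smul hr s
  have hcr := cross_map_ne_zero φ
  have hslab := vadd_smul_dual_eq_slab φ s hr
  set d := r • LinearMap.adjoint (φ.symm : Plane →ₗ[ℝ] Plane) !₂[1, 0] with hdd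
  obtain ⟨V1, V2, V3, V4⟩ := vertices_mem_diamond α α
  have mem : ∀ k ∈ diamond α α, c₀ + φ k ∈ c₀ +ᵥ (φ '' diamond α α) := fun k hk =>
    mem_vadd_set.2 ⟨_, mem_image_of_mem _ hk, rfl⟩
  refine ⟨hQ, hT, r, isEHZCapacity_of_not_fits hQ hT (W := ![0, d, d]) ?_ ?_ ?_, ?_⟩
  · refine not_fits_segment (f := φ !₂[1, 0]) (x := inner ℝ (φ !₂[1, 0]) s) (a := r) ?_ ?_ ?_
    · intro h0; rw [h0] at hcr; simp [cross] at hcr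
    · intro v hv
      rw [hslab] at hv
      exact hv.1
    · rw [hdd, real_inner_comm, inner_smul_left, inner_adjoint_symm, inner_plane]; simp
  · refine len_segment_le (hQ.2.2.mono interior_subset) (x := inner ℝ d c₀) ?_
    intro v hv
    obtain ⟨_, ⟨k, hk, rfl⟩, rfl⟩ := mem_vadd_set.1 hv
    have hk' := (diamond_subset_unitSquare hα hα hk).1
    rw [vadd_eq_add, inner_add_right, hdd, inner_smul_left _ (φ k), inner_adjoint_symm,
      conj_trivial, (inner_basis k).1]
    constructor <;> nlinarith [hk'.1, hk'.2]
  · intro z hz γ hγ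
    obtain ⟨q, p, h, hA⟩ := hγ.exists_isCharPair hQ hT hz
    have h' := h.swap
    rw [hslab] at h'
    have key : ∀ k e : Plane, k ∈ diamond α α → k + e ∈ diamond α α →
        c₀ + φ k + (1 : ℝ) • φ e ∈ c₀ +ᵥ (φ '' diamond α α) := fun k e _ hke => by
      have := mem _ hke
      rwa [map_add, ← add_assoc, ← one_smul ℝ (φ e)] at this
    have := h'.slab_le hcr hQ.2.2 (r := 1) (mem _ V3) (key _ _ V3 (by
      convert V4 using 1; ext i; fin_cases i <;> simp)) (mem _ V1) (key _ _ V1 (by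
      convert V2 using 1; ext i; fin_cases i <;> simp))
    rw [h.pairing_swap] at this
    rw [hA]; linarith
  · rw [volume_real_prod, hQv, volume_real_vadd, volume_real_smul, hPv]
    field_simp

end Dual

/-- A quadrilateral with parallel sides `ab` and `dc` is an affine diamond. -/
lemma trapezoid_eq_diamond {a b c d : Plane} {l : ℝ} (hl0 : 0 < l)
    (h : c - d = l • (b - a)) (hcr : cross (b - a) (d - a) ≠ 0) :
    ∃ (φ : Plane ≃ₗ[ℝ] Plane) (c₀ : Plane),
      convexHull ℝ {a, b, c, d} = c₀ +ᵥ (φ '' diamond (l / (1 + l)) (l / (1 + l))) := by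
  set u := b - a with hu
  set v := d - a with hv
  set f₁ := u - v with hf₁
  set f₂ := -v - l • u with hf₂
  have hdet : LinearMap.det (basisMap f₁ f₂) ≠ 0 := by
    have e : cross f₁ f₂ = -(1 + l) * cross u v := by
      simp [hf₁, hf₂, cross]; ring
    rw [det_basisMap, e]
    exact mul_ne_zero (by linarith) hcr
  have hb : b = a + u := by rw [hu]; abel
  have hd : d = a + v := by rw [hv]; abel
  have hc : c = a + v + l • u := by rw [← h, ← hd]; abel
  have hl : (1 + l) ≠ 0 := by positivity
  refine ⟨LinearMap.equivOfDetNeZero _ hdet, a - (l / (1 + l)) • f₁ - f₂, ?_⟩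
  have hco : ∀ x, LinearMap.equivOfDetNeZero _ hdet x = basisMap f₁ f₂ x := fun x => rfl
  have himg : ⇑(LinearMap.equivOfDetNeZero _ hdet) '' diamond (l / (1 + l)) (l / (1 + l)) =
      basisMap f₁ f₂ '' diamond (l / (1 + l)) (l / (1 + l)) := image_congr fun x _ => hco x
  rw [himg, diamond_eq, LinearMap.image_convexHull, ← convexHull_vadd]
  congr 1
  simp only [image_insert_eq, image_singleton, vadd_set_insert, vadd_set_singleton, vadd_eq_add,
    basisMap_apply]
  have ea : a - (l / (1 + l)) • f₁ - f₂ +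
      ((!₂[l / (1 + l), 1] : Plane) 0 • f₁ + (!₂[l / (1 + l), 1] : Plane) 1 • f₂) = a := by
    simp
  have eb : a - (l / (1 + l)) • f₁ - f₂ +
      ((!₂[1, l / (1 + l)] : Plane) 0 • f₁ + (!₂[1, l / (1 + l)] : Plane) 1 • f₂) = b := by
    ext i; simp [hb, hf₁, hf₂]; field_simp; ring
  have ed : a - (l / (1 + l)) • f₁ - f₂ +
      ((!₂[0, l / (1 + l)] : Plane) 0 • f₁ + (!₂[0, l / (1 + l)] : Plane) 1 • f₂) = d := by
    ext i; simp [hd, hf₁, hf₂]; field_simp; ring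
  have ec : a - (l / (1 + l)) • f₁ - f₂ +
      ((!₂[l / (1 + l), 0] : Plane) 0 • f₁ + (!₂[l / (1 + l), 0] : Plane) 1 • f₂) = c := by
    ext i; simp [hc, hf₁, hf₂]; field_simp; ring
  rw [ea, eb, ec, ed]
  ext x
  simp only [mem_insert_iff, mem_singleton_iff]
  tauto

theorem exists_dualParallelogram {Q : Set Plane} (hQ : IsTrapezoid Q) (hQt : ¬ IsTriangle Q)
    (hQp : ¬ IsParallelogram Q) :
    ∃ P : Set Plane, IsParallelogram P ∧ IsDualParallelogram Q P ∧
      ∀ T : Set Plane, IsEqualityCase Q T ↔ IsScaledTranslate P T := by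
  have main : ∀ (a b c d : Plane) (l : ℝ), 0 < l → l < 1 → c - d = l • (b - a) →
      cross (b - a) (d - a) ≠ 0 → Q = convexHull ℝ {a, b, c, d} →
      ∃ P : Set Plane, IsParallelogram P ∧ IsDualParallelogram Q P ∧
        ∀ T : Set Plane, IsEqualityCase Q T ↔ IsScaledTranslate P T := by
    intro a b c d l hl0 hl1 h hcr hq
    obtain ⟨φ, c₀, e⟩ := trapezoid_eq_diamond hl0 h hcr
    rw [e] at hq
    have h0 : 0 < l / (1 + l) := by positivity
    have h1 : l / (1 + l) < 1 / 2 := by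
      rw [div_lt_div_iff₀ (by positivity) (by positivity)]; linarith
    have hα : l / (1 + l) ∈ Icc (0 : ℝ) 1 := ⟨h0.le, by linarith⟩
    refine ⟨_, isParallelogram_dual φ, ⟨φ, c₀, _, _, hα, hα, hq, rfl⟩, fun T => ?_⟩
    rw [hq]
    exact ⟨fun hE => hE.isScaledTranslate_dual h0 h1, isEqualityCase_dual hα⟩
  rcases hQ with hQ | ⟨a, b, c, d, hind, ⟨l, hl0, h⟩, hq⟩
  · exact absurd hQ hQt
  have hcr : cross (b - a) (d - a) ≠ 0 := cross_ne_zero_of_affineIndependent hind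
  rcases lt_trichotomy l 1 with hl | rfl | hl
  · exact main a b c d l hl0 hl h hcr hq
  · refine absurd ⟨a, b - a, d - a, linearIndependent_of_cross_ne_zero hcr, ?_⟩ hQp
    rw [one_smul] at h
    have e1 : a + (b - a) = b := by abel
    have e2 : a + (d - a) = d := by abel
    have e3 : b + (d - a) = c := by rw [← sub_add_cancel c d, h]; abel
    rw [hq, e1, e2, e3]
  · refine main d c b a l⁻¹ (by positivity) (inv_lt_one_of_one_lt₀ hl) ?_ ?_ ?_
    · rw [h, inv_smul_smul₀ hl0.ne']
    · rw [h]
      have : cross (l • (b - a)) (a - d) = -l * cross (b - a) (d - a) := by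
        simp [cross]; ring
      rw [this]
      exact mul_ne_zero (by linarith) hcr
    · rw [hq]
      congr 1
      ext x
      simp only [mem_insert_iff, mem_singleton_iff]
      tauto

end Viterbo

end

theorem theorem1p2 :
    (∀ D : Set Viterbo.Plane, Viterbo.IsTriangle D → ∀ T : Set Viterbo.Plane,
      (Viterbo.IsEqualityCase D T ↔
        ∃ S ∈ Viterbo.minimalHulls D, Viterbo.IsScaledTranslate S T)) ∧
    (∀ S : Set Viterbo.Plane, Viterbo.IsAxisParallelSquare S → ∀ T : Set Viterbo.Plane,
      (Viterbo.IsEqualityCase S T ↔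
        ∃ a₁ ∈ Set.Icc (0 : ℝ) 1, ∃ a₂ ∈ Set.Icc (0 : ℝ) 1,
          Viterbo.IsScaledTranslate (Viterbo.diamond a₁ a₂) T)) ∧
    (∀ Q : Set Viterbo.Plane, Viterbo.IsTrapezoid Q → ¬ Viterbo.IsTriangle Q →
      ¬ Viterbo.IsParallelogram Q →
      ∃ P : Set Viterbo.Plane, Viterbo.IsParallelogram P ∧ Viterbo.IsDualParallelogram Q P ∧
        ∀ T : Set Viterbo.Plane,
          (Viterbo.IsEqualityCase Q T ↔ Viterbo.IsScaledTranslate P T)) := by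
  refine ⟨fun D hD T => ?_, fun S hS T => ?_, fun Q hQ hQt hQp => ?_⟩
  · obtain ⟨v₀, v₁, v₂, hX, rfl⟩ := hD.exists_vertices
    exact Viterbo.isEqualityCase_triangle_iff hX T
  · obtain ⟨x, y, a, ha, rfl⟩ := hS
    exact Viterbo.isEqualityCase_square_iff x y ha T
  · exact Viterbo.exists_dualParallelogram hQ hQt hQp
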